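/- Let $\mathfrak o$ be a compact (that is, complete with finite residue field) discrete valuation ring with maximal ideal $\mathfrak p=(\pi)$ and residue field $\mathbf k$ of cardinality $q$ and odd characteristic. Let $\mathfrak O\supset\mathfrak o$ be an unramified quadratic extension (a discrete valuation ring, so with maximal ideal $\pi\mathfrak O$), and let $x\mapsto x^\circ$ be its non-trivial automorphism over $\mathfrak o$. For $\ell\ge 1$ put $\mathfrak o_\ell=\mathfrak o/\mathfrak p^\ell$ and $\mathfrak O_\ell=\mathfrak O/\pi^\ell\mathfrak O$. For $A=(a_{i,j})\in \mathrm{Mat}_3(\mathfrak O_\ell)$ let $A^\star=(a_{4-j,4-i}^\circ)_{i,j}$, and let $\mathrm{GU}_3(\mathfrak o_\ell)=\{A\in\mathrm{GL}_3(\mathfrak O_\ell)\mid A^\star A=I\}$. For $\delta\in\pi\mathfrak o_\ell$ let $$\mathbf c=\begin{pmatrix}0&0&1\\0&\delta&0\\\delta^2&0&0\end{pmatrix},$$ and let $\mathbf J_\delta(\mathfrak o_\ell)$ be either $\mathbf J_{L,\delta}(\mathfrak o_\ell)$, the centraliser of $\mathbf c$ in $\mathrm{GL}_3(\mathfrak o_\ell)$,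 in which case put $\epsilon=1$; or $\mathbf J_{U,\delta}(\mathfrak o_\ell)$, the centraliser of $\mathbf c$ in $\mathrm{GU}_3(\mathfrak o_\ell)$, in which case put $\epsilon=-1$. For a finite group $G$ let $\zeta_G(s)=\sum_{\rho}(\dim\rho)^{-s}$ be its representation zeta function, where $\rho$ runs over the (finitely many) isomorphism classes of irreducible finite-dimensional complex representations of $G$. Then for every $s\in\mathbb C$, if $\ell=1$, $$\zeta_{\mathbf J_\delta(\mathbf k)}(s)=(q-\epsilon)^2+(q^2-1)(q-\epsilon)^{-s}+(q-1)(q-\epsilon)^2q^{-s},$$ and if $\ell\ge 2$, $$\zeta_{\mathbf J_\delta(\mathfrak o_\ell)}(s)=q^{2\ell-2}(q-\epsilon)^2+(q-\epsilon)^2(q-1)\sum_{i=1}^{\ell}q^{i+2\ell-3}q^{-is}+(q^2-1)\sum_{i=0}^{\ell-1}q^{i+2\ell-2}\bigl(q^i(q-\epsilon)\bigr)^{-s}.$$ In particular, $\zeta_{\mathbf J_\delta(\mathfrak o_\ell)}$ depends only on $q$, $\ell$ and $\epsilon$, and not on $\delta$. -/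

import Mathlib

open IsLocalRing

noncomputable section

/-! ### Irreducible representations and the representation zeta function -/

/-- Irreducible complex representations of `G` on `ℂⁿ`. -/
abbrev IrrepOfDim (G : Type*) [Group G] (n : ℕ) : Type _ :=
  {ρ : Representation ℂ G (Fin n → ℂ) // ρ.IsIrreducible}

/-- Isomorphism of irreducible representations on `ℂⁿ`. -/
def irrepSetoid (G : Type*) [Group G] (n : ℕ) : Setoid (IrrepOfDim G n) where
  r ρ σ := Nonempty (Representation.Equiv ρ.1 σ.1)
  iseqv :=
    { refl := fun ρ => ⟨Representation.Equiv.refl ρ.1⟩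
      symm := fun ⟨e⟩ => ⟨e.symm⟩
      trans := fun ⟨e⟩ ⟨f⟩ => ⟨e.trans f⟩ }

/-- `Irr(G)`: the isomorphism classes of finite-dimensional irreducible complex representations
of `G`, sorted by dimension (the first component). -/
def Irr (G : Type*) [Group G] : Type _ :=
  Σ n : ℕ, Quotient (irrepSetoid G n)

/-- The dimension of a class in `Irr(G)`. -/
def Irr.dim {G : Type*} [Group G] (ρ : Irr G) : ℕ := ρ.1

/-- The representation zeta function `ζ_G(s) = ∑_{ρ ∈ Irr(G)} (dim ρ)^{-s}`. -/
def repZeta (G : Type*) [Group G] (s : ℂ) : ℂ :=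
  ∑' ρ : Irr G, (ρ.dim : ℂ) ^ (-s)

/-! ### The unitary group -/

section Unitary

variable {R : Type*} [CommRing R] (d : ℕ)

/-- The permutation matrix of the longest Weyl element. -/
def weylMatrix (R : Type*) [CommRing R] (d : ℕ) : Matrix (Fin d) (Fin d) R :=
  Matrix.of fun i j => if j = Fin.rev i then 1 else 0

/-- The operation `(a_{i,j})^⋆ = W (a_{j,i}°) W⁻¹ = (a°_{d+1-j,d+1-i})`
for a ring endomorphism `a ↦ a°`. -/
def hermStar (c : R →+* R) {d : ℕ} (A : Matrix (Fin d) (Fin d) R) : Matrix (Fin d) (Fin d) R :=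
  Matrix.of fun i j => c (A (Fin.rev j) (Fin.rev i))

theorem weylMatrix_mul_self : weylMatrix R d * weylMatrix R d = 1 := by
  ext i j
  rw [Matrix.mul_apply, Finset.sum_eq_single (Fin.rev i)]
  · simp [weylMatrix, Matrix.one_apply, eq_comm]
  · intro k _ hk
    simp [weylMatrix, hk]
  · simp

theorem hermStar_eq (c : R →+* R) {d : ℕ} (A : Matrix (Fin d) (Fin d) R) :
    hermStar c A = weylMatrix R d * (A.map c).transpose * (weylMatrix R d)⁻¹ := by
  rw [Matrix.inv_eq_left_inv (weylMatrix_mul_self (R := R) d)]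
  ext i j
  have key : ∀ x : Fin d, (j = Fin.rev x) ↔ (x = Fin.rev j) := fun x => by
    rw [eq_comm, Fin.rev_eq_iff]
  simp [hermStar, weylMatrix, Matrix.mul_apply, key]

theorem hermStar_one (c : R →+* R) {d : ℕ} :
    hermStar c (1 : Matrix (Fin d) (Fin d) R) = 1 := by
  ext i j
  simp [hermStar, Matrix.one_apply, eq_comm]

theorem hermStar_mul (c : R →+* R) {d : ℕ} (A B : Matrix (Fin d) (Fin d) R) :
    hermStar c (A * B) = hermStar c B * hermStar c A := by
  ext i j
  simp only [hermStar, Matrix.mul_apply, Matrix.of_apply, map_sum, map_mul]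
  rw [← Equiv.sum_comp Fin.revPerm]
  simp [mul_comm]

/-- `GU_d = {A ∈ GL_d(R) | A^⋆ A = I}`. -/
def GU (c : R →+* R) (d : ℕ) : Subgroup (GL (Fin d) R) where
  carrier := {A | hermStar c (A : Matrix (Fin d) (Fin d) R) * (A : Matrix (Fin d) (Fin d) R) = 1}
  one_mem' := by simp [hermStar_one]
  mul_mem' := by
    intro A B hA hB
    simp only [Set.mem_ofPred_eq, Units.val_mul, hermStar_mul] at *
    rw [mul_assoc, ← mul_assoc _ (A : Matrix (Fin d) (Fin d) R), hA, one_mul, hB]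
  inv_mem' := by
    intro A hA
    simp only [Set.mem_ofPred_eq] at *
    have h : hermStar c (A : Matrix (Fin d) (Fin d) R) = ((A⁻¹ : GL (Fin d) R) : Matrix _ _ R) :=
      (Units.inv_eq_of_mul_eq_one_left hA).symm
    rw [← h, ← hermStar_mul, mul_eq_one_comm.mp hA, hermStar_one]

end Unitary

/-! ### The centralisers -/

/-- The matrix `𝐜`, with rows `(0, 0, 1)`, `(0, δ, 0)`, `(δ², 0, 0)`. -/
def cMatrix {R : Type*} [CommRing R] (δ : R) : Matrix (Fin 3) (Fin 3) R :=
  !![0, 0, 1; 0, δ, 0; δ ^ 2, 0, 0]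

/-- The centraliser in `GL_d(R)` of a (not necessarily invertible) matrix. -/
def centGL {R : Type*} [CommRing R] {d : ℕ} (C : Matrix (Fin d) (Fin d) R) :
    Subgroup (GL (Fin d) R) where
  carrier := {g | Commute (g : Matrix (Fin d) (Fin d) R) C}
  one_mem' := Commute.one_left _
  mul_mem' := fun ha hb => Commute.mul_left ha hb
  inv_mem' := fun ha => Commute.units_inv_left ha

section Levels

variable (o : Type*) [CommRing o] [IsLocalRing o]
variable (O : Type*) [CommRing O] [Algebra o O]

/-- `o_ℓ = o / 𝔭^ℓ`. -/
abbrev oLevel (ℓ : ℕ) : Type _ := o ⧸ (maximalIdeal o ^ ℓ)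

/-- `O_ℓ = O / 𝔭^ℓ O`; for an unramified extension of discrete valuation rings, `𝔭 O` is the
maximal ideal of `O`. -/
abbrev OLevel (ℓ : ℕ) : Type _ := O ⧸ (maximalIdeal o ^ ℓ).map (algebraMap o O)

variable {o O}

/-- The endomorphism of `O_ℓ` induced by an automorphism `x ↦ x°` of `O` over `o`. -/
def conjLevel (c : O ≃ₐ[o] O) (ℓ : ℕ) : OLevel o O ℓ →+* OLevel o O ℓ :=
  Ideal.quotientMap _ (c : O →+* O) (by
    rw [Ideal.map_le_iff_le_comap]
    intro x hx
    have h := Ideal.mem_map_of_mem (algebraMap o O) hx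
    simpa using h)

/-- The natural map `o_ℓ → O_ℓ`. -/
def levelMap (ℓ : ℕ) : oLevel o ℓ →+* OLevel o O ℓ :=
  Ideal.quotientMap _ (algebraMap o O) Ideal.le_comap_map

/-- `J_{L,δ}(o_ℓ)`, the centraliser of `𝐜` in `GL_3(o_ℓ)`. -/
def JL {ℓ : ℕ} (δ : oLevel o ℓ) : Subgroup (GL (Fin 3) (oLevel o ℓ)) :=
  centGL (cMatrix δ)

/-- `J_{U,δ}(o_ℓ)`, the centraliser of `𝐜` in `GU_3(o_ℓ) ≤ GL_3(O_ℓ)`. -/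
def JU (c : O ≃ₐ[o] O) {ℓ : ℕ} (δ : oLevel o ℓ) : Subgroup (GL (Fin 3) (OLevel o O ℓ)) :=
  GU (conjLevel c ℓ) 3 ⊓ centGL (cMatrix (levelMap ℓ δ))

end Levels

/-! ### The closed formulae -/

/-- The formula for `ℓ = 1`. -/
def zetaFormulaOne (q : ℕ) (ε : ℤ) (s : ℂ) : ℂ :=
  ((q : ℂ) - ε) ^ 2 + ((q : ℂ) ^ 2 - 1) * ((q : ℂ) - ε) ^ (-s)
    + ((q : ℂ) - 1) * ((q : ℂ) - ε) ^ 2 * (q : ℂ) ^ (-s)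

/-- The formula for `ℓ ≥ 2`. -/
def zetaFormula (q : ℕ) (ε : ℤ) (ℓ : ℕ) (s : ℂ) : ℂ :=
  (q : ℂ) ^ (2 * ℓ - 2) * ((q : ℂ) - ε) ^ 2
    + ((q : ℂ) - ε) ^ 2 * ((q : ℂ) - 1) *
        ∑ i ∈ Finset.Icc 1 ℓ, (q : ℂ) ^ (i + 2 * ℓ - 3) * (q : ℂ) ^ (-((i : ℂ) * s))
    + ((q : ℂ) ^ 2 - 1) *
        ∑ i ∈ Finset.range ℓ, (q : ℂ) ^ (i + 2 * ℓ - 2) *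
          ((q : ℂ) ^ i * ((q : ℂ) - ε)) ^ (-s)

end

/-!
The centraliser of `𝐜` in the `3 × 3` matrices is an algebra of rank five. In suitable coordinates
it depends on `δ` only through `τ = 2 δ`, and it carries an involution `star` once the coefficients
are extended to a quadratic algebra `S = R[ξ] / (ξ² - u)` over `R = 𝔬_ℓ`; this is `Cen R u τ`. Both
families of groups are its groups of unitary elements. For `u = 1` the algebra `S` splits, and the
unitary group is the centraliser in the general linear group (`Cen.unitaryEquivGL`); if `u` is a
unit which is not a square modulo `𝔭`, then `S = 𝔒_ℓ`, and the unitary group is the centraliser in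
`GU₃` (`exists_generator`, `exists_levelEquiv`, `Cen.unitaryEquivGU`). The two cases differ only in
the number `N = q - ε` of elements of norm one in the quadratic algebra over the residue field.

Let `G = unitary (Cen R u τ)` with `ℓ ≥ 2`. The congruence subgroup of `G` modulo `π ^ (ℓ - 1)`, of
order `q ^ 5`, contains the off-diagonal subgroup of the elements with `a = d = 1`, of order
`q ^ 3`, and this contains the corner subgroup of the elements for which moreover `b = e = 0`, of
order `q`. The irreducible representations of `G` fall into three kinds.

* Those which are nontrivial on the corner subgroup have dimension `q ^ ℓ`
  (`Cen.finrank_eq_of_corner`).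
* Those which are trivial on the corner subgroup, but not on the off-diagonal one, have dimension
  `q ^ (ℓ - 1) N` (`Cen.finrank_eq_of_offDiag`).
* Those which are trivial on the off-diagonal subgroup are twists of representations of the group
  of level `ℓ - 1` by linear characters, which come from the coordinate `a` and a `2 × 2`
  determinant (`Cen.diagHom`). Each representation of level `ℓ - 1` arises in `q ^ 2` ways
  (`Irr.sum_trivialOn_eq_smul`).

The sums of the squares of the dimensions of the representations of `G` and of its quotients by the
two small subgroups then determine the numbers of representations of the first two kinds
(`Irr.sum_eq_of_chain`), which yields a recursion in `ℓ` (`Cen.sum_irr_eq`). The closed formula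
satisfies the same recursion (`zetaFormula_succ`). At level one, `τ = 0`, the off-diagonal subgroup
is a Heisenberg group with abelian quotient, and the dimensions are computed directly
(`Cen.sum_irr_eq_of_level_one`).

The dimensions at level `ℓ ≥ 2` come from the orbit method. Let `h = ⌊ℓ / 2⌋`, `m = ℓ - h`, and let
`𝔥`, `𝔨` be the ideals of the multiples of `π ^ h` and of `π ^ m`. A truncated exponential
parametrises the unitary elements of `1 + 𝔥` by the skew elements of `𝔥`, and weights for the
abelian group of the unitary elements of `1 + 𝔨` are given by linear functionals `μ` on the algebra.
Nontriviality on the small subgroups makes `μ` regular, in the sense that the commutator pairing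
`μ (Y X - X Y)`, a triple product of vectors in `S³`, has a unimodular coefficient vector. Then the
centraliser of `μ` is commutative (`Cen.Functional.Regular.mul_comm`), the stabiliser of the weight
is the product of the unitary elements of `1 + 𝔥` and of the unitary elements of this centraliser,
and a Heisenberg argument gives the dimension of the weight space
(`Representation.IsIrreducible.finrank_sq_mul_card`, `HeisPair.exists_matches_finrank_sq`). By
Clifford theory the dimension of the representation is that of the weight space times the length of
the orbit of the weight (`Representation.IsIrreducible.card_charStab_mul_finrank`). The orders of
all the groups involved are obtained from the Cayley transform, which counts unitary elements of
`1 + J` for a nil ideal `J` by skew elements of `J` (`card_unitary_sub_one_mem`).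
-/

noncomputable section

/-! ### Irreducible representations of finite groups -/

namespace Representation

variable {G V : Type*} [Group G] [AddCommGroup V] [Module ℂ V] {ρ : Representation ℂ G V}

theorem isIrreducible_iff_submodule :
    ρ.IsIrreducible ↔ Nontrivial V ∧
      ∀ W : Submodule ℂ V, (∀ g, ∀ v ∈ W, ρ g v ∈ W) → W = ⊥ ∨ W = ⊤ := by
  constructor
  · intro h
    refine ⟨?_, fun W hW => ?_⟩
    · obtain ⟨x, y, hxy⟩ := h.toNontrivial
      by_contra hV
      rw [not_nontrivial_iff_subsingleton] at hV
      exact hxy (Subrepresentation.toSubmodule_injective (Subsingleton.elim _ _))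
    · rcases h.eq_bot_or_eq_top (⟨W, hW⟩ : Subrepresentation ρ) with h | h
      · left; exact congrArg Subrepresentation.toSubmodule h
      · right; exact congrArg Subrepresentation.toSubmodule h
  · rintro ⟨hV, h⟩
    refine { exists_pair_ne := ⟨⊥, ⊤, fun e => ?_⟩, eq_bot_or_eq_top := fun W => ?_ }
    · exact bot_ne_top (α := Submodule ℂ V) (congrArg Subrepresentation.toSubmodule e)
    · rcases h W.toSubmodule W.apply_mem_toSubmodule with h | h
      · left; exact Subrepresentation.toSubmodule_injective h
      · right; exact Subrepresentation.toSubmodule_injective h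

theorem IsIrreducible.nontrivial (h : ρ.IsIrreducible) : Nontrivial V :=
  (isIrreducible_iff_submodule.1 h).1

/-- Schur's lemma, for endomorphisms that commute with the action. -/
theorem IsIrreducible.exists_eq_smul_one [FiniteDimensional ℂ V] (h : ρ.IsIrreducible)
    (f : Module.End ℂ V) (hf : ∀ g, Commute (ρ g) f) : ∃ c : ℂ, f = c • 1 := by
  have := h.nontrivial
  obtain ⟨c, hc⟩ := Module.End.exists_eigenvalue f
  refine ⟨c, ?_⟩
  have := ((isIrreducible_iff_submodule.1 h).2 (f.eigenspace c) ?_).resolve_left hc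
  · ext v
    have hv : v ∈ f.eigenspace c := this ▸ Submodule.mem_top
    simpa using Module.End.mem_eigenspace_iff.1 hv
  · intro g v hv
    rw [Module.End.mem_eigenspace_iff] at hv ⊢
    rw [← Module.End.mul_apply, ← (hf g).eq, Module.End.mul_apply, hv, map_smul]

/-- If the operators of an irreducible representation commute pairwise, it is one-dimensional. -/
theorem IsIrreducible.finrank_eq_one [FiniteDimensional ℂ V] (h : ρ.IsIrreducible)
    (hc : ∀ g g', Commute (ρ g) (ρ g')) : Module.finrank ℂ V = 1 := by
  have := h.nontrivial
  have hs : ∀ g, ∃ c : ℂ, ρ g = c • 1 := fun g => h.exists_eq_smul_one _ fun g' => hc g' g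
  obtain ⟨v, hv⟩ := exists_ne (0 : V)
  refine _root_.finrank_eq_one v hv fun w => ?_
  have := ((isIrreducible_iff_submodule.1 h).2 (ℂ ∙ v) ?_).resolve_left (by simpa using hv)
  · exact Submodule.mem_span_singleton.1 (this ▸ Submodule.mem_top)
  · intro g x hx
    obtain ⟨c, hc⟩ := hs g
    rw [hc]
    exact Submodule.smul_mem _ _ hx

/-! ### Weight spaces for a normal subgroup -/

variable (ρ) in
/-- The subspace on which the subgroup `K` acts through the function `χ`. -/
def weightSpace (K : Subgroup G) (χ : G → ℂ) : Submodule ℂ V where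
  carrier := {v | ∀ k ∈ K, ρ k v = χ k • v}
  add_mem' := fun hv hw k hk => by simp [hv k hk, hw k hk]
  zero_mem' := fun k _ => by rw [map_zero, smul_zero]
  smul_mem' := fun c v hv k hk => by rw [map_smul, hv k hk, smul_comm]

/-- The stabiliser of (the restriction to `K` of) the function `χ` under conjugation. -/
def charStab (K : Subgroup G) [K.Normal] (χ : G → ℂ) : Subgroup G where
  carrier := {g | ∀ k ∈ K, χ (g * k * g⁻¹) = χ k}
  one_mem' := by simp
  mul_mem' := by
    intro a b ha hb k hk
    have := ha _ (Subgroup.Normal.conj_mem ‹_› k hk b)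
    rw [← hb k hk, ← this]
    congr 1
    group
  inv_mem' := by
    intro a ha k hk
    have := ha _ (Subgroup.Normal.conj_mem ‹_› k hk a⁻¹)
    rw [← this]
    congr 1
    group

theorem mem_charStab {K : Subgroup G} [K.Normal] {χ : G → ℂ} {g : G} :
    g ∈ charStab K χ ↔ ∀ k ∈ K, χ (g * k * g⁻¹) = χ k := Iff.rfl

theorem apply_mem_weightSpace {K : Subgroup G} [K.Normal] {χ : G → ℂ} {g : G}
    (hg : g ∈ charStab K χ) {v : V} (hv : v ∈ weightSpace ρ K χ) :
    ρ g v ∈ weightSpace ρ K χ := by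
  intro k hk
  have hk' := Subgroup.Normal.conj_mem ‹_› k hk g⁻¹
  have h1 := (charStab K χ).inv_mem hg k hk
  have : k * g = g * (g⁻¹ * k * g⁻¹⁻¹) := by group
  rw [← Module.End.mul_apply, ← map_mul, this, map_mul, Module.End.mul_apply, hv _ hk', h1,
    map_smul]

variable (ρ) in
/-- The action of the stabiliser of `χ` on the weight space of `χ`. -/
def weightRep (K : Subgroup G) [K.Normal] (χ : G → ℂ) :
    Representation ℂ (charStab K χ) (weightSpace ρ K χ) where
  toFun g := (ρ g).restrict fun _ hv => apply_mem_weightSpace g.2 hv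
  map_one' := by ext; simp
  map_mul' x y := by ext; simp

@[simp]
theorem coe_weightRep_apply (K : Subgroup G) [K.Normal] (χ : G → ℂ) (g : charStab K χ)
    (v : weightSpace ρ K χ) : (weightRep ρ K χ g v : V) = ρ g v := rfl

section Projection

variable {K : Subgroup G} {χ : G → ℂ}

variable (ρ K χ) in
/-- The projection onto the weight space of `χ` (when that space is non-zero). -/
def weightProj : Module.End ℂ V :=
  (Nat.card K : ℂ)⁻¹ • ∑ᶠ k : K, χ (k : G)⁻¹ • ρ k

theorem weight_mul (hχ : weightSpace ρ K χ ≠ ⊥) {k k' : G} (hk : k ∈ K) (hk' : k' ∈ K) :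
    χ (k * k') = χ k * χ k' := by
  obtain ⟨v, hv, hv0⟩ := Submodule.exists_mem_ne_zero_of_ne_bot hχ
  have h1 := hv _ (K.mul_mem hk hk')
  rw [map_mul, Module.End.mul_apply, hv _ hk', map_smul, hv _ hk, smul_smul, mul_comm] at h1
  exact (smul_left_injective ℂ hv0 h1).symm

theorem weight_one (hχ : weightSpace ρ K χ ≠ ⊥) : χ 1 = 1 := by
  obtain ⟨v, hv, hv0⟩ := Submodule.exists_mem_ne_zero_of_ne_bot hχ
  have h1 := hv _ K.one_mem
  rw [map_one, Module.End.one_apply] at h1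
  exact smul_left_injective ℂ hv0 (by simpa using h1.symm)

variable [Finite G]

theorem apply_mul_weightProj (hχ : weightSpace ρ K χ ≠ ⊥) {k : G} (hk : k ∈ K) :
    ρ k * weightProj ρ K χ = χ k • weightProj ρ K χ := by
  have := Fintype.ofFinite K
  rw [weightProj, mul_smul_comm, smul_comm (χ k), finsum_eq_sum_of_fintype, Finset.mul_sum]
  congr 1
  rw [Finset.smul_sum]
  refine Fintype.sum_equiv (Equiv.mulLeft (⟨k, hk⟩ : K)) _ _ fun x => ?_
  have h1 : χ (k * ((k * x : G))⁻¹) = χ k * χ ((k * x : G)⁻¹) :=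
    weight_mul hχ hk (K.inv_mem (K.mul_mem hk x.2))
  have h2 : k * ((k * x : G))⁻¹ = (k * (x : G)⁻¹ * k⁻¹) := by group
  have h3 : χ (k * (x : G)⁻¹ * k⁻¹) = χ (x : G)⁻¹ := by
    rw [weight_mul hχ (K.mul_mem hk (K.inv_mem x.2)) (K.inv_mem hk),
      weight_mul hχ hk (K.inv_mem x.2), mul_comm, ← mul_assoc,
      ← weight_mul hχ (K.inv_mem hk) hk, inv_mul_cancel, weight_one hχ, one_mul]
  simp only [Equiv.coe_mulLeft, Subgroup.coe_mul, map_mul, mul_smul_comm, smul_smul]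
  rw [← h1, h2, h3]

theorem weightProj_mul_apply (hχ : weightSpace ρ K χ ≠ ⊥) {k : G} (hk : k ∈ K) :
    weightProj ρ K χ * ρ k = χ k • weightProj ρ K χ := by
  have := Fintype.ofFinite K
  rw [weightProj, smul_mul_assoc, smul_comm (χ k), finsum_eq_sum_of_fintype, Finset.sum_mul]
  congr 1
  rw [Finset.smul_sum]
  refine Fintype.sum_equiv (Equiv.mulRight (⟨k, hk⟩ : K)) _ _ fun x => ?_
  have h1 : χ (k * ((x * k : G))⁻¹) = χ k * χ ((x * k : G)⁻¹) :=
    weight_mul hχ hk (K.inv_mem (K.mul_mem x.2 hk))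
  have h2 : k * ((x * k : G))⁻¹ = (x : G)⁻¹ := by group
  simp only [Equiv.coe_mulRight, Subgroup.coe_mul, map_mul, smul_mul_assoc, smul_smul]
  rw [← h1, h2]

theorem weightProj_apply_of_mem (hχ : weightSpace ρ K χ ≠ ⊥) {v : V}
    (hv : v ∈ weightSpace ρ K χ) : weightProj ρ K χ v = v := by
  have := Fintype.ofFinite K
  rw [weightProj, finsum_eq_sum_of_fintype]
  have : ∀ k : K, (χ (k : G)⁻¹ • ρ k) v = v := fun k => by
    rw [LinearMap.smul_apply, hv _ k.2, smul_smul, ← weight_mul hχ (K.inv_mem k.2) k.2,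
      inv_mul_cancel, weight_one hχ, one_smul]
  simp only [LinearMap.smul_apply, LinearMap.sum_apply] at this ⊢
  simp only [this]
  simp [← Nat.cast_smul_eq_nsmul ℂ, smul_smul]

theorem weightProj_mem (hχ : weightSpace ρ K χ ≠ ⊥) (v : V) :
    weightProj ρ K χ v ∈ weightSpace ρ K χ := fun k hk => by
  rw [← Module.End.mul_apply, apply_mul_weightProj hχ hk, LinearMap.smul_apply]

theorem isProj_weightProj (hχ : weightSpace ρ K χ ≠ ⊥) :
    LinearMap.IsProj (weightSpace ρ K χ) (weightProj ρ K χ) :=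
  ⟨weightProj_mem hχ, fun _ => weightProj_apply_of_mem hχ⟩

/-- A translate of a weight space by an element outside the stabiliser is another weight space,
so that it is killed by the projection. -/
theorem weightProj_apply_apply_eq_zero [K.Normal] (hχ : weightSpace ρ K χ ≠ ⊥) {g : G}
    (hg : g ∉ charStab K χ) {v : V} (hv : v ∈ weightSpace ρ K χ) :
    weightProj ρ K χ (ρ g v) = 0 := by
  rw [mem_charStab] at hg
  push Not at hg
  obtain ⟨k, hk, hne⟩ := hg
  have h1 : weightProj ρ K χ (ρ (g * k * g⁻¹) (ρ g v)) =
      χ (g * k * g⁻¹) • weightProj ρ K χ (ρ g v) := by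
    rw [← Module.End.mul_apply, weightProj_mul_apply hχ (Subgroup.Normal.conj_mem ‹_› k hk g),
      LinearMap.smul_apply]
  have h2 : ρ (g * k * g⁻¹) (ρ g v) = χ k • ρ g v := by
    rw [← Module.End.mul_apply, ← map_mul, inv_mul_cancel_right, map_mul, Module.End.mul_apply,
      hv k hk, map_smul]
  rw [h2, map_smul] at h1
  by_contra h0
  exact hne (smul_left_injective ℂ h0 h1.symm)

/-- The weight spaces in the orbit of `χ` have equal dimension and fill an irreducible
representation. -/
theorem IsIrreducible.card_charStab_mul_finrank [K.Normal] [FiniteDimensional ℂ V]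
    (h : ρ.IsIrreducible) (hχ : weightSpace ρ K χ ≠ ⊥) :
    Nat.card (charStab K χ) * Module.finrank ℂ V =
      Nat.card G * Module.finrank ℂ (weightSpace ρ K χ) := by
  classical
  have := Fintype.ofFinite G
  set e := weightProj ρ K χ with he
  -- the average of the conjugates of the projection is a scalar, whose trace is known
  obtain ⟨c, hc⟩ := h.exists_eq_smul_one (∑ g : G, ρ g * e * ρ g⁻¹) (by
    intro x
    rw [commute_iff_eq, Finset.mul_sum, Finset.sum_mul]
    refine Fintype.sum_equiv (Equiv.mulLeft x) _ _ fun g => ?_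
    simp only [Equiv.coe_mulLeft, mul_inv_rev, map_mul, ← mul_assoc]
    rw [mul_assoc _ (ρ x⁻¹), ← map_mul ρ x⁻¹, inv_mul_cancel, map_one, mul_one])
  have htr := congrArg (LinearMap.trace ℂ V) hc
  have h1 : ∀ g : G, LinearMap.trace ℂ V (ρ g * e * ρ g⁻¹) =
      Module.finrank ℂ (weightSpace ρ K χ) := fun g => by
    rw [LinearMap.trace_mul_comm, ← mul_assoc, ← map_mul, inv_mul_cancel, map_one, one_mul,
      (isProj_weightProj hχ).trace]
  simp only [map_sum, h1, Finset.sum_const, Finset.card_univ, map_smul, LinearMap.trace_one,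
    nsmul_eq_mul, smul_eq_mul] at htr
  -- evaluating at a weight vector computes the scalar as the order of the stabiliser
  have hcS : c = Nat.card (charStab K χ) := by
    obtain ⟨v, hv, hv0⟩ := Submodule.exists_mem_ne_zero_of_ne_bot hχ
    have h2 := congrArg (fun f : Module.End ℂ V => e (f v)) hc
    have h3 : ∀ g : G, e ((ρ g * e * ρ g⁻¹) v) = if g ∈ charStab K χ then v else 0 := by
      intro g
      split_ifs with hg
      · rw [Module.End.mul_apply, Module.End.mul_apply, he, weightProj_apply_of_mem hχ
          (apply_mem_weightSpace ((charStab K χ).inv_mem hg) hv), ← Module.End.mul_apply (ρ g),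
          ← map_mul, mul_inv_cancel, map_one]
        exact weightProj_apply_of_mem hχ hv
      · exact weightProj_apply_apply_eq_zero hχ hg (weightProj_mem hχ _)
    have h4 : e v = v := weightProj_apply_of_mem hχ hv
    simp only [LinearMap.sum_apply, map_sum, h3, LinearMap.smul_apply, Module.End.one_apply,
      map_smul, h4] at h2
    rw [← Finset.sum_filter, Finset.sum_const, ← Nat.cast_smul_eq_nsmul ℂ] at h2
    rw [← smul_left_injective ℂ hv0 h2, Nat.card_eq_fintype_card, Fintype.card_subtype]
  rw [hcS] at htr
  rw [Nat.card_eq_fintype_card (α := G)]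
  exact_mod_cast htr.symm

/-- By Clifford theory, the stabiliser of a weight acts irreducibly on the weight space: the
translates of a vector of the weight space span `V`, and the projection onto the weight space kills
those by elements outside the stabiliser. -/
theorem IsIrreducible.weightRep [K.Normal] (h : ρ.IsIrreducible)
    (hχ : weightSpace ρ K χ ≠ ⊥) : (weightRep ρ K χ).IsIrreducible := by
  rw [isIrreducible_iff_submodule]
  refine ⟨Submodule.nontrivial_iff_ne_bot.2 hχ, fun U hU => or_iff_not_imp_left.2 fun hU0 => ?_⟩
  obtain ⟨u, huU, hu0⟩ := Submodule.exists_mem_ne_zero_of_ne_bot hU0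
  have key := ((isIrreducible_iff_submodule.1 h).2
    (Submodule.span ℂ (Set.range fun g : G => ρ g u)) ?_).resolve_left ?_
  · have h2 : ∀ v ∈ Submodule.span ℂ (Set.range fun g : G => ρ g u),
        (⟨weightProj ρ K χ v, weightProj_mem hχ v⟩ : weightSpace ρ K χ) ∈ U := by
      intro v hv
      induction hv using Submodule.span_induction with
      | mem x hx =>
        obtain ⟨g, rfl⟩ := hx
        by_cases hg : g ∈ charStab K χ
        · have := hU ⟨g, hg⟩ u huU
          convert this using 1
          ext
          simpa using weightProj_apply_of_mem hχ (apply_mem_weightSpace hg u.2)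
        · convert U.zero_mem using 1
          ext
          simpa using weightProj_apply_apply_eq_zero hχ hg u.2
      | zero => convert U.zero_mem using 1; ext; simp
      | add x y _ _ hx hy => convert U.add_mem hx hy using 1; ext; simp
      | smul c x _ hx => convert U.smul_mem c hx using 1; ext; simp
    rw [eq_top_iff]
    intro v _
    have := h2 v (key ▸ Submodule.mem_top)
    convert this using 1
    ext
    exact (weightProj_apply_of_mem hχ v.2).symm
  · intro g v hv
    induction hv using Submodule.span_induction with
    | mem x hx =>
      obtain ⟨g', rfl⟩ := hx
      exact Submodule.subset_span ⟨g * g', by simp⟩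
    | zero => simp
    | add x y _ _ hx hy => rw [map_add]; exact Submodule.add_mem _ hx hy
    | smul c x _ hx => rw [map_smul]; exact Submodule.smul_mem _ _ hx
  · intro h0
    have : (u : V) ∈ Submodule.span ℂ (Set.range fun g : G => ρ g u) :=
      Submodule.subset_span ⟨1, by simp⟩
    rw [h0, Submodule.mem_bot] at this
    exact hu0 (Subtype.ext this)

end Projection

/-! ### Heisenberg type subgroups -/

/-- Let `S = H C` with `C` commutative, and let an irreducible representation of `S` be given by
scalars on `R ≤ H`, and such that each element of `H` outside `R` has a commutator with an element
of `H` acting by a scalar different from `1`. If the commutators of elements of `C` and `H` which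
lie in `R` act trivially, the restriction to `H` is irreducible, of dimension `[H : R]^{1/2}`.

For `t ∈ C` the operator `∑ h, ρ [t, h]` is `ρ t` times a class sum, which acts by a scalar; its
trace does not vanish. Hence `ρ t` belongs to the span of `ρ(H)`. -/
theorem IsIrreducible.finrank_sq_mul_card [Finite G] [FiniteDimensional ℂ V]
    (hρ : ρ.IsIrreducible) (H C R : Subgroup G) [H.Normal] (hRH : R ≤ H)
    (hC : ∀ s ∈ C, ∀ t ∈ C, s * t = t * s)
    (hHC : ∀ g, ∃ h ∈ H, ∃ t ∈ C, g = h * t)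
    (hR : ∀ r ∈ R, ∃ c : ℂ, ρ r = c • 1)
    (hH : ∀ h ∈ H, h ∉ R → ∃ h' ∈ H, ∃ c : ℂ, c ≠ 1 ∧ ρ (h * h' * h⁻¹ * h'⁻¹) = c • 1)
    (hCH : ∀ t ∈ C, ∀ h ∈ H, t * h * t⁻¹ * h⁻¹ ∈ R → ρ (t * h * t⁻¹ * h⁻¹) = 1) :
    Module.finrank ℂ V ^ 2 * Nat.card R = Nat.card H := by
  classical
  have := Fintype.ofFinite G
  have := hρ.nontrivial
  have hn : (Module.finrank ℂ V : ℂ) ≠ 0 := Nat.cast_ne_zero.2 Module.finrank_pos.ne'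
  -- the character vanishes on `H` outside `R`
  have hvan : ∀ h ∈ H, h ∉ R → LinearMap.trace ℂ V (ρ h) = 0 := by
    intro h hh hhR
    obtain ⟨h', -, c, hc, hcom⟩ := hH h hh hhR
    have h1 : LinearMap.trace ℂ V (ρ (h * h' * h⁻¹ * h'⁻¹) * ρ (h' * h * h'⁻¹)) =
        LinearMap.trace ℂ V (ρ h) := by
      rw [← map_mul]; congr 2; group
    have h2 : LinearMap.trace ℂ V (ρ (h' * h * h'⁻¹)) = LinearMap.trace ℂ V (ρ h) :=
      char_conj ρ h h'
    rw [hcom, smul_mul_assoc, one_mul, map_smul, h2, smul_eq_mul] at h1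
    have : (c - 1) * LinearMap.trace ℂ V (ρ h) = 0 := by linear_combination h1
    exact (mul_eq_zero.1 this).resolve_left (sub_ne_zero.2 hc)
  have hspan : ∀ t ∈ C, ρ t ∈ Submodule.span ℂ (ρ '' H) := by
    intro t ht
    set W : Module.End ℂ V := ∑ h : H, ρ (t * h * t⁻¹ * (h : G)⁻¹) with hW
    obtain ⟨z, hz⟩ := hρ.exists_eq_smul_one (ρ t⁻¹ * W) (by
      have hZ : ρ t⁻¹ * W = ∑ h : H, ρ (h * t⁻¹ * (h : G)⁻¹) := by
        rw [hW, Finset.mul_sum]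
        refine Finset.sum_congr rfl fun h _ => ?_
        rw [← map_mul]; congr 1; group
      rw [hZ]
      intro g
      obtain ⟨x, hx, s, hs, rfl⟩ := hHC g
      rw [map_mul]
      refine Commute.mul_left ?_ ?_
      · rw [commute_iff_eq, Finset.mul_sum, Finset.sum_mul]
        refine Fintype.sum_equiv (Equiv.mulLeft (⟨x, hx⟩ : H)) _ _ fun h => ?_
        rw [← map_mul, ← map_mul]; congr 1
        simp only [Equiv.coe_mulLeft, Subgroup.coe_mul]; group
      · rw [commute_iff_eq, Finset.mul_sum, Finset.sum_mul]
        refine Fintype.sum_equiv ((MulAut.conjNormal (H := H) s).toEquiv) _ _ fun h => ?_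
        rw [← map_mul, ← map_mul]; congr 1
        have : s⁻¹ * t⁻¹ * s = t⁻¹ := by
          rw [mul_assoc, ← hC s hs _ (C.inv_mem ht), ← mul_assoc, inv_mul_cancel, one_mul]
        simp only [MulEquiv.toEquiv_eq_coe, MulEquiv.coe_toEquiv, MulAut.conjNormal_apply]
        calc s * (h * t⁻¹ * (h : G)⁻¹) = s * h * t⁻¹ * (h : G)⁻¹ := by group
          _ = s * h * (s⁻¹ * t⁻¹ * s) * (h : G)⁻¹ := by rw [this]
          _ = s * h * s⁻¹ * t⁻¹ * (s * h * s⁻¹)⁻¹ * s := by group)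
    have hWz : W = z • ρ t := by
      have := congrArg (ρ t * ·) hz
      simpa only [← mul_assoc, ← map_mul, mul_inv_cancel, map_one, one_mul, mul_smul_comm,
        mul_one] using this
    have hWtr : LinearMap.trace ℂ V W =
        (Finset.univ.filter fun h : H => t * h * t⁻¹ * (h : G)⁻¹ ∈ R).card *
          Module.finrank ℂ V := by
      rw [hW, map_sum, ← nsmul_eq_mul, ← Finset.sum_const, Finset.sum_filter]
      refine Finset.sum_congr rfl fun h _ => ?_
      split_ifs with hR'
      · rw [hCH t ht h h.2 hR', LinearMap.trace_one]
      · refine hvan _ (H.mul_mem ?_ (H.inv_mem h.2)) hR'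
        exact Subgroup.Normal.conj_mem ‹_› _ h.2 t
    have hz0 : z ≠ 0 := by
      rintro rfl
      rw [hWz, zero_smul, map_zero, eq_comm, mul_eq_zero, or_iff_left hn, Nat.cast_eq_zero,
        Finset.card_eq_zero] at hWtr
      have : (1 : H) ∈ Finset.univ.filter fun h : H => t * h * t⁻¹ * (h : G)⁻¹ ∈ R := by
        simp [R.one_mem]
      rw [hWtr] at this
      simp at this
    have : ρ t = z⁻¹ • W := by rw [hWz, smul_smul, inv_mul_cancel₀ hz0, one_smul]
    rw [this]
    refine Submodule.smul_mem _ _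
      (Submodule.sum_mem _ fun h _ => Submodule.subset_span ⟨_, ?_, rfl⟩)
    exact H.mul_mem (Subgroup.Normal.conj_mem ‹_› _ h.2 t) (H.inv_mem h.2)
  -- as `ρ(C)` lies in the span of `ρ(H)`, the restriction to `H` is irreducible, so that its
  -- character, which is supported on `R`, has norm one
  let ρH : Representation ℂ H V := ρ.comp H.subtype
  have hirr : ρH.IsIrreducible := by
    rw [isIrreducible_iff_submodule]
    refine ⟨inferInstance, fun U hU => (isIrreducible_iff_submodule.1 hρ).2 U fun g v hv => ?_⟩
    have hst : ∀ f ∈ Submodule.span ℂ (ρ '' H), ∀ v ∈ U, f v ∈ U := by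
      intro f hf
      induction hf using Submodule.span_induction with
      | mem x hx => obtain ⟨h, hh, rfl⟩ := hx; exact hU ⟨h, hh⟩
      | zero => simp
      | add x y _ _ hx hy => exact fun v hv => U.add_mem (hx v hv) (hy v hv)
      | smul c x _ hx => exact fun v hv => U.smul_mem c (hx v hv)
    obtain ⟨h, hh, t, ht, rfl⟩ := hHC g
    rw [map_mul]
    exact hU ⟨h, hh⟩ _ (hst _ (hspan t ht) v hv)
  have hcard : (Nat.card H : ℂ) ≠ 0 := Nat.cast_ne_zero.2 Nat.card_pos.ne'
  have : Invertible (Nat.card H : ℂ) := invertibleOfNonzero hcard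
  have horth := char_orthonormal ρH ρH
  rw [if_pos ⟨Equiv.refl ρH⟩, inv_mul_eq_iff_eq_mul₀ hcard, mul_one] at horth
  have hterm : ∀ h : H, ρH.character h * ρH.character h⁻¹ =
      if (h : G) ∈ R then (Module.finrank ℂ V : ℂ) ^ 2 else 0 := by
    intro h
    split_ifs with hhR
    · obtain ⟨c, hc⟩ := hR h hhR
      obtain ⟨d, hd⟩ := hR _ (R.inv_mem hhR)
      have hcd : c * d = 1 := by
        have : ρ ((h : G) * (h : G)⁻¹) = (c * d) • 1 := by
          rw [map_mul, hc, hd, smul_mul_smul_comm, one_mul]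
        rw [mul_inv_cancel, map_one] at this
        have h1 := congrArg (LinearMap.trace ℂ V) this
        rw [map_smul, LinearMap.trace_one, smul_eq_mul] at h1
        exact mul_right_cancel₀ hn (by rw [one_mul]; exact h1.symm)
      have e1 : ρH.character h = c * Module.finrank ℂ V := by
        change LinearMap.trace ℂ V (ρ h) = _
        rw [hc, map_smul, LinearMap.trace_one, smul_eq_mul]
      have e2 : ρH.character h⁻¹ = d * Module.finrank ℂ V := by
        change LinearMap.trace ℂ V (ρ (h : G)⁻¹) = _
        rw [hd, map_smul, LinearMap.trace_one, smul_eq_mul]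
      rw [e1, e2]
      linear_combination (Module.finrank ℂ V : ℂ) ^ 2 * hcd
    · have : ρH.character h = 0 := hvan _ h.2 hhR
      rw [this, zero_mul]
  rw [Finset.sum_congr rfl fun h _ => hterm h, ← Finset.sum_filter, Finset.sum_const,
    nsmul_eq_mul] at horth
  have hcardR : (Finset.univ.filter fun h : H => (h : G) ∈ R).card = Nat.card R := by
    rw [← Nat.card_congr (Subgroup.subgroupOfEquivOfLe hRH).toEquiv, Nat.card_eq_fintype_card,
      ← Fintype.card_subtype]
    rfl
  rw [hcardR] at horth
  have : (Nat.card R : ℂ) * (Module.finrank ℂ V : ℂ) ^ 2 = Nat.card H := horth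
  rw [mul_comm]
  exact_mod_cast this

end Representation

/-! ### Simultaneous eigenvectors -/

namespace Representation

variable {G V : Type*} [Group G] [AddCommGroup V] [Module ℂ V] {ρ : Representation ℂ G V}

/-- Commuting operators which preserve a non-zero subspace have a common eigenvector in it. -/
theorem exists_weight_of_commute [FiniteDimensional ℂ V] {K : Subgroup G}
    (hK : ∀ k ∈ K, ∀ k' ∈ K, Commute (ρ k) (ρ k')) (W : Submodule ℂ V) (hW : W ≠ ⊥)
    (hKW : ∀ k ∈ K, ∀ v ∈ W, ρ k v ∈ W) :
    ∃ χ : G → ℂ, weightSpace ρ K χ ⊓ W ≠ ⊥ := by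
  induction hn : Module.finrank ℂ W using Nat.strong_induction_on generalizing W with
  | _ n ih =>
  by_cases hs : ∀ k ∈ K, ∃ c : ℂ, ∀ v ∈ W, ρ k v = c • v
  · choose! χ hχ using hs
    refine ⟨χ, ?_⟩
    have : W ≤ weightSpace ρ K χ := fun v hv k hk => hχ k hk v hv
    rwa [inf_eq_right.2 this]
  · push Not at hs
    obtain ⟨k, hk, hc⟩ := hs
    have : Nontrivial W := Submodule.nontrivial_iff_ne_bot.2 hW
    obtain ⟨c, hcv⟩ := Module.End.exists_eigenvalue ((ρ k).restrict (hKW k hk))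
    obtain ⟨w, hw⟩ := hcv.exists_hasEigenvector
    have hww : ρ k w = c • (w : V) := congrArg Subtype.val hw.apply_eq_smul
    obtain ⟨v, hv, hvc⟩ := hc c
    have hlt : W ⊓ Module.End.eigenspace (ρ k) c < W :=
      lt_of_le_of_ne inf_le_left fun e =>
        hvc (Module.End.mem_eigenspace_iff.1 (e.symm.le hv).2)
    obtain ⟨χ, hχ⟩ := ih _ (hn ▸ Submodule.finrank_lt_finrank_of_lt hlt)
      (W ⊓ Module.End.eigenspace (ρ k) c) (fun e => hw.2 (Subtype.ext
        ((Submodule.eq_bot_iff _).1 e w ⟨w.2, Module.End.mem_eigenspace_iff.2 hww⟩))) (by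
        rintro k' hk' v ⟨hv, hve⟩
        refine ⟨hKW _ hk' _ hv, Module.End.mem_eigenspace_iff.2 ?_⟩
        rw [← Module.End.mul_apply, (hK k hk k' hk').eq, Module.End.mul_apply,
          Module.End.mem_eigenspace_iff.1 hve, map_smul]) rfl
    refine ⟨χ, fun e => hχ (eq_bot_iff.2 ?_)⟩
    exact (inf_le_inf_left _ inf_le_left).trans e.le

/-- If `n ∈ K` does not act trivially, it does not act trivially on some weight space of `K`. -/
theorem exists_weight_apply_ne_one [Finite G] [FiniteDimensional ℂ V] {K : Subgroup G}
    (hK : ∀ k ∈ K, ∀ k' ∈ K, Commute (ρ k) (ρ k')) {n : G} (hn : n ∈ K) (hn1 : ρ n ≠ 1) :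
    ∃ χ : G → ℂ, weightSpace ρ K χ ≠ ⊥ ∧ χ n ≠ 1 := by
  obtain ⟨χ, hχ⟩ := exists_weight_of_commute hK (LinearMap.range (ρ n - 1))
    (fun e => hn1 (sub_eq_zero.1 (LinearMap.range_eq_bot.1 e))) (by
      rintro k hk _ ⟨v, rfl⟩
      refine ⟨ρ k v, ?_⟩
      have := congrArg (fun f : Module.End ℂ V => f v) (hK n hn k hk).eq
      simp only [Module.End.mul_apply] at this
      simp [this])
  obtain ⟨w, ⟨hw, v, rfl⟩, hw0⟩ := Submodule.exists_mem_ne_zero_of_ne_bot hχ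
  refine ⟨χ, fun e => hw0 (by rw [e] at hw; exact hw), fun h1 => hw0 ?_⟩
  -- the sum over the powers of `n` multiplies the vector by the order of `n`, and kills it
  set N := orderOf n with hN
  have hfix : ∀ i : ℕ, (ρ n ^ i) ((ρ n - 1) v) = (ρ n - 1) v := by
    intro i
    induction i with
    | zero => simp
    | succ i ih =>
      have := hw n hn
      rw [h1, one_smul] at this
      rw [pow_succ, Module.End.mul_apply, this, ih]
  have hsum : (∑ i ∈ Finset.range N, ρ n ^ i) ((ρ n - 1) v) = 0 := by
    rw [← Module.End.mul_apply, geom_sum_mul, ← map_pow, hN, pow_orderOf_eq_one, map_one, sub_self,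
      LinearMap.zero_apply]
  rw [LinearMap.sum_apply, Finset.sum_congr rfl fun i _ => hfix i, Finset.sum_const,
    Finset.card_range, ← Nat.cast_smul_eq_nsmul ℂ, smul_eq_zero] at hsum
  exact hsum.resolve_left (Nat.cast_ne_zero.2 (orderOf_pos n).ne')

theorem IsIrreducible.of_equiv {W : Type*} [AddCommGroup W] [Module ℂ W]
    {σ : Representation ℂ G W} (h : ρ.IsIrreducible) (e : ρ.Equiv σ) : σ.IsIrreducible := by
  rw [isIrreducible_iff_submodule] at h ⊢
  obtain ⟨h0, h⟩ := h
  have hc : ∀ g v, e (ρ g v) = σ g (e v) := fun g v =>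
    IntertwiningMap.isIntertwining _ _ e.toIntertwiningMap g v
  refine ⟨e.toLinearEquiv.symm.toEquiv.nontrivial, fun U hU => ?_⟩
  have hst : ∀ g, ∀ v ∈ U.comap e.toLinearEquiv.toLinearMap,
      ρ g v ∈ U.comap e.toLinearEquiv.toLinearMap := fun g v hv => by
    have := hU g _ hv
    rw [Submodule.mem_comap]
    convert this using 1
    exact hc g v
  rcases h (U.comap e.toLinearEquiv.toLinearMap) hst with h | h
  · left
    rw [eq_bot_iff]
    intro w hw
    obtain ⟨v, rfl⟩ := e.toLinearEquiv.surjective w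
    have : v ∈ U.comap e.toLinearEquiv.toLinearMap := hw
    rw [h, Submodule.mem_bot] at this
    rw [this, map_zero]
    exact Submodule.zero_mem _
  · right
    rw [eq_top_iff]
    intro w _
    obtain ⟨v, rfl⟩ := e.toLinearEquiv.surjective w
    exact (h ▸ Submodule.mem_top : v ∈ U.comap e.toLinearEquiv.toLinearMap)

/-- Pulling back along a surjective homomorphism preserves irreducibility. -/
theorem IsIrreducible.comp {Q : Type*} [Group Q] {σ : Representation ℂ Q V} (h : σ.IsIrreducible)
    (f : G →* Q) (hf : Function.Surjective f) :
    IsIrreducible (σ.comp f : Representation ℂ G V) := by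
  rw [isIrreducible_iff_submodule] at h ⊢
  refine ⟨h.1, fun U hU => h.2 U fun q v hv => ?_⟩
  obtain ⟨g, rfl⟩ := hf q
  exact hU g v hv

variable (ρ) in
/-- The twist of a representation by a linear character. -/
def twist (θ : G →* ℂˣ) : Representation ℂ G V where
  toFun g := (θ g : ℂ) • ρ g
  map_one' := by simp
  map_mul' g h := by rw [map_mul, map_mul, Units.val_mul, smul_mul_smul_comm]

theorem twist_apply (θ : G →* ℂˣ) (g : G) : ρ.twist θ g = (θ g : ℂ) • ρ g := rfl

theorem IsIrreducible.twist (h : ρ.IsIrreducible) (θ : G →* ℂˣ) : (ρ.twist θ).IsIrreducible := by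
  rw [isIrreducible_iff_submodule] at h ⊢
  refine ⟨h.1, fun U hU => h.2 U fun g v hv => ?_⟩
  have := U.smul_mem (θ g : ℂ)⁻¹ (hU g v hv)
  rwa [twist_apply, LinearMap.smul_apply, smul_smul, inv_mul_cancel₀ (θ g).ne_zero,
    one_smul] at this

end Representation

/-! ### The set of irreducible representations -/

namespace Irr

open Representation

variable {G : Type*} [Group G]

/-- A representation in the given isomorphism class. -/
def rep (x : Irr G) : Representation ℂ G (Fin x.dim → ℂ) := (Quotient.out x.2).1

theorem isIrreducible_rep (x : Irr G) : x.rep.IsIrreducible := (Quotient.out x.2).2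

theorem eq_of_equiv {x y : Irr G} (h : Nonempty (x.rep.Equiv y.rep)) : x = y := by
  obtain ⟨n, x⟩ := x
  obtain ⟨m, y⟩ := y
  obtain ⟨e⟩ := h
  obtain rfl : n = m := 
    (Module.finrank_fin_fun ℂ).symm.trans
      (e.toLinearEquiv.finrank_eq.trans (Module.finrank_fin_fun ℂ))
  congr 1
  rw [← Quotient.out_eq x, ← Quotient.out_eq y]
  exact Quotient.sound ⟨e⟩

/-- Each irreducible representation is isomorphic to one on a standard space `ℂⁿ`, and so has a
class in `Irr G`. -/
theorem exists_equiv {V : Type*} [AddCommGroup V] [Module ℂ V] [FiniteDimensional ℂ V]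
    {ρ : Representation ℂ G V} (h : ρ.IsIrreducible) : ∃ x : Irr G, Nonempty (x.rep.Equiv ρ) := by
  let e : V ≃ₗ[ℂ] (Fin (Module.finrank ℂ V) → ℂ) := (Module.finBasis ℂ V).equivFun
  let σ : Representation ℂ G (Fin (Module.finrank ℂ V) → ℂ) :=
    (e.conjAlgEquiv ℂ : _ →* _).comp ρ
  have hσ : ρ.Equiv σ := Representation.Equiv.mk e fun g => by
    ext v; simp [σ, LinearEquiv.conjAlgEquiv]
  refine ⟨⟨_, Quotient.mk (irrepSetoid G _) ⟨σ, h.of_equiv hσ⟩⟩, ?_⟩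
  obtain ⟨e'⟩ := Quotient.exact (Quotient.out_eq (Quotient.mk (irrepSetoid G _) ⟨σ, h.of_equiv hσ⟩))
  exact ⟨e'.trans hσ.symm⟩

/-- The isomorphism class of an irreducible representation. -/
def mk {V : Type*} [AddCommGroup V] [Module ℂ V] [FiniteDimensional ℂ V]
    {ρ : Representation ℂ G V} (h : ρ.IsIrreducible) : Irr G := (exists_equiv h).choose

/-- The defining isomorphism of a representative of the class of `ρ` with `ρ`. -/
def mkEquiv {V : Type*} [AddCommGroup V] [Module ℂ V] [FiniteDimensional ℂ V]
    {ρ : Representation ℂ G V} (h : ρ.IsIrreducible) : (mk h).rep.Equiv ρ :=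
  (exists_equiv h).choose_spec.some

theorem dim_mk {V : Type*} [AddCommGroup V] [Module ℂ V] [FiniteDimensional ℂ V]
    {ρ : Representation ℂ G V} (h : ρ.IsIrreducible) : (mk h).dim = Module.finrank ℂ V := by
  simpa using (mkEquiv h).toLinearEquiv.finrank_eq

end Irr

open Representation in
/-- Equivalent representations act by the same scalars. -/
theorem Representation.Equiv.apply_eq_smul_one_iff {G V W : Type*} [Group G] [AddCommGroup V]
    [Module ℂ V] [AddCommGroup W] [Module ℂ W] {ρ : Representation ℂ G V}
    {σ : Representation ℂ G W} (e : ρ.Equiv σ) (g : G) (c : ℂ) :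
    ρ g = c • 1 ↔ σ g = c • 1 := by
  have hc : ∀ v, e (ρ g v) = σ g (e v) := fun v =>
    IntertwiningMap.isIntertwining _ _ e.toIntertwiningMap g v
  constructor
  · intro h
    ext w
    obtain ⟨v, rfl⟩ := e.toLinearEquiv.surjective w
    have := hc v
    rw [h] at this
    simpa using this.symm
  · intro h
    ext v
    apply e.toLinearEquiv.injective
    have := hc v
    rw [h] at this
    simpa using this

/-! ### Finiteness and the sum of the squares of the dimensions -/

open Representation in
/-- An isomorphism with a twist, read as an isomorphism from the inverse twist. -/
def Representation.Equiv.untwist {G V W : Type*} [Group G] [AddCommGroup V]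
    [Module ℂ V] [AddCommGroup W] [Module ℂ W] {ρ : Representation ℂ G V}
    {σ : Representation ℂ G W} {θ : G →* ℂˣ} (e : ρ.Equiv (σ.twist θ)) :
    (ρ.twist θ⁻¹).Equiv σ :=
  Representation.Equiv.mk e.toLinearEquiv fun g => LinearMap.ext fun v => by
    have h : e.toLinearEquiv (ρ g v) = (θ g : ℂ) • σ g (e.toLinearEquiv v) :=
      IntertwiningMap.isIntertwining _ _ e.toIntertwiningMap g v
    have : e.toLinearEquiv (((θ⁻¹ g : ℂˣ) : ℂ) • ρ g v) = σ g (e.toLinearEquiv v) := by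
      rw [map_smul, h, smul_smul, MonoidHom.inv_apply, Units.inv_mul, one_smul]
    exact this

namespace Irr

open Representation

section Wedderburn

variable {G : Type*} [Group G] {n : ℕ} {d : Fin n → ℕ}

/-- The representation of `G` on the column space of the `i`-th Wedderburn component of `ℂ[G]`. -/
def columnRep (e : MonoidAlgebra ℂ G ≃ₐ[ℂ] ((i : Fin n) → Matrix (Fin (d i)) (Fin (d i)) ℂ))
    (i : Fin n) : Representation ℂ G (Fin (d i) → ℂ) :=
  (((Matrix.toLinAlgEquiv' (R := ℂ) (n := Fin (d i))).toAlgHom.comp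
    (Pi.evalAlgHom ℂ _ i)).comp e.toAlgHom : _ →* _).comp (MonoidAlgebra.of ℂ G)

variable (e : MonoidAlgebra ℂ G ≃ₐ[ℂ] ((i : Fin n) → Matrix (Fin (d i)) (Fin (d i)) ℂ))

theorem asAlgebraHom_columnRep (i : Fin n) (x : MonoidAlgebra ℂ G) (v : Fin (d i) → ℂ) :
    (columnRep e i).asAlgebraHom x v = (e x i).mulVec v := by
  have : (columnRep e i).asAlgebraHom = ((Matrix.toLinAlgEquiv' (R := ℂ)
      (n := Fin (d i))).toAlgHom.comp (Pi.evalAlgHom ℂ _ i)).comp e.toAlgHom := by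
    apply MonoidAlgebra.algHom_ext
    · intro g
      change (columnRep e i).asAlgebraHom (MonoidAlgebra.of ℂ G g) = _
      rw [asAlgebraHom_of]
      rfl
    · exact Subsingleton.elim _ _
  rw [this]
  simp [Matrix.toLinAlgEquiv'_apply]

theorem apply_mem_of_asAlgebraHom {V : Type*} [AddCommGroup V] [Module ℂ V]
    {ρ : Representation ℂ G V} {U : Submodule ℂ V} (hU : ∀ g, ∀ v ∈ U, ρ g v ∈ U)
    (x : MonoidAlgebra ℂ G) {v : V} (hv : v ∈ U) : ρ.asAlgebraHom x v ∈ U := by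
  induction x using MonoidAlgebra.induction_on with
  | of g => simpa using hU g v hv
  | add x y hx hy => rw [map_add]; exact U.add_mem hx hy
  | smul c x hx => rw [map_smul]; exact U.smul_mem c hx

/-- The column space of a matrix algebra is irreducible, as a matrix unit moves any non-zero vector
to any other up to scalars. -/
theorem isIrreducible_columnRep (hd : ∀ i, NeZero (d i)) (i : Fin n) :
    (columnRep e i).IsIrreducible := by
  rw [isIrreducible_iff_submodule]
  have : Nonempty (Fin (d i)) := ⟨⟨0, Nat.pos_of_ne_zero (hd i).out⟩⟩
  refine ⟨inferInstance, fun U hU => or_iff_not_imp_left.2 fun h0 => eq_top_iff.2 fun v _ => ?_⟩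
  obtain ⟨u, hu, hu0⟩ := Submodule.exists_mem_ne_zero_of_ne_bot h0
  obtain ⟨j, hj⟩ := Function.ne_iff.1 hu0
  have := apply_mem_of_asAlgebraHom hU
    (e.symm (Pi.single i (Matrix.vecMulVec v (Pi.single j (u j)⁻¹)))) hu
  rw [asAlgebraHom_columnRep, AlgEquiv.apply_symm_apply, Pi.single_eq_same,
    Matrix.vecMulVec_mulVec] at this
  have hj' : u j ≠ 0 := hj
  simpa [hj', ← MulOpposite.op_inv, ← MulOpposite.op_mul] using this

theorem asAlgebraHom_equiv {V W : Type*} [AddCommGroup V] [Module ℂ V] [AddCommGroup W]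
    [Module ℂ W] {ρ : Representation ℂ G V} {σ : Representation ℂ G W} (f : ρ.IntertwiningMap σ)
    (x : MonoidAlgebra ℂ G) (v : V) : f (ρ.asAlgebraHom x v) = σ.asAlgebraHom x (f v) := by
  induction x using MonoidAlgebra.induction_on with
  | of g => simpa using IntertwiningMap.isIntertwining _ _ f g v
  | add x y hx hy => simp [hx, hy]
  | smul c x hx => simp [hx]

/-- Different components have non-isomorphic column spaces: the central idempotent of the component
`i` acts as the identity on its own column space, and as `0` on the others. -/
theorem columnRep_injective (hd : ∀ i, NeZero (d i)) {i j : Fin n}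
    (h : Nonempty ((columnRep e i).Equiv (columnRep e j))) : i = j := by
  by_contra hij
  obtain ⟨f⟩ := h
  have : Nonempty (Fin (d i)) := ⟨⟨0, Nat.pos_of_ne_zero (hd i).out⟩⟩
  obtain ⟨v, hv⟩ := exists_ne (0 : Fin (d i) → ℂ)
  have := asAlgebraHom_equiv f.toIntertwiningMap (e.symm (Pi.single i 1)) v
  rw [asAlgebraHom_columnRep, asAlgebraHom_columnRep, AlgEquiv.apply_symm_apply,
    Pi.single_eq_same, Pi.single_eq_of_ne (Ne.symm hij), Matrix.one_mulVec,
    Matrix.zero_mulVec] at this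
  exact hv (f.toLinearEquiv.injective (by rw [map_zero]; exact this))

/-- Every irreducible representation is the column space of a Wedderburn component: the central
idempotents of the components act by scalars, and one of them acts as the identity. -/
theorem exists_equiv_columnRep (hd : ∀ i, NeZero (d i)) {V : Type*} [AddCommGroup V] [Module ℂ V]
    [FiniteDimensional ℂ V] {ρ : Representation ℂ G V} (h : ρ.IsIrreducible) :
    ∃ i, Nonempty ((columnRep e i).Equiv ρ) := by
  have := h.nontrivial
  set Φ := ρ.asAlgebraHom.comp e.symm.toAlgHom with hΦ
  have hΦg : ∀ g, ρ g = Φ (e (MonoidAlgebra.of ℂ G g)) := fun g => by simp [hΦ]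
  have hsum : ∑ i, Φ (Pi.single i 1) = 1 := by
    rw [← map_sum, Finset.univ_sum_single (fun i => (1 : Matrix (Fin (d i)) (Fin (d i)) ℂ))]
    exact map_one Φ
  obtain ⟨i, hi⟩ : ∃ i, Φ (Pi.single i 1) ≠ 0 := by
    by_contra! h0
    simp [h0] at hsum
  have hcen : ∀ (i : Fin n) x, (Pi.single i 1 : (i : Fin n) → Matrix (Fin (d i)) (Fin (d i)) ℂ) * x
      = Pi.single i (x i) ∧ x * Pi.single i 1 = Pi.single i (x i) := fun i x => by
    constructor <;> ext j : 1 <;> by_cases hj : j = i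
    · subst hj; simp
    · simp [hj]
    · subst hj; simp
    · simp [hj]
  have hone : Φ (Pi.single i 1) = 1 := by
    obtain ⟨c, hc⟩ := h.exists_eq_smul_one (Φ (Pi.single i 1)) fun g => by
      rw [hΦg, commute_iff_eq, ← map_mul, ← map_mul, (hcen i _).1, (hcen i _).2]
    have hid : Φ (Pi.single i 1) * Φ (Pi.single i 1) = Φ (Pi.single i 1) := by
      rw [← map_mul, (hcen i _).1, Pi.single_eq_same]
    rw [hc] at hi hid ⊢
    have hc0 : c ≠ 0 := fun h0 => hi (by rw [h0, zero_smul])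
    rw [smul_mul_smul_comm, one_mul] at hid
    have := smul_left_injective ℂ (one_ne_zero : (1 : Module.End ℂ V) ≠ 0) hid
    rw [mul_eq_left₀ hc0] at this
    rw [this, one_smul]
  have hΦi : ∀ x, Φ x = Φ (Pi.single i (x i)) := fun x => by
    rw [← (hcen i x).1, map_mul, hone, one_mul]
  obtain ⟨v, hv⟩ := exists_ne (0 : V)
  -- a diagonal matrix unit which does not kill `v`
  obtain ⟨a, ha⟩ : ∃ a, Φ (Pi.single i (Matrix.single a a 1)) v ≠ 0 := by
    by_contra! h0
    have h1 : ∑ a, Φ (Pi.single i (Matrix.single a a 1)) = 1 := by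
      rw [← map_sum, ← hone]
      congr 1
      ext j : 1
      rw [Finset.sum_apply]
      by_cases hj : j = i
      · subst hj
        simp only [Pi.single_eq_same, Matrix.sum_single_one]
      · simp [hj]
    have h2 := congrArg (fun f : Module.End ℂ V => f v) h1
    simp only [LinearMap.sum_apply, h0, Finset.sum_const_zero, Module.End.one_apply] at h2
    exact hv h2.symm
  set w := Φ (Pi.single i (Matrix.single a a 1)) v with hw
  let T : (Fin (d i) → ℂ) →ₗ[ℂ] V :=
    { toFun := fun x => Φ (Pi.single i (Matrix.vecMulVec x (Pi.single a 1))) w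
      map_add' := fun x y => by
        rw [Matrix.add_vecMulVec, Pi.single_add, map_add, LinearMap.add_apply]
      map_smul' := fun c x => by
        rw [Matrix.smul_vecMulVec, Pi.single_smul, map_smul, LinearMap.smul_apply,
          RingHom.id_apply] }
  have hT : ∀ g x, T (columnRep e i g x) = ρ g (T x) := by
    intro g x
    have h1 : columnRep e i g x = (e (MonoidAlgebra.of ℂ G g) i).mulVec x := by
      rw [← asAlgebraHom_columnRep]; simp
    rw [h1, hΦg, hΦi (e _)]
    change Φ _ w = Φ _ (Φ _ w)
    rw [← Module.End.mul_apply (Φ _) (Φ _) w, ← map_mul, ← Pi.single_mul, Matrix.mul_vecMulVec]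
  let f : (columnRep e i).IntertwiningMap ρ := ⟨T, fun g => LinearMap.ext (hT g)⟩
  have := isIrreducible_columnRep e hd i
  refine ⟨i, ?_⟩
  rcases IsIrreducible.bijective_or_eq_zero f with hf | hf
  · exact ⟨f.ofBijective hf⟩
  · exfalso
    have h1 : T (Pi.single a 1) = w := by
      change Φ _ w = w
      rw [hw, ← Module.End.mul_apply, ← map_mul, ← Pi.single_mul]
      congr 3
      ext b c
      rw [Matrix.vecMulVec_mul]
      simp only [Matrix.vecMulVec_apply, Matrix.single_one_vecMul, Matrix.single_apply,
        Pi.single_apply, Matrix.row_apply]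
      by_cases hb : b = a <;> by_cases hc : c = a <;> simp [hb, hc, Ne.symm]
    apply ha
    rw [← h1]
    exact congrArg (fun f : (columnRep e i).IntertwiningMap ρ => f (Pi.single a 1)) hf

end Wedderburn

/-- The irreducible classes are indexed by the Wedderburn components of `ℂ[G]`. -/
theorem exists_equiv_fin (G : Type*) [Group G] [Finite G] :
    ∃ (n : ℕ) (f : Fin n ≃ Irr G), ∑ i, (f i).dim ^ 2 = Nat.card G := by
  have := Fintype.ofFinite G
  have : NeZero (Nat.card G : ℂ) := ⟨Nat.cast_ne_zero.2 Nat.card_pos.ne'⟩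
  obtain ⟨n, d, hd, ⟨e⟩⟩ :=
    IsSemisimpleRing.exists_algEquiv_pi_matrix_of_isAlgClosed ℂ (MonoidAlgebra ℂ G)
  have hirr := isIrreducible_columnRep e hd
  let f : Fin n → Irr G := fun i => mk (hirr i)
  have hf : Function.Bijective f := by
    constructor
    · intro i j hij
      have e1 : (f i).rep.Equiv (columnRep e i) := mkEquiv (hirr i)
      have e2 : (f j).rep.Equiv (columnRep e j) := mkEquiv (hirr j)
      rw [hij] at e1
      exact columnRep_injective e hd ⟨e1.symm.trans e2⟩
    · intro x
      obtain ⟨i, ⟨f⟩⟩ := exists_equiv_columnRep e hd x.isIrreducible_rep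
      exact ⟨i, eq_of_equiv ⟨(mkEquiv (hirr i)).trans f⟩⟩
  have hdim : ∀ i, (f i).dim = d i := fun i => by
    rw [← Module.finrank_fin_fun ℂ (n := d i)]; exact dim_mk (hirr i)
  refine ⟨n, Equiv.ofBijective f hf, ?_⟩
  have h1 := e.toLinearEquiv.finrank_eq
  rw [Module.finrank_pi_fintype] at h1
  simp only [Module.finrank_matrix, Fintype.card_fin, Module.finrank_self, mul_one] at h1
  have h2 : Module.finrank ℂ (MonoidAlgebra ℂ G) = Nat.card G := by
    exact Module.finrank_eq_nat_card_basis (MonoidAlgebra.basis G ℂ)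
  rw [← h2, h1]
  refine Finset.sum_congr rfl fun i _ => ?_
  rw [Equiv.ofBijective_apply, hdim, sq]

instance (G : Type*) [Group G] [Finite G] : Finite (Irr G) := by
  obtain ⟨n, f, -⟩ := exists_equiv_fin G
  exact Finite.of_equiv _ f

instance (G : Type*) [Group G] [Finite G] : Fintype (Irr G) := Fintype.ofFinite _

theorem sum_dim_sq (G : Type*) [Group G] [Finite G] : ∑ x : Irr G, x.dim ^ 2 = Nat.card G := by
  obtain ⟨n, f, h⟩ := exists_equiv_fin G
  rw [← h, ← f.sum_comp]

/-! ### Inflation and twisting -/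

section Inflation

variable {G Q : Type*} [Group G] [Group Q]

/-- The class of the pullback of a representation along a surjective homomorphism. -/
def inflate (f : G →* Q) (hf : Function.Surjective f) (y : Irr Q) : Irr G :=
  mk (y.isIrreducible_rep.comp f hf)

theorem dim_inflate (f : G →* Q) (hf : Function.Surjective f) (y : Irr Q) :
    (inflate f hf y).dim = y.dim := by
  rw [inflate, dim_mk, Module.finrank_fin_fun]

theorem inflate_injective (f : G →* Q) (hf : Function.Surjective f) :
    Function.Injective (inflate f hf) := by
  intro x y hxy
  have e1 := mkEquiv (x.isIrreducible_rep.comp f hf)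
  have e2 := mkEquiv (y.isIrreducible_rep.comp f hf)
  have hxy' : mk (x.isIrreducible_rep.comp f hf) = mk (y.isIrreducible_rep.comp f hf) := hxy
  rw [hxy'] at e1
  have e := e1.symm.trans e2
  refine eq_of_equiv ⟨Representation.Equiv.mk e.toLinearEquiv fun q => ?_⟩
  obtain ⟨g, rfl⟩ := hf q
  exact LinearMap.ext fun v => IntertwiningMap.isIntertwining _ _ e.toIntertwiningMap g v

/-- The class `x` consists of representations which are trivial on `N`. -/
def TrivialOn (x : Irr G) (N : Subgroup G) : Prop := ∀ g ∈ N, x.rep g = 1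

theorem trivialOn_inflate (f : G →* Q) (hf : Function.Surjective f) (y : Irr Q) :
    (inflate f hf y).TrivialOn f.ker := by
  intro g hg
  have := ((mkEquiv (y.isIrreducible_rep.comp f hf)).apply_eq_smul_one_iff g 1).2 (by
    rw [MonoidHom.mem_ker] at hg
    simp [hg])
  rw [one_smul] at this
  exact this

theorem exists_inflate_eq (f : G →* Q) (hf : Function.Surjective f) {x : Irr G}
    (hx : x.TrivialOn f.ker) : ∃ y, inflate f hf y = x := by
  let s := Function.surjInv hf
  have hs : ∀ q, f (s q) = q := Function.surjInv_eq hf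
  have hfac : ∀ g h, f g = f h → x.rep g = x.rep h := by
    intro g h hgh
    have h1 := hx (h⁻¹ * g) (by simp [MonoidHom.mem_ker, hgh])
    have h2 : g = h * (h⁻¹ * g) := by group
    rw [h2, map_mul, h1, mul_one]
  let σ : Representation ℂ Q (Fin x.dim → ℂ) :=
    { toFun := fun q => x.rep (s q)
      map_one' := by rw [hfac (s 1) 1 (by rw [hs, map_one]), map_one]
      map_mul' := fun p q => by
        rw [hfac (s (p * q)) (s p * s q) (by rw [map_mul, hs, hs, hs]), map_mul] }
  have hσ : ∀ g, σ (f g) = x.rep g := fun g => hfac _ _ (hs _)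
  have hirr : σ.IsIrreducible := by
    have := x.isIrreducible_rep
    rw [isIrreducible_iff_submodule] at this ⊢
    exact ⟨this.1, fun U hU => this.2 U fun g v hv => by rw [← hσ]; exact hU (f g) v hv⟩
  refine ⟨mk hirr, eq_of_equiv ⟨(mkEquiv _).trans
    (Representation.Equiv.mk (mkEquiv hirr).toLinearEquiv fun g => ?_)⟩⟩
  refine LinearMap.ext fun v => ?_
  rw [← hσ]
  exact IntertwiningMap.isIntertwining _ _ (mkEquiv hirr).toIntertwiningMap (f g) v

open Classical in
/-- Representations of a quotient are the representations trivial on the kernel. -/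
theorem sum_trivialOn_ker [Finite G] [Finite Q] {M : Type*} [AddCommMonoid M] (f : G →* Q)
    (hf : Function.Surjective f) (F : ℕ → M) :
    ∑ x : Irr G with x.TrivialOn f.ker, F x.dim = ∑ y : Irr Q, F y.dim := by
  symm
  refine Finset.sum_bij (fun y _ => inflate f hf y) (fun y _ => ?_)
    (fun y _ z _ h => inflate_injective f hf h) (fun x hx => ?_) (fun y _ => ?_)
  · simpa using trivialOn_inflate f hf y
  · obtain ⟨y, rfl⟩ := exists_inflate_eq f hf (Finset.mem_filter.1 hx).2
    exact ⟨y, Finset.mem_univ _, rfl⟩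
  · rw [dim_inflate]

open Classical in
/-- The representations which are trivial on `N` are those of `G ⧸ N`. -/
theorem sum_trivialOn_sq [Finite G] (N : Subgroup G) [N.Normal] :
    (∑ x : Irr G with x.TrivialOn N, x.dim ^ 2) * Nat.card N = Nat.card G := by
  have := sum_trivialOn_ker (QuotientGroup.mk' N) (QuotientGroup.mk'_surjective N) (· ^ 2)
  rw [QuotientGroup.ker_mk'] at this
  rw [this, sum_dim_sq, ← Subgroup.card_eq_card_quotient_mul_card_subgroup]

theorem repZeta_eq_sum [Finite G] (s : ℂ) : repZeta G s = ∑ x : Irr G, (x.dim : ℂ) ^ (-s) := by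
  rw [repZeta, tsum_fintype]

theorem repZeta_congr [Finite G] [Finite Q] (f : G ≃* Q) (s : ℂ) : repZeta G s = repZeta Q s := by
  classical
  rw [repZeta_eq_sum, repZeta_eq_sum, ← sum_trivialOn_ker f.toMonoidHom f.surjective
    (fun d => (d : ℂ) ^ (-s)), Finset.filter_true_of_mem]
  intro x _ g hg
  have : g = 1 := f.injective (by simpa using hg)
  rw [this, map_one]

/-- The class of the twist of a representation by a linear character. -/
def twist (θ : G →* ℂˣ) (x : Irr G) : Irr G := mk (x.isIrreducible_rep.twist θ)

theorem dim_twist (θ : G →* ℂˣ) (x : Irr G) : (x.twist θ).dim = x.dim := by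
  rw [twist, dim_mk, Module.finrank_fin_fun]

theorem twist_rep_eq_smul_one_iff (θ : G →* ℂˣ) (x : Irr G) (g : G) (c : ℂ) :
    (x.twist θ).rep g = c • 1 ↔ x.rep g = ((θ g : ℂ)⁻¹ * c) • 1 := by
  rw [twist, (mkEquiv (x.isIrreducible_rep.twist θ)).apply_eq_smul_one_iff, twist_apply]
  constructor
  · intro h
    rw [mul_smul, ← h, smul_smul, inv_mul_cancel₀ (θ g).ne_zero, one_smul]
  · intro h
    rw [h, smul_smul, mul_inv_cancel_left₀ (θ g).ne_zero]

theorem twist_twist_inv (θ : G →* ℂˣ) (x : Irr G) : (x.twist θ).twist θ⁻¹ = x := by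
  exact eq_of_equiv ⟨(mkEquiv _).trans (mkEquiv (x.isIrreducible_rep.twist θ)).untwist⟩

/-- Twisting by a linear character is a permutation of the irreducible classes. -/
def twistEquiv (θ : G →* ℂˣ) : Irr G ≃ Irr G where
  toFun := twist θ
  invFun := twist θ⁻¹
  left_inv := twist_twist_inv θ
  right_inv x := by
    have h1 : θ⁻¹⁻¹ = θ := by ext g; simp
    have := twist_twist_inv θ⁻¹ x
    rwa [h1] at this

end Inflation

end Irr

/-! ### Unitary groups of finite rings with involution -/

/-- A function which is multiplicative on a subgroup extends to an additive character, as `ℂˣ` is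
divisible. -/
theorem AddChar.exists_extend {A : Type*} [AddCommGroup A] [Finite A] (B : AddSubgroup A)
    (f : A → ℂ) (h0 : f 0 = 1) (hadd : ∀ x ∈ B, ∀ y ∈ B, f (x + y) = f x * f y) :
    ∃ Λ : AddChar A ℂ, ∀ x ∈ B, Λ x = f x := by
  have hne : ∀ x ∈ B, f x * f (-x) = 1 := fun x hx => by
    rw [← hadd x hx _ (B.neg_mem hx), add_neg_cancel, h0]
  have : Finite (Multiplicative A) := Finite.of_equiv _ Multiplicative.ofAdd
  have : NeZero (Monoid.exponent (Multiplicative A)) :=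
    ⟨Monoid.exponent_ne_zero_of_finite⟩
  let φ : AddSubgroup.toSubgroup B →* ℂˣ :=
    { toFun := fun x => Units.mkOfMulEqOne (f (Multiplicative.toAdd (x : Multiplicative A)))
        (f (-Multiplicative.toAdd (x : Multiplicative A))) (hne _ x.2)
      map_one' := by ext; simpa using h0
      map_mul' := fun x y => by ext; exact hadd _ x.2 _ y.2 }
  obtain ⟨Φ, hΦ⟩ := MonoidHom.domRestrict_surjective ℂ (AddSubgroup.toSubgroup B) φ
  refine ⟨{ toFun := fun x => Φ (Multiplicative.ofAdd x), map_zero_eq_one' := ?_,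
            map_add_eq_mul' := ?_ }, fun x hx => ?_⟩
  · simp
  · intro x y; simp
  · have := congrArg Units.val (DFunLike.congr_fun hΦ (⟨Multiplicative.ofAdd x, hx⟩ :
      AddSubgroup.toSubgroup B))
    simpa [φ] using this

section PowCard

variable {A : Type*} [Ring A] [Finite A]

/-- The group `1 + J` has the order of `J`. -/
theorem pow_card_eq_one_of_sub_one_mem (J : NonUnitalSubring A) (hJ : ∀ x ∈ J, IsNilpotent x)
    {z : A} (hz : z - 1 ∈ J) : z ^ Nat.card J = 1 := by
  have hpow : ∀ (u : A), u - 1 ∈ J → ∀ n : ℕ, u ^ n - 1 ∈ J := by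
    intro u hu n
    induction n with
    | zero => simp
    | succ n ih =>
      have : u ^ (n + 1) - 1 = (u ^ n - 1) * (u - 1) + (u ^ n - 1) + (u - 1) := by
        rw [pow_succ]; noncomm_ring
      rw [this]
      exact J.add_mem (J.add_mem (J.mul_mem ih hu) ih) hu
  have : Finite Aˣ := inferInstance
  let P : Subgroup Aˣ :=
    { carrier := {u | (u : A) - 1 ∈ J}
      one_mem' := by simp
      mul_mem' := by
        intro a b ha hb
        have : ((a * b : Aˣ) : A) - 1 = (a - 1) * (b - 1) + (a - 1) + (b - 1) := by
          rw [Units.val_mul]; noncomm_ring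
        rw [Set.mem_ofPred_eq] at *
        rw [this]
        exact J.add_mem (J.add_mem (J.mul_mem ha hb) ha) hb
      inv_mem' := by
        intro a ha
        rw [Set.mem_ofPred_eq] at *
        have : a⁻¹ = a ^ (orderOf a - 1) := by
          rw [eq_comm, ← mul_eq_one_iff_eq_inv, ← pow_succ,
            Nat.sub_add_cancel (orderOf_pos a), pow_orderOf_eq_one]
        rw [this, Units.val_pow_eq_pow_val]
        exact hpow _ ha _ }
  have hu : ∀ x ∈ J, IsUnit (1 + x) := fun x hx => (hJ x hx).isUnit_one_add
  let e : P ≃ J :=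
    { toFun := fun u => ⟨((u : Aˣ) : A) - 1, u.2⟩
      invFun := fun x => ⟨(hu x x.2).unit, by
        change ((hu x x.2).unit : A) - 1 ∈ J
        simp⟩
      left_inv := fun u => by ext; simp
      right_inv := fun x => by ext; simp }
  have hzu : IsUnit z := by simpa using hu _ hz
  have h1 : (⟨hzu.unit, hz⟩ : P) ^ Nat.card P = 1 := pow_card_eq_one'
  rw [Nat.card_congr e] at h1
  have := congrArg (fun u : P => ((u : Aˣ) : A)) h1
  simpa using this

/-- If `2` is invertible, there are no elements of additive order two. -/
theorem odd_card_of_isUnit_two (h2 : IsUnit (2 : A)) (J : AddSubgroup A) : Odd (Nat.card J) := by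
  rw [← Nat.not_even_iff_odd]
  intro hev
  obtain ⟨x, hx⟩ := exists_prime_addOrderOf_dvd_card' (G := J) 2 hev.two_dvd
  have h0 : (2 : A) * (x : A) = 0 := by
    have := addOrderOf_nsmul_eq_zero x
    rw [hx] at this
    have := congrArg Subtype.val this
    simpa [two_mul, two_nsmul] using this
  rw [h2.mul_right_eq_zero] at h0
  have : x = 0 := Subtype.ext h0
  rw [this, addOrderOf_zero] at hx
  norm_num at hx

variable [StarRing A]

/-- An element which is unitary modulo `J` is turned into a unitary element by a power of
`star Y * Y`, since `1 + J` has odd order. -/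
theorem exists_mul_pow_mem_unitary (h2 : IsUnit (2 : A)) (J : NonUnitalSubring A)
    (hJ : ∀ x ∈ J, IsNilpotent x) {Y : A} (hY : star Y * Y - 1 ∈ J) :
    ∃ k : ℕ, Y * (star Y * Y) ^ k ∈ unitary A := by
  obtain ⟨k, hk⟩ := odd_card_of_isUnit_two h2 J.toAddSubgroup
  refine ⟨k, ?_⟩
  have h1 : star (Y * (star Y * Y) ^ k) * (Y * (star Y * Y) ^ k) = 1 := by
    have h3 : (star Y * Y) ^ (2 * k + 1) = 1 := by
      rw [← pow_card_eq_one_of_sub_one_mem J hJ hY]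
      congr 1
      exact hk.symm
    rw [star_mul, star_pow, star_mul, star_star, mul_assoc, ← mul_assoc (star Y),
      ← pow_succ', ← pow_add, ← h3]
    congr 1
    ring
  exact Unitary.mem_iff.2 ⟨h1, mul_eq_one_comm.1 h1⟩

omit [Finite A] in
theorem coe_inv_unitary (g : unitary A) : ((g⁻¹ : unitary A) : A) = star (g : A) := rfl

/-- The Cayley transform: the unitary elements of `1 + J` correspond to the skew elements
of `J`. -/
theorem card_unitary_sub_one_mem (h2 : IsUnit (2 : A)) (J : NonUnitalSubring A)
    (hJ : ∀ x ∈ J, IsNilpotent x) :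
    Nat.card {g : unitary A // (g : A) - 1 ∈ J} = Nat.card {X : A // X ∈ J ∧ star X = -X} := by
  have hinv : ∀ v : A, v - 1 ∈ J → ∃ w : A, w - 1 ∈ J ∧ v * w = 1 ∧ w * v = 1 := by
    intro v hv
    refine ⟨v ^ (Nat.card J - 1), ?_, ?_, ?_⟩
    · have hpow : ∀ n : ℕ, v ^ n - 1 ∈ J := by
        intro n
        induction n with
        | zero => simp
        | succ n ih =>
          have : v ^ (n + 1) - 1 = (v ^ n - 1) * (v - 1) + (v ^ n - 1) + (v - 1) := by
            rw [pow_succ]; noncomm_ring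
          rw [this]
          exact J.add_mem (J.add_mem (J.mul_mem ih hv) ih) hv
      exact hpow _
    · rw [← pow_succ', Nat.sub_add_cancel Nat.card_pos, pow_card_eq_one_of_sub_one_mem J hJ hv]
    · rw [← pow_succ, Nat.sub_add_cancel Nat.card_pos, pow_card_eq_one_of_sub_one_mem J hJ hv]
  have hhalf : ∀ x ∈ J, ∃ y ∈ J, 2 * y = x := by
    have hinj : Function.Injective fun x : J => x + x := by
      intro x y hxy
      have h3 : (x : A) + x = y + y := congrArg Subtype.val hxy
      rw [← two_mul, ← two_mul] at h3
      exact Subtype.ext (h2.mul_left_cancel h3)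
    intro x hx
    obtain ⟨y, hy⟩ := Finite.surjective_of_injective hinj ⟨x, hx⟩
    exact ⟨y, y.2, by rw [two_mul]; exact congrArg Subtype.val hy⟩
  symm
  -- `X ↦ (1 + X) (1 - X)⁻¹ = 2 (1 - X)⁻¹ - 1`
  choose! w hwJ hw hw' using hinv
  have hsub : ∀ X ∈ J, (1 - X) - 1 ∈ J := fun X hX => by
    simpa using J.neg_mem hX
  refine Nat.card_congr (Equiv.ofBijective (fun X : {X : A // X ∈ J ∧ star X = -X} =>
    (⟨⟨2 * w (1 - X) - 1, ?_⟩, ?_⟩ : {g : unitary A // (g : A) - 1 ∈ J})) ⟨?_, ?_⟩)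
  · obtain ⟨X, hX, hs⟩ := X
    have e1 := hw (1 - X) (hsub X hX)
    have e2 := hw' (1 - X) (hsub X hX)
    set v := w (1 - X)
    have e3 : star v * (1 + X) = 1 := by
      have := congrArg star e1
      rwa [star_mul, star_one, star_sub, star_one, hs, sub_neg_eq_add] at this
    have h1 : star (2 * v - 1) * (2 * v - 1) = 1 := by
      have e4 : 2 * v - 1 = (1 + X) * v := by
        calc 2 * v - 1 = 2 * v - (1 - X) * v := by rw [e1]
          _ = _ := by noncomm_ring
      have e5 : star (2 * v - 1) = star v * (1 - X) := by
        rw [e4, star_mul, star_add, star_one, hs, sub_eq_add_neg]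
      rw [e5, e4]
      calc star v * (1 - X) * ((1 + X) * v) = (star v * (1 + X)) * ((1 - X) * v) := by noncomm_ring
        _ = 1 := by rw [e3, e1, one_mul]
    exact Unitary.mem_iff.2 ⟨h1, mul_eq_one_comm.1 h1⟩
  · have := hwJ _ (hsub X.1 X.2.1)
    have h3 : 2 * w (1 - (X : A)) - 1 - 1 = (w (1 - X) - 1) + (w (1 - X) - 1) := by noncomm_ring
    rw [h3]
    exact J.add_mem this this
  · intro X Y hXY
    have h3 := congrArg (fun g : {g : unitary A // (g : A) - 1 ∈ J} => (g.1 : A)) hXY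
    simp only [sub_left_inj] at h3
    have h4 := h2.mul_left_cancel h3
    have h5 : (1 - X.1 : A) = 1 - Y.1 := by
      calc (1 - X.1 : A) = (1 - X.1) * (w (1 - Y.1) * (1 - Y.1)) := by
            rw [hw' _ (hsub _ Y.2.1), mul_one]
        _ = 1 - Y.1 := by rw [← h4, ← mul_assoc, hw _ (hsub _ X.2.1), one_mul]
    exact Subtype.ext (sub_right_injective h5)
  · rintro ⟨g, hg⟩
    obtain ⟨y, hy, h3⟩ := hhalf _ hg
    have hgy : (g : A) = 2 * y + 1 := by rw [h3, sub_add_cancel]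
    have hv : (1 + y) - 1 ∈ J := by simpa using hy
    set u := w (1 + y)
    have e1 : (1 + y) * u = 1 := hw _ hv
    have e2 : u * (1 + y) = 1 := hw' _ hv
    have hu : 1 - u ∈ J := by simpa using J.neg_mem (hwJ _ hv)
    have hsg : star (g : A) * g = 1 := Unitary.coe_star_mul_self g
    have hs : star (1 - u) = -(1 - u) := by
      -- `star (1 + y) = star g * (1 + y)`, so that `star u = u * g = 2 - u`
      have e3 : star (1 + y) = star (g : A) * (1 + y) := by
        apply h2.mul_left_cancel
        have : (2 : A) * star (1 + y) = star (2 * (1 + y)) := by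
          rw [star_mul, star_ofNat, mul_two, two_mul]
        rw [this]
        have e4 : 2 * (1 + y) = g + 1 := by rw [hgy]; noncomm_ring
        have e5 : 2 * (star (g : A) * (1 + y)) = star (g : A) * (2 * (1 + y)) := by noncomm_ring
        rw [e5, e4, mul_add, hsg, star_add, star_one, mul_one, add_comm]
      have e4 : star u * star (1 + y) = 1 := by rw [← star_mul, e1, star_one]
      have e5 : star u = u * g := by
        rw [e3] at e4
        have hgg : (g : A) * star (g : A) = 1 := Unitary.coe_mul_star_self g
        calc star u = star u * (star (g : A) * ((1 + y) * u) * g) := by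
              rw [e1, mul_one, hsg, mul_one]
          _ = (star u * (star (g : A) * (1 + y))) * u * g := by noncomm_ring
          _ = u * g := by rw [e4, one_mul]
      rw [star_sub, star_one, e5, hgy]
      calc 1 - u * (2 * y + 1) = 1 - (2 * (u * (1 + y)) - u) := by noncomm_ring
        _ = _ := by rw [e2]; noncomm_ring
    refine ⟨⟨1 - u, hu, hs⟩, ?_⟩
    apply Subtype.ext
    apply Subtype.ext
    change 2 * w (1 - (1 - u)) - 1 = (g : A)
    have e6 : w (1 - (1 - u)) = 1 + y := by
      have e7 := hw _ (hsub _ hu)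
      rw [sub_sub_cancel] at e7 ⊢
      calc w u = (1 + y) * u * w u := by rw [e1, one_mul]
        _ = 1 + y := by rw [mul_assoc, e7, mul_one]
    rw [e6, hgy]
    noncomm_ring

end PowCard

/-! ### Congruence subgroups and the quadratic exponential -/

section Congruence

variable {A : Type*} [Ring A] [StarRing A]

/-- The skew elements of an ideal. -/
def skewIn (I : Ideal A) : AddSubgroup A where
  carrier := {X | X ∈ I ∧ star X = -X}
  add_mem' := fun ⟨ha, ha'⟩ ⟨hb, hb'⟩ => ⟨I.add_mem ha hb, by rw [star_add, ha', hb']; abel⟩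
  zero_mem' := ⟨I.zero_mem, by simp⟩
  neg_mem' := fun ⟨ha, ha'⟩ => ⟨I.neg_mem ha, by rw [star_neg, ha']⟩

theorem conj_mem_skewIn {I : Ideal A} [I.IsTwoSided] {X : A} (hX : X ∈ skewIn I) (g : unitary A) :
    (g : A) * X * star (g : A) ∈ skewIn I :=
  ⟨I.mul_mem_right _ (I.mul_mem_left _ hX.1), by
    rw [star_mul, star_mul, star_star, hX.2]; noncomm_ring⟩

/-- The unitary elements congruent to `1` modulo an ideal. -/
def unitaryCongr (I : Ideal A) [I.IsTwoSided] : Subgroup (unitary A) where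
  carrier := {g | (g : A) - 1 ∈ I}
  one_mem' := by simp
  mul_mem' := by
    intro a b ha hb
    rw [Set.mem_ofPred_eq] at *
    have : ((a * b : unitary A) : A) - 1 = a * ((b : A) - 1) + ((a : A) - 1) := by
      rw [Submonoid.coe_mul]; noncomm_ring
    rw [this]
    exact I.add_mem (I.mul_mem_left _ hb) ha
  inv_mem' := by
    intro a ha
    rw [Set.mem_ofPred_eq] at *
    have : ((a⁻¹ : unitary A) : A) - 1 = -(star (a : A) * ((a : A) - 1)) := by
      rw [coe_inv_unitary, mul_sub, Unitary.coe_star_mul_self]; noncomm_ring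
    rw [this]
    exact I.neg_mem (I.mul_mem_left _ ha)

theorem mem_unitaryCongr {I : Ideal A} [I.IsTwoSided] {g : unitary A} :
    g ∈ unitaryCongr I ↔ (g : A) - 1 ∈ I := Iff.rfl

instance (I : Ideal A) [I.IsTwoSided] : (unitaryCongr I).Normal where
  conj_mem := by
    intro n hn g
    rw [mem_unitaryCongr] at *
    have : ((g * n * g⁻¹ : unitary A) : A) - 1 = g * ((n : A) - 1) * star (g : A) := by
      rw [Submonoid.coe_mul, Submonoid.coe_mul, coe_inv_unitary, mul_sub, sub_mul, mul_one,
        show (g : A) * star (g : A) = 1 from Unitary.coe_mul_star_self g]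
    rw [this]
    exact I.mul_mem_right _ (I.mul_mem_left _ hn)

/-- A pair of ideals `𝔨 ≤ 𝔥` with `𝔥² ≤ 𝔨` and `𝔥 𝔨 = 𝔨 𝔥 = 0`, so that the group of
unitary elements of `1 + 𝔥` is nilpotent of class at most two. -/
structure HeisPair (𝔥 𝔨 : Ideal A) : Prop where
  le : 𝔨 ≤ 𝔥
  mul_mem : ∀ {x y}, x ∈ 𝔥 → y ∈ 𝔥 → x * y ∈ 𝔨
  mul_eq_zero : ∀ {x y}, x ∈ 𝔥 → y ∈ 𝔨 → x * y = 0
  mul_eq_zero' : ∀ {x y}, x ∈ 𝔥 → y ∈ 𝔨 → y * x = 0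

/-- The truncated exponential of `2 X`. -/
def quadExp (X : A) : A := 1 + 2 * X + 2 * (X * X)

namespace HeisPair

variable {𝔥 𝔨 : Ideal A}

omit [StarRing A] in
theorem quadExp_mul (hp : HeisPair 𝔥 𝔨) {X Y : A} (hX : X ∈ 𝔥) (hY : Y ∈ 𝔥) :
    quadExp X * quadExp Y = quadExp (X + Y + (X * Y - Y * X)) := by
  have hD : X * Y - Y * X ∈ 𝔨 := 𝔨.sub_mem (hp.mul_mem hX hY) (hp.mul_mem hY hX)
  set D := X * Y - Y * X with hDdef
  have hS : X + Y ∈ 𝔥 := 𝔥.add_mem hX hY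
  have h1 : (X + Y + D) * (X + Y + D) = X * X + X * Y + Y * X + Y * Y := by
    calc (X + Y + D) * (X + Y + D) = X * X + X * Y + Y * X + Y * Y + (X + Y) * D + D * (X + Y)
        + D * D := by noncomm_ring
      _ = _ := by
        rw [hp.mul_eq_zero hS hD, hp.mul_eq_zero' hS hD, hp.mul_eq_zero (hp.le hD) hD]
        abel
  rw [quadExp, quadExp, quadExp, h1]
  calc (1 + 2 * X + 2 * (X * X)) * (1 + 2 * Y + 2 * (Y * Y))
      = 1 + 2 * X + 2 * (X * X) + 2 * Y + 4 * (X * Y) + 2 * (Y * Y) + 4 * (X * (Y * Y))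
        + 4 * (X * X * Y) + 4 * (X * X * (Y * Y)) := by noncomm_ring
    _ = 1 + 2 * X + 2 * (X * X) + 2 * Y + 4 * (X * Y) + 2 * (Y * Y) := by
      rw [hp.mul_eq_zero hX (hp.mul_mem hY hY), hp.mul_eq_zero' hY (hp.mul_mem hX hX),
        hp.mul_eq_zero (hp.le (hp.mul_mem hX hX)) (hp.mul_mem hY hY)]
      simp
    _ = _ := by rw [hDdef]; noncomm_ring

omit [StarRing A] in
theorem quadExp_zero : quadExp (0 : A) = 1 := by simp [quadExp]

theorem star_quadExp {X : A} (hX : star X = -X) : star (quadExp X) = quadExp (-X) := by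
  simp only [quadExp, star_add, star_mul, star_one, star_ofNat, hX]
  noncomm_ring

/-- The quadratic exponential as a unitary element. -/
def expU (hp : HeisPair 𝔥 𝔨) (X : skewIn 𝔥) : unitary A :=
  ⟨quadExp X, Unitary.mem_iff.2 ⟨by
      rw [star_quadExp X.2.2, hp.quadExp_mul (𝔥.neg_mem X.2.1) X.2.1]
      convert quadExp_zero using 2
      noncomm_ring, by
      rw [star_quadExp X.2.2, hp.quadExp_mul X.2.1 (𝔥.neg_mem X.2.1)]
      convert quadExp_zero using 2
      noncomm_ring⟩⟩

variable (hp : HeisPair 𝔥 𝔨)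

theorem coe_expU (X : skewIn 𝔥) : (hp.expU X : A) = 1 + 2 * X + 2 * (X * X) := rfl

/-- The commutator of two skew elements of `𝔥`. -/
def brk (X Y : skewIn 𝔥) : skewIn 𝔥 :=
  ⟨X * Y - Y * X, 𝔥.sub_mem (𝔥.mul_mem_left _ Y.2.1) (𝔥.mul_mem_left _ X.2.1), by
    rw [star_sub, star_mul, star_mul, X.2.2, Y.2.2]; noncomm_ring⟩

theorem coe_brk (X Y : skewIn 𝔥) : (brk X Y : A) = X * Y - Y * X := rfl

include hp in
theorem brk_mem (X Y : skewIn 𝔥) : (brk X Y : A) ∈ 𝔨 :=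
  𝔨.sub_mem (hp.mul_mem X.2.1 Y.2.1) (hp.mul_mem Y.2.1 X.2.1)

/-- The Baker-Campbell-Hausdorff formula: the bracket enters without the usual factor `1 / 2`, as
`expU` is the exponential of twice its argument, and the higher terms vanish. -/
theorem expU_mul (X Y : skewIn 𝔥) : hp.expU X * hp.expU Y = hp.expU (X + Y + brk X Y) :=
  Subtype.ext (hp.quadExp_mul X.2.1 Y.2.1)

theorem expU_zero : hp.expU 0 = 1 := Subtype.ext quadExp_zero

include hp in
theorem brk_of_mem {X Y : skewIn 𝔥} (hX : (X : A) ∈ 𝔨) : brk X Y = 0 := by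
  apply Subtype.ext
  rw [coe_brk, hp.mul_eq_zero' Y.2.1 hX, hp.mul_eq_zero Y.2.1 hX, sub_zero]
  rfl

theorem brk_neg (X Y : skewIn 𝔥) : brk X (-Y) = -brk X Y := by
  apply Subtype.ext
  simp only [coe_brk, AddSubgroup.coe_neg]
  noncomm_ring

theorem neg_brk (X Y : skewIn 𝔥) : brk (-X) Y = -brk X Y := by
  apply Subtype.ext
  simp only [coe_brk, AddSubgroup.coe_neg]
  noncomm_ring

theorem brk_swap (X Y : skewIn 𝔥) : brk Y X = -brk X Y := by
  apply Subtype.ext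
  simp only [coe_brk, AddSubgroup.coe_neg]
  noncomm_ring

theorem brk_add (X Y Z : skewIn 𝔥) : brk X (Y + Z) = brk X Y + brk X Z := by
  apply Subtype.ext
  simp only [coe_brk, AddSubgroup.coe_add]
  noncomm_ring

theorem add_brk (X Y Z : skewIn 𝔥) : brk (X + Y) Z = brk X Z + brk Y Z := by
  apply Subtype.ext
  simp only [coe_brk, AddSubgroup.coe_add]
  noncomm_ring

theorem zero_brk (X : skewIn 𝔥) : brk 0 X = 0 := by
  apply Subtype.ext
  simp [coe_brk]

theorem brk_self (X : skewIn 𝔥) : brk X X = 0 := by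
  apply Subtype.ext
  simp [coe_brk]

theorem expU_inv (X : skewIn 𝔥) : (hp.expU X)⁻¹ = hp.expU (-X) := by
  rw [inv_eq_iff_mul_eq_one, expU_mul, brk_neg, brk_self, ← expU_zero hp]
  congr 1
  simp

/-- The commutator of two exponentials. -/
theorem expU_commutator (X Y : skewIn 𝔥) :
    hp.expU X * hp.expU Y * (hp.expU X)⁻¹ * (hp.expU Y)⁻¹ = hp.expU (brk X Y + brk X Y) := by
  have h0 : ∀ Z : skewIn 𝔥, brk (brk X Y) Z = 0 := fun Z => hp.brk_of_mem (hp.brk_mem X Y)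
  rw [expU_inv, expU_inv, expU_mul, expU_mul, expU_mul]
  congr 1
  simp only [add_brk, brk_neg, neg_brk, brk_self, h0, brk_swap X Y, neg_zero,
    zero_brk]
  abel

theorem expU_of_mem {X : skewIn 𝔥} (hX : (X : A) ∈ 𝔨) : (hp.expU X : A) = 1 + 2 * X := by
  rw [coe_expU, hp.mul_eq_zero X.2.1 hX, mul_zero, add_zero]

theorem expU_mem_iff_of_mem {X : skewIn 𝔥} [𝔨.IsTwoSided] (hX : (X : A) ∈ 𝔨) :
    hp.expU X ∈ unitaryCongr 𝔨 := by
  rw [mem_unitaryCongr, hp.expU_of_mem hX, add_sub_cancel_left]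
  exact 𝔨.mul_mem_left _ hX

theorem expU_mem [𝔥.IsTwoSided] (X : skewIn 𝔥) : hp.expU X ∈ unitaryCongr 𝔥 := by
  rw [mem_unitaryCongr, coe_expU, add_assoc, add_sub_cancel_left]
  exact 𝔥.add_mem (𝔥.mul_mem_left _ X.2.1) (𝔥.mul_mem_left _ (𝔥.mul_mem_left _ X.2.1))

/-- Squares of elements of `𝔥` which differ by an element of `𝔨` agree, so that the linear term
determines the exponential. -/
theorem expU_injective (h2 : IsUnit (2 : A)) : Function.Injective hp.expU := by
  intro X Y hXY
  have h1 : hp.expU X * (hp.expU Y)⁻¹ = 1 := by rw [hXY, mul_inv_cancel]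
  -- if `X + X² = Y + Y²`, then `X - Y` lies in `𝔨`, and the squares agree
  have h3 : (X : A) + X * X = Y + Y * Y := by
    have h4 := congrArg Subtype.val hXY
    rw [coe_expU, coe_expU] at h4
    apply h2.mul_left_cancel
    rw [mul_add, mul_add]
    have := congrArg (fun x : A => x - 1) h4
    simpa [add_assoc] using this
  have h4 : (X : A) - Y ∈ 𝔨 := by
    have : (X : A) - Y = Y * Y - X * X := by
      rw [sub_eq_sub_iff_add_eq_add, h3, add_comm]
    rw [this]
    exact 𝔨.sub_mem (hp.mul_mem Y.2.1 Y.2.1) (hp.mul_mem X.2.1 X.2.1)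
  have h5 : (X : A) * X = Y * Y := by
    have : (X : A) * X - Y * Y = X * (X - Y) + (X - Y) * Y := by noncomm_ring
    rw [← sub_eq_zero, this, hp.mul_eq_zero X.2.1 h4, hp.mul_eq_zero' Y.2.1 h4, add_zero]
  rw [h5, add_left_inj] at h3
  exact Subtype.ext h3

/-- The quadratic exponential is onto the unitary elements of `1 + 𝔥`. -/
theorem exists_expU [𝔥.IsTwoSided] (h2 : IsUnit (2 : A)) {g : unitary A}
    (hg : g ∈ unitaryCongr 𝔥) : ∃ X, hp.expU X = g := by
  obtain ⟨c, hc⟩ := h2.exists_right_inv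
  rw [mem_unitaryCongr] at hg
  -- with `g = 1 + 2 P`, the logarithm is `P - P²`
  obtain ⟨P, hP⟩ : ∃ P, P = c * ((g : A) - 1) := ⟨_, rfl⟩
  have hPh : P ∈ 𝔥 := hP ▸ 𝔥.mul_mem_left _ hg
  have hgP : (g : A) = 1 + 2 * P := by rw [hP, ← mul_assoc, hc, one_mul, add_sub_cancel]
  have hPP := hp.mul_mem hPh hPh
  have hPPP : P * (P * P) = 0 := hp.mul_eq_zero hPh hPP
  have hPPP' : P * P * P = 0 := hp.mul_eq_zero' hPh hPP
  have hP4 : P * P * (P * P) = 0 := hp.mul_eq_zero (hp.le hPP) hPP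
  have hsP : star P = -P + 2 * (P * P) := by
    have e1 : star (g : A) * g = 1 := Unitary.coe_star_mul_self g
    have e2 : (g : A) * (1 - 2 * P + 4 * (P * P)) = 1 := by
      rw [hgP]
      calc (1 + 2 * P) * (1 - 2 * P + 4 * (P * P)) = 1 + 8 * (P * (P * P)) := by noncomm_ring
        _ = 1 := by rw [hPPP, mul_zero, add_zero]
    have e3 : star (g : A) = 1 - 2 * P + 4 * (P * P) := left_inv_eq_right_inv e1 e2
    rw [hgP, star_add, star_one, star_mul, star_ofNat, mul_two, ← two_mul] at e3
    apply h2.mul_left_cancel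
    have := congrArg (fun x : A => x - 1) e3
    simp only [add_sub_cancel_left] at this
    rw [this]
    noncomm_ring
  have hs : star (P - P * P) = -(P - P * P) := by
    rw [star_sub, star_mul, hsP]
    calc -P + 2 * (P * P) - (-P + 2 * (P * P)) * (-P + 2 * (P * P))
        = -P + P * P + 2 * (P * (P * P)) + 2 * (P * P * P) - 4 * (P * P * (P * P)) := by
          noncomm_ring
      _ = _ := by rw [hPPP, hPPP', hP4]; noncomm_ring
  refine ⟨⟨P - P * P, 𝔥.sub_mem hPh (hp.le hPP), hs⟩, Subtype.ext ?_⟩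
  rw [coe_expU, hgP]
  calc 1 + 2 * (P - P * P) + 2 * ((P - P * P) * (P - P * P))
      = 1 + 2 * P - 2 * (P * (P * P)) - 2 * (P * P * P) + 2 * (P * P * (P * P)) := by
        noncomm_ring
    _ = _ := by rw [hPPP, hPPP', hP4]; noncomm_ring

/-- Conjugation of a skew element by a unitary element. -/
def conjSkew [𝔥.IsTwoSided] (g : unitary A) (X : skewIn 𝔥) : skewIn 𝔥 :=
  ⟨g * X * star (g : A), conj_mem_skewIn X.2 g⟩

theorem expU_conj [𝔥.IsTwoSided] (g : unitary A) (X : skewIn 𝔥) :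
    g * hp.expU X * g⁻¹ = hp.expU (conjSkew g X) := by
  apply Subtype.ext
  have h1 : star (g : A) * g = 1 := Unitary.coe_star_mul_self g
  have h3 : (g : A) * star (g : A) = 1 := Unitary.coe_mul_star_self g
  change (g : A) * (1 + 2 * X + 2 * (X * X)) * star (g : A) =
    1 + 2 * (g * X * star (g : A)) + 2 * (g * X * star (g : A) * (g * X * star (g : A)))
  calc (g : A) * (1 + 2 * X + 2 * (X * X)) * star (g : A)
      = g * star (g : A) + 2 * (g * X * star (g : A)) + 2 * (g * X * 1 * X * star (g : A)) := by
        noncomm_ring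
    _ = _ := by rw [h3, ← h1]; noncomm_ring

end HeisPair

end Congruence

/-! ### Representations of unitary groups over a Heisenberg pair of ideals -/

namespace HeisPair

open Representation

variable {A : Type*} [Ring A] [StarRing A] {𝔥 𝔨 : Ideal A} [𝔥.IsTwoSided] [𝔨.IsTwoSided]

/-- The stabiliser of (the restriction to the skew elements of) an additive character. -/
def stabSkew (Λ : AddChar A ℂ) : Subgroup (unitary A) where
  carrier := {t | ∀ X, star X = -X → Λ (t * X * star (t : A)) = Λ X}
  one_mem' := by simp
  mul_mem' := by
    intro a b ha hb X hX
    rw [← hb X hX, ← ha (b * X * star (b : A))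
      (by rw [star_mul, star_mul, star_star, hX]; noncomm_ring), Submonoid.coe_mul, star_mul]
    congr 1
    noncomm_ring
  inv_mem' := by
    intro a ha X hX
    have h1 : (a : A) * star (a : A) = 1 := Unitary.coe_mul_star_self a
    rw [← ha (((a⁻¹ : unitary A) : A) * X * star ((a⁻¹ : unitary A) : A))
      (by rw [star_mul, star_mul, star_star, hX]; noncomm_ring), coe_inv_unitary, star_star]
    congr 1
    calc (a : A) * (star (a : A) * X * a) * star (a : A)
        = (a * star (a : A)) * X * (a * star (a : A)) := by noncomm_ring
      _ = X := by rw [h1, one_mul, mul_one]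

theorem mem_stabSkew {Λ : AddChar A ℂ} {t : unitary A} :
    t ∈ stabSkew Λ ↔ ∀ X, star X = -X → Λ (t * X * star (t : A)) = Λ X := Iff.rfl

/-- The radical of the alternating form `Λ [X, Y]` on the skew elements of `𝔥`. -/
def radical (𝔥 : Ideal A) [𝔥.IsTwoSided] (Λ : AddChar A ℂ) : AddSubgroup (skewIn 𝔥) where
  carrier := {X | ∀ Y : skewIn 𝔥, Λ (brk X Y : skewIn 𝔥) = 1}
  add_mem' := fun ha hb Y => by
    rw [add_brk, AddSubgroup.coe_add, AddChar.map_add_eq_mul, ha Y, hb Y, one_mul]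
  zero_mem' := fun Y => by rw [zero_brk]; simp
  neg_mem' := fun {X} ha Y => by
    rw [neg_brk, ← brk_neg]
    exact ha (-Y)

theorem mem_radical {Λ : AddChar A ℂ} {X : skewIn 𝔥} :
    X ∈ radical 𝔥 Λ ↔ ∀ Y : skewIn 𝔥, Λ (brk X Y : skewIn 𝔥) = 1 := Iff.rfl

/-- The properties of the stabiliser of an additive character which determine the dimensions of
the representations attached to its restriction to `𝔨`. -/
structure Polarised (𝔥 𝔨 : Ideal A) [𝔥.IsTwoSided] [𝔨.IsTwoSided] (Λ : AddChar A ℂ) : Prop where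
  /-- the stabiliser of `Λ` is commutative -/
  comm : ∀ s ∈ stabSkew Λ, ∀ t ∈ stabSkew Λ, s * t = t * s
  /-- the stabiliser of the restriction of `Λ` to `𝔨` is the product of `1 + 𝔥` and the stabiliser
  of `Λ` -/
  exists_mul : ∀ g : unitary A, (∀ X ∈ skewIn 𝔨, Λ (g * X * star (g : A)) = Λ X) →
    ∃ h ∈ unitaryCongr 𝔥, ∃ t ∈ stabSkew Λ, g = h * t
  /-- the stabiliser of `Λ` acts trivially on the radical modulo `𝔨` -/
  conj_sub_mem : ∀ t ∈ stabSkew Λ, ∀ X ∈ radical 𝔥 Λ, (conjSkew t X - X : A) ∈ 𝔨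

variable (hp : HeisPair 𝔥 𝔨) (h2 : IsUnit (2 : A))

omit [𝔥.IsTwoSided] in
include hp h2 in
theorem exists_expU_of_mem {k : unitary A} (hk : k ∈ unitaryCongr 𝔨) :
    ∃ X : skewIn 𝔥, (X : A) ∈ 𝔨 ∧ hp.expU X = k := by
  have hp' : HeisPair 𝔨 𝔨 := ⟨le_rfl, fun hx hy => hp.mul_mem (hp.le hx) (hp.le hy),
    fun hx hy => hp.mul_eq_zero (hp.le hx) hy, fun hx hy => hp.mul_eq_zero' (hp.le hx) hy⟩
  obtain ⟨X, rfl⟩ := hp'.exists_expU h2 hk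
  exact ⟨⟨X, hp.le X.2.1, X.2.2⟩, X.2.1, rfl⟩

/-- The function `χ` on the unitary elements of `1 + 𝔨` is the additive character `Λ`. -/
def Matches (χ : unitary A → ℂ) (Λ : AddChar A ℂ) : Prop :=
  ∀ X : skewIn 𝔥, (X : A) ∈ 𝔨 → χ (hp.expU X) = Λ X

variable {V : Type*} [AddCommGroup V] [Module ℂ V]
  {ρ : Representation ℂ (unitary A) V} {χ : unitary A → ℂ}

omit [𝔥.IsTwoSided] in
/-- On `𝔨` the exponential is a homomorphism, so that a weight for `1 + 𝔨` is an additive character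
of the skew elements of `𝔨`; it is extended to the whole ring. -/
theorem exists_matches [Finite A]
    (hχ : weightSpace ρ (unitaryCongr 𝔨) χ ≠ ⊥) : ∃ Λ, hp.Matches χ Λ := by
  classical
  let B : AddSubgroup A := skewIn 𝔨
  let f : A → ℂ := fun X => if h : X ∈ skewIn 𝔥 then χ (hp.expU ⟨X, h⟩) else 0
  have hB : ∀ x ∈ B, x ∈ skewIn 𝔥 := fun x hx => ⟨hp.le hx.1, hx.2⟩
  have hf : ∀ x (hx : x ∈ B), f x = χ (hp.expU ⟨x, hB x hx⟩) := fun x hx => dif_pos (hB x hx)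
  obtain ⟨Λ, hΛ⟩ := AddChar.exists_extend B f (by
    rw [hf 0 B.zero_mem, ← weight_one hχ]
    exact congrArg χ hp.expU_zero) (fun x hx y hy => by
    rw [hf _ (B.add_mem hx hy), hf x hx, hf y hy, ← weight_mul hχ
      (hp.expU_mem_iff_of_mem hx.1) (hp.expU_mem_iff_of_mem hy.1), expU_mul,
      hp.brk_of_mem hx.1, add_zero]
    rfl)
  refine ⟨Λ, fun X hX => ?_⟩
  rw [hΛ X ⟨hX, X.2.2⟩, hf X ⟨hX, X.2.2⟩]

include h2 in
/-- The stabiliser of a weight for `1 + 𝔨` is the stabiliser of the additive character of `𝔨` to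
which it corresponds. -/
theorem mem_charStab_iff {Λ : AddChar A ℂ} (hΛ : hp.Matches χ Λ) {g : unitary A} :
    g ∈ charStab (unitaryCongr 𝔨) χ ↔ ∀ X ∈ skewIn 𝔨, Λ (g * X * star (g : A)) = Λ X := by
  rw [mem_charStab]
  constructor
  · intro h X hX
    have h1 := h (hp.expU ⟨X, hp.le hX.1, hX.2⟩) (hp.expU_mem_iff_of_mem hX.1)
    rw [expU_conj,
      hΛ (conjSkew g ⟨X, hp.le hX.1, hX.2⟩) (𝔨.mul_mem_right _ (𝔨.mul_mem_left _ hX.1)),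
      hΛ ⟨X, hp.le hX.1, hX.2⟩ hX.1] at h1
    exact h1
  · intro h k hk
    obtain ⟨X, hX, rfl⟩ := hp.exists_expU_of_mem h2 hk
    rw [expU_conj, hΛ X hX, hΛ (conjSkew g X) (𝔨.mul_mem_right _ (𝔨.mul_mem_left _ hX))]
    exact h X ⟨hX, X.2.2⟩

omit [𝔥.IsTwoSided] [𝔨.IsTwoSided] in
include h2 in
theorem exists_half (Y : skewIn 𝔥) : ∃ Z : skewIn 𝔥, Z + Z = Y := by
  obtain ⟨c, hc⟩ := h2.exists_right_inv
  have hs : star (c * (Y : A)) = -(c * Y) := by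
    apply h2.mul_left_cancel
    have e1 : (2 : A) * star (c * (Y : A)) = star (2 * (c * (Y : A))) := by
      rw [star_mul 2, star_ofNat, mul_two, two_mul]
    rw [e1, ← mul_assoc, hc, one_mul, Y.2.2, mul_neg, ← mul_assoc, hc, one_mul]
  refine ⟨⟨c * Y, 𝔥.mul_mem_left _ Y.2.1, hs⟩, Subtype.ext ?_⟩
  change c * (Y : A) + c * Y = Y
  rw [← two_mul, ← mul_assoc, hc, one_mul]

omit [𝔥.IsTwoSided] [𝔨.IsTwoSided] in
/-- The exponential need not be a homomorphism, but it is injective. -/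
theorem card_congr_expU [Finite A] (B : AddSubgroup (skewIn 𝔥)) (P : Subgroup (unitary A))
    (h : ∀ g, g ∈ P ↔ ∃ X ∈ B, hp.expU X = g) (h2 : IsUnit (2 : A)) :
    Nat.card P = Nat.card B := by
  symm
  refine Nat.card_congr (Equiv.ofBijective
    (fun X : B => (⟨hp.expU X, (h _).2 ⟨X, X.2, rfl⟩⟩ : P)) ⟨fun X Y hXY => ?_, fun g => ?_⟩)
  · exact Subtype.ext (hp.expU_injective h2 (congrArg Subtype.val hXY))
  · obtain ⟨X, hX, hg⟩ := (h g).1 g.2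
    exact ⟨⟨X, hX⟩, Subtype.ext hg⟩

include h2 in
/-- If all additive characters which restrict to the weight `χ` on `𝔨` are polarised, the
dimension of the weight space is the square root of the index of the radical. The additive
character in the statement is chosen to be compatible with the scalars by which the radical
acts on the weight space. -/
theorem exists_matches_finrank_sq [Finite A] [FiniteDimensional ℂ V] (hρ : ρ.IsIrreducible)
    (hχ : weightSpace ρ (unitaryCongr 𝔨) χ ≠ ⊥)
    (hpol : ∀ Λ, hp.Matches χ Λ → Polarised 𝔥 𝔨 Λ) :
    ∃ Λ, hp.Matches χ Λ ∧ Module.finrank ℂ (weightSpace ρ (unitaryCongr 𝔨) χ) ^ 2 *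
      Nat.card (radical 𝔥 Λ) = Nat.card (skewIn 𝔥) := by
  classical
  set K := unitaryCongr 𝔨 with hK
  set W := weightSpace ρ K χ with hW
  set S := charStab K χ with hS
  obtain ⟨Λ₀, hΛ₀⟩ := hp.exists_matches hχ
  have hpol₀ := hpol Λ₀ hΛ₀
  have hσ : (weightRep ρ K χ).IsIrreducible := hρ.weightRep hχ
  have hWn := hσ.nontrivial
  -- all matching characters agree on the commutators, and have the same radical
  have hbrk : ∀ Λ, hp.Matches χ Λ → ∀ X Y : skewIn 𝔥, Λ (brk X Y : skewIn 𝔥) =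
      χ (hp.expU (brk X Y)) := fun Λ hΛ X Y => (hΛ _ (hp.brk_mem X Y)).symm
  have hrad : ∀ Λ, hp.Matches χ Λ → radical 𝔥 Λ = radical 𝔥 Λ₀ := by
    intro Λ hΛ
    ext X
    simp only [mem_radical, hbrk Λ hΛ, hbrk Λ₀ hΛ₀]
  have hHS : ∀ X : skewIn 𝔥, hp.expU X ∈ S := by
    intro X
    rw [hS, mem_charStab]
    intro k hk
    obtain ⟨Y, hY, rfl⟩ := hp.exists_expU_of_mem h2 hk
    congr 1
    rw [← mul_inv_eq_one, expU_commutator, brk_swap Y X, hp.brk_of_mem hY, neg_zero, add_zero,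
      expU_zero]
  have hstabS : ∀ Λ, hp.Matches χ Λ → stabSkew Λ ≤ S := fun Λ hΛ t ht =>
    (hp.mem_charStab_iff h2 hΛ).2 fun X hX => ht X hX.2
  -- action of elements of `𝔨`
  have hact : ∀ (X : skewIn 𝔥), (X : A) ∈ 𝔨 → ∀ w ∈ W, ρ (hp.expU X) w = Λ₀ X • w := by
    intro X hX w hw
    rw [hw _ (hp.expU_mem_iff_of_mem hX), hΛ₀ X hX]
  have hdbl : ∀ X Y : skewIn 𝔥, X ∈ radical 𝔥 Λ₀ →
      Λ₀ ((brk X Y + brk X Y : skewIn 𝔥) : A) = 1 := fun X Y hX => by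
    rw [AddSubgroup.coe_add, AddChar.map_add_eq_mul, hX Y, one_mul]
  -- the radical acts by scalars
  have hscal : ∀ X ∈ radical 𝔥 Λ₀, ∃ c : ℂ, ∀ w ∈ W, ρ (hp.expU X) w = c • w := by
    intro X hX
    obtain ⟨c, hc⟩ := hσ.exists_eq_smul_one (weightRep ρ K χ ⟨hp.expU X, hHS X⟩) (by
      -- it is enough that the commutator of `s` and `expU X` acts trivially
      have hred : ∀ s : S, ∀ Z : skewIn 𝔥, (Z : A) ∈ 𝔨 → Λ₀ Z = 1 →
          (s : unitary A) * hp.expU X = hp.expU X * hp.expU Z * s →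
          Commute (weightRep ρ K χ s) (weightRep ρ K χ ⟨hp.expU X, hHS X⟩) := by
        intro s Z hZ hZ1 hcomm
        rw [commute_iff_eq]
        ext w
        simp only [Module.End.mul_apply, coe_weightRep_apply]
        rw [← Module.End.mul_apply, ← map_mul, hcomm, map_mul, map_mul, Module.End.mul_apply,
          Module.End.mul_apply, hact Z hZ _ (apply_mem_weightSpace s.2 w.2), hZ1, one_smul]
      intro s
      obtain ⟨h, hh, t, ht, hst⟩ := hpol₀.exists_mul s ((hp.mem_charStab_iff h2 hΛ₀).1 s.2)
      obtain ⟨Y, rfl⟩ := hp.exists_expU h2 hh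
      have e1 : s = (⟨hp.expU Y, hHS Y⟩ : S) * ⟨t, hstabS Λ₀ hΛ₀ ht⟩ := Subtype.ext hst
      rw [e1, map_mul]
      refine Commute.mul_left ?_ ?_
      · refine hred _ (brk Y X + brk Y X) (𝔨.add_mem (hp.brk_mem Y X) (hp.brk_mem Y X)) ?_ ?_
        · rw [brk_swap X Y, ← neg_add, AddSubgroup.coe_neg, AddChar.map_neg_eq_inv, hdbl X Y hX,
            inv_one]
        · change hp.expU Y * hp.expU X = hp.expU X * hp.expU (brk Y X + brk Y X) * hp.expU Y
          have hc : ∀ Z : skewIn 𝔥, Z + (brk Y X + brk Y X) = (brk Y X + brk Y X) + Z :=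
            fun Z => add_comm _ _
          have hk : ((brk Y X + brk Y X : skewIn 𝔥) : A) ∈ 𝔨 :=
            𝔨.add_mem (hp.brk_mem Y X) (hp.brk_mem Y X)
          have : hp.expU X * hp.expU (brk Y X + brk Y X) =
              hp.expU (brk Y X + brk Y X) * hp.expU X := by
            rw [expU_mul, expU_mul, hp.brk_of_mem hk, brk_swap (brk Y X + brk Y X) X,
              hp.brk_of_mem hk, hc, neg_zero]
          rw [this, ← expU_commutator]
          group
      · set D : skewIn 𝔥 := conjSkew t X - X with hD
        have hDk : (D : A) ∈ 𝔨 := hpol₀.conj_sub_mem t ht X hX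
        refine hred _ D hDk ?_ ?_
        · have : Λ₀ (D + X : skewIn 𝔥) = Λ₀ X := by
            rw [hD, sub_add_cancel]
            exact ht X X.2.2
          rw [AddSubgroup.coe_add, AddChar.map_add_eq_mul] at this
          have h0 : Λ₀ (X : A) ≠ 0 := fun h => by
            have := Λ₀.map_zero_eq_one
            rw [← add_neg_cancel (X : A), AddChar.map_add_eq_mul, h, zero_mul] at this
            exact zero_ne_one this
          exact mul_right_cancel₀ h0 (by rw [one_mul]; exact this)
        · change t * hp.expU X = hp.expU X * hp.expU D * t
          have : hp.expU X * hp.expU D = t * hp.expU X * t⁻¹ := by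
            rw [expU_conj, expU_mul, brk_swap D X, hp.brk_of_mem hDk, neg_zero, add_zero, hD,
              add_sub_cancel]
          rw [this]
          group)
    refine ⟨c, fun w hw => ?_⟩
    have := congrArg (fun f : Module.End ℂ W => (f ⟨w, hw⟩ : V)) hc
    exact this
  choose! f hf using hscal
  obtain ⟨w₀, hw₀, hw₀0⟩ := Submodule.exists_mem_ne_zero_of_ne_bot hχ
  have hfadd : ∀ X ∈ radical 𝔥 Λ₀, ∀ Y ∈ radical 𝔥 Λ₀, f (X + Y) = f X * f Y := by
    intro X hX Y hY
    have hb : brk X Y ∈ radical 𝔥 Λ₀ := fun Z => by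
      rw [hp.brk_of_mem (hp.brk_mem X Y)]; simp
    have e1 : hp.expU (X + Y) * hp.expU (brk X Y) = hp.expU X * hp.expU Y := by
      rw [expU_mul, expU_mul, brk_swap (brk X Y) (X + Y), hp.brk_of_mem (hp.brk_mem X Y), neg_zero,
        add_zero]
    have e2 := congrArg (fun g => ρ g w₀) e1
    simp only [map_mul, Module.End.mul_apply] at e2
    rw [hact _ (hp.brk_mem X Y) _ hw₀, hX Y, one_smul, hf _ (add_mem hX hY) _ hw₀,
      hf Y hY _ hw₀, map_smul, hf X hX _ hw₀, smul_smul, mul_comm (f Y)] at e2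
    exact smul_left_injective ℂ hw₀0 e2
  -- on `𝔨` the scalars are given by the weight
  have hf𝔨 : ∀ X : skewIn 𝔥, (X : A) ∈ 𝔨 → X ∈ radical 𝔥 Λ₀ ∧ f X = Λ₀ X := by
    intro X hX
    have hXr : X ∈ radical 𝔥 Λ₀ := fun Z => by rw [hp.brk_of_mem hX]; simp
    refine ⟨hXr, smul_left_injective ℂ hw₀0 ?_⟩
    exact (hf X hXr w₀ hw₀).symm.trans (hact X hX w₀ hw₀)
  -- extend the scalars to an additive character
  obtain ⟨Λ, hΛ⟩ := AddChar.exists_extend ((radical 𝔥 Λ₀).map (skewIn 𝔥).subtype)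
    (fun x => if h : x ∈ skewIn 𝔥 then f ⟨x, h⟩ else 0) (by
      rw [dif_pos (skewIn 𝔥).zero_mem]
      exact (hf𝔨 0 𝔨.zero_mem).2.trans Λ₀.map_zero_eq_one) (by
      rintro _ ⟨X, hX, rfl⟩ _ ⟨Y, hY, rfl⟩
      have := hfadd X hX Y hY
      rw [← AddSubgroup.coe_subtype] at *
      change (if h : ((X + Y : skewIn 𝔥) : A) ∈ skewIn 𝔥 then f ⟨_, h⟩ else 0) =
        (if h : (X : A) ∈ skewIn 𝔥 then f ⟨X, h⟩ else 0) *
        (if h : (Y : A) ∈ skewIn 𝔥 then f ⟨Y, h⟩ else 0)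
      rw [dif_pos (X + Y).2, dif_pos X.2, dif_pos Y.2]
      exact this)
  have hΛf : ∀ X ∈ radical 𝔥 Λ₀, Λ X = f X := fun X hX => by
    rw [hΛ X ⟨X, hX, rfl⟩, dif_pos X.2]
  have hΛm : hp.Matches χ Λ := fun X hX => by
    rw [hΛf X (hf𝔨 X hX).1, (hf𝔨 X hX).2, hΛ₀ X hX]
  have hpolΛ := hpol Λ hΛm
  refine ⟨Λ, hΛm, ?_⟩
  -- the subgroups
  let R : Subgroup (unitary A) :=
    { carrier := {g | ∃ X ∈ radical 𝔥 Λ₀, hp.expU X = g}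
      one_mem' := ⟨0, zero_mem _, hp.expU_zero⟩
      mul_mem' := by
        rintro _ _ ⟨X, hX, rfl⟩ ⟨Y, hY, rfl⟩
        refine ⟨X + Y + brk X Y, add_mem (add_mem hX hY) (hf𝔨 _ (hp.brk_mem X Y)).1, ?_⟩
        rw [expU_mul]
      inv_mem' := by
        rintro _ ⟨X, hX, rfl⟩
        exact ⟨-X, neg_mem hX, (hp.expU_inv X).symm⟩ }
  have hRmem : ∀ X, hp.expU X ∈ R → X ∈ radical 𝔥 Λ₀ := by
    rintro X ⟨Y, hY, hXY⟩
    rwa [← hp.expU_injective h2 hXY]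
  have hHS' : unitaryCongr 𝔥 ≤ S := fun g hg => by
    obtain ⟨X, rfl⟩ := hp.exists_expU h2 hg
    exact hHS X
  have hRH : R ≤ unitaryCongr 𝔥 := by
    rintro _ ⟨X, -, rfl⟩
    exact hp.expU_mem X
  have hone : ∀ (s : S) (c : ℂ), (∀ w ∈ W, ρ s w = c • w) → weightRep ρ K χ s = c • 1 := by
    intro s c h
    ext w
    exact h w w.2
  have key := IsIrreducible.finrank_sq_mul_card hσ ((unitaryCongr 𝔥).subgroupOf S)
    ((stabSkew Λ).subgroupOf S) (R.subgroupOf S) (fun x hx => hRH hx) ?_ ?_ ?_ ?_ ?_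
  · rw [Nat.card_congr (Subgroup.subgroupOfEquivOfLe (hRH.trans hHS')).toEquiv,
      Nat.card_congr (Subgroup.subgroupOfEquivOfLe hHS').toEquiv,
      hp.card_congr_expU (radical 𝔥 Λ₀) R (fun g => Iff.rfl) h2,
      hp.card_congr_expU ⊤ (unitaryCongr 𝔥) (fun g => ⟨fun hg => by
        obtain ⟨X, hX⟩ := hp.exists_expU h2 hg
        exact ⟨X, trivial, hX⟩, fun ⟨X, _, hX⟩ => hX ▸ hp.expU_mem X⟩) h2,
      AddSubgroup.card_top] at key
    rw [hrad Λ hΛm]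
    exact key
  · rintro s hs t ht
    exact Subtype.ext (hpolΛ.comm s hs t ht)
  · intro g
    obtain ⟨h, hh, t, ht, hgt⟩ := hpolΛ.exists_mul g ((hp.mem_charStab_iff h2 hΛm).1 g.2)
    exact ⟨⟨h, hHS' hh⟩, hh, ⟨t, hstabS Λ hΛm ht⟩, ht, Subtype.ext hgt⟩
  · rintro ⟨_, _⟩ ⟨X, hX, rfl⟩
    exact ⟨f X, hone _ _ (hf X hX)⟩
  · rintro ⟨h, hhS⟩ hh hhR
    obtain ⟨X, rfl⟩ := hp.exists_expU h2 hh
    have hXr : X ∉ radical 𝔥 Λ₀ := fun hX => hhR ⟨X, hX, rfl⟩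
    rw [mem_radical] at hXr
    push Not at hXr
    obtain ⟨Y, hY⟩ := hXr
    -- the commutator of exponentials is the exponential of twice the bracket
    obtain ⟨Z, rfl⟩ := exists_half h2 Y
    refine ⟨⟨hp.expU Z, hHS Z⟩, hp.expU_mem Z, _, hY, hone _ _ fun w hw => ?_⟩
    change ρ (hp.expU X * hp.expU Z * (hp.expU X)⁻¹ * (hp.expU Z)⁻¹) w = _
    rw [expU_commutator, ← brk_add, hact _ (hp.brk_mem _ _) w hw]
  · rintro ⟨t, htS⟩ ht ⟨h, hhS⟩ hh hcR
    obtain ⟨X, rfl⟩ := hp.exists_expU h2 hh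
    replace ht : t ∈ stabSkew Λ := ht
    set X' : skewIn 𝔥 := conjSkew t X with hX'
    set Z : skewIn 𝔥 := X' + -X + brk X' (-X) with hZ
    have hcom : t * hp.expU X * t⁻¹ * (hp.expU X)⁻¹ = hp.expU Z := by
      rw [expU_conj, expU_inv, expU_mul]
    have hZr : Z ∈ radical 𝔥 Λ₀ := hRmem Z (by rw [← hcom]; exact hcR)
    have h1 := hone ⟨hp.expU Z, hHS Z⟩ _ (hf Z hZr)
    have h3 : f Z = 1 := by
      -- `Λ` is invariant under `t`, and `[Z, X] = [X', X]`
      have hX'Λ : Λ X' = Λ X := ht X X.2.2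
      rw [← hΛf Z hZr, hZ, AddSubgroup.coe_add, AddChar.map_add_eq_mul, AddSubgroup.coe_add,
        AddChar.map_add_eq_mul, hX'Λ, ← AddChar.map_add_eq_mul, AddSubgroup.coe_neg,
        add_neg_cancel, AddChar.map_zero_eq_one, one_mul]
      have h4 := (hrad Λ hΛm ▸ hZr : Z ∈ radical 𝔥 Λ) (-X)
      rw [hZ, add_brk, add_brk, hp.brk_of_mem (hp.brk_mem _ _), neg_brk, brk_neg X, brk_self,
        neg_zero, neg_zero, add_zero, add_zero] at h4
      exact h4
    rw [h3, one_smul] at h1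
    rw [← h1]
    congr 1
    exact Subtype.ext hcom

end HeisPair

/-! ### The centraliser algebra -/

/-- The centraliser of the matrix `𝐜` with parameter `δ`, `τ = 2 δ`, in the `3 × 3` matrices over
the quadratic algebra `S = R ⊕ R ξ`, `ξ² = u`. The element with coordinates `(a, c, b, e, d)` is
the matrix with rows `(a + δ c, b, c)`, `(δ e, d, e)`, `(δ² c, δ b, a + δ c)`; in these coordinates
`δ` enters the multiplication only through `τ`. -/
@[ext] structure Cen (R : Type*) [CommRing R] (u τ : R) where
  /-- the upper left entry minus `δ c`, which is the eigenvalue on the kernel of `𝐜 + δ` -/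
  a : QuadraticAlgebra R u 0
  /-- the upper right entry -/
  c : QuadraticAlgebra R u 0
  /-- the upper middle entry -/
  b : QuadraticAlgebra R u 0
  /-- the middle right entry -/
  e : QuadraticAlgebra R u 0
  /-- the central entry -/
  d : QuadraticAlgebra R u 0

namespace Cen

variable {R : Type*} [CommRing R] {u τ : R}

local notation "S" => QuadraticAlgebra R u 0

instance : Zero (Cen R u τ) := ⟨⟨0, 0, 0, 0, 0⟩⟩
instance : One (Cen R u τ) := ⟨⟨1, 0, 0, 0, 1⟩⟩
instance : Add (Cen R u τ) :=
  ⟨fun X Y => ⟨X.a + Y.a, X.c + Y.c, X.b + Y.b, X.e + Y.e, X.d + Y.d⟩⟩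
instance : Neg (Cen R u τ) := ⟨fun X => ⟨-X.a, -X.c, -X.b, -X.e, -X.d⟩⟩
instance : Mul (Cen R u τ) :=
  ⟨fun X Y => ⟨X.a * Y.a,
    X.a * Y.c + X.c * Y.a + algebraMap R S τ * X.c * Y.c + X.b * Y.e,
    (X.a + algebraMap R S τ * X.c) * Y.b + X.b * Y.d,
    X.e * (Y.a + algebraMap R S τ * Y.c) + X.d * Y.e,
    X.d * Y.d + algebraMap R S τ * X.e * Y.b⟩⟩
instance : Star (Cen R u τ) :=
  ⟨fun X => ⟨star X.a, star X.c, star X.e, star X.b, star X.d⟩⟩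

section

variable (X Y : Cen R u τ)

@[simp] theorem zero_a : (0 : Cen R u τ).a = 0 := rfl
@[simp] theorem zero_c : (0 : Cen R u τ).c = 0 := rfl
@[simp] theorem zero_b : (0 : Cen R u τ).b = 0 := rfl
@[simp] theorem zero_e : (0 : Cen R u τ).e = 0 := rfl
@[simp] theorem zero_d : (0 : Cen R u τ).d = 0 := rfl
@[simp] theorem one_a : (1 : Cen R u τ).a = 1 := rfl
@[simp] theorem one_c : (1 : Cen R u τ).c = 0 := rfl
@[simp] theorem one_b : (1 : Cen R u τ).b = 0 := rfl
@[simp] theorem one_e : (1 : Cen R u τ).e = 0 := rfl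
@[simp] theorem one_d : (1 : Cen R u τ).d = 1 := rfl
@[simp] theorem add_a : (X + Y).a = X.a + Y.a := rfl
@[simp] theorem add_c : (X + Y).c = X.c + Y.c := rfl
@[simp] theorem add_b : (X + Y).b = X.b + Y.b := rfl
@[simp] theorem add_e : (X + Y).e = X.e + Y.e := rfl
@[simp] theorem add_d : (X + Y).d = X.d + Y.d := rfl
@[simp] theorem neg_a : (-X).a = -X.a := rfl
@[simp] theorem neg_c : (-X).c = -X.c := rfl
@[simp] theorem neg_b : (-X).b = -X.b := rfl
@[simp] theorem neg_e : (-X).e = -X.e := rfl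
@[simp] theorem neg_d : (-X).d = -X.d := rfl
@[simp] theorem mul_a : (X * Y).a = X.a * Y.a := rfl
@[simp] theorem mul_c : (X * Y).c =
    X.a * Y.c + X.c * Y.a + algebraMap R S τ * X.c * Y.c + X.b * Y.e := rfl
@[simp] theorem mul_b : (X * Y).b = (X.a + algebraMap R S τ * X.c) * Y.b + X.b * Y.d := rfl
@[simp] theorem mul_e : (X * Y).e = X.e * (Y.a + algebraMap R S τ * Y.c) + X.d * Y.e := rfl
@[simp] theorem mul_d : (X * Y).d = X.d * Y.d + algebraMap R S τ * X.e * Y.b := rfl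
@[simp] theorem star_a : (star X).a = star X.a := rfl
@[simp] theorem star_c : (star X).c = star X.c := rfl
@[simp] theorem star_b : (star X).b = star X.e := rfl
@[simp] theorem star_e : (star X).e = star X.b := rfl
@[simp] theorem star_d : (star X).d = star X.d := rfl

end

instance : Ring (Cen R u τ) where
  add_assoc X Y Z := by ext1 <;> simp [add_assoc]
  zero_add X := by ext1 <;> simp
  add_zero X := by ext1 <;> simp
  add_comm X Y := by ext1 <;> simp [add_comm]
  nsmul := nsmulRec
  zsmul := zsmulRec
  neg_add_cancel X := by ext1 <;> simp
  mul_assoc X Y Z := by ext1 <;> simp only [mul_a, mul_c, mul_b, mul_e, mul_d] <;> ring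
  one_mul X := by ext1 <;> simp
  mul_one X := by ext1 <;> simp
  zero_mul X := by ext1 <;> simp
  mul_zero X := by ext1 <;> simp
  left_distrib X Y Z := by
    ext1 <;> simp only [mul_a, mul_c, mul_b, mul_e, mul_d, add_a, add_c, add_b, add_e, add_d] <;>
      ring
  right_distrib X Y Z := by
    ext1 <;> simp only [mul_a, mul_c, mul_b, mul_e, mul_d, add_a, add_c, add_b, add_e, add_d] <;>
      ring

section

variable (X Y : Cen R u τ)

@[simp] theorem sub_a : (X - Y).a = X.a - Y.a := by rw [sub_eq_add_neg, sub_eq_add_neg]; rfl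
@[simp] theorem sub_c : (X - Y).c = X.c - Y.c := by rw [sub_eq_add_neg, sub_eq_add_neg]; rfl
@[simp] theorem sub_b : (X - Y).b = X.b - Y.b := by rw [sub_eq_add_neg, sub_eq_add_neg]; rfl
@[simp] theorem sub_e : (X - Y).e = X.e - Y.e := by rw [sub_eq_add_neg, sub_eq_add_neg]; rfl
@[simp] theorem sub_d : (X - Y).d = X.d - Y.d := by rw [sub_eq_add_neg, sub_eq_add_neg]; rfl

end

theorem star_algebraMap' (r : R) : star (algebraMap R S r) = algebraMap R S r := by
  ext <;> simp

instance : StarRing (Cen R u τ) where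
  star_involutive X := by ext1 <;> simp
  star_mul X Y := by
    ext1 <;> simp only [mul_a, mul_c, mul_b, mul_e, mul_d, star_a, star_c, star_b, star_e, star_d,
      star_add, star_mul, star_algebraMap'] <;> ring
  star_add X Y := by ext1 <;> simp

/-- The coordinates, as an equivalence. -/
def coords : Cen R u τ ≃ S × S × S × S × S where
  toFun X := (X.a, X.c, X.b, X.e, X.d)
  invFun x := ⟨x.1, x.2.1, x.2.2.1, x.2.2.2.1, x.2.2.2.2⟩

instance [Finite R] : Finite (QuadraticAlgebra R u 0) :=
  Finite.of_equiv _ (QuadraticAlgebra.equivProd u 0).symm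

instance [Finite R] : Finite (Cen R u τ) := Finite.of_equiv _ coords.symm

/-- The inclusion of the scalars. -/
def scalar : S →+* Cen R u τ where
  toFun s := ⟨s, 0, 0, 0, s⟩
  map_one' := rfl
  map_mul' s t := by ext1 <;> simp
  map_zero' := rfl
  map_add' s t := by ext1 <;> simp

@[simp] theorem scalar_a (s : S) : (scalar s : Cen R u τ).a = s := rfl
@[simp] theorem scalar_c (s : S) : (scalar s : Cen R u τ).c = 0 := rfl
@[simp] theorem scalar_b (s : S) : (scalar s : Cen R u τ).b = 0 := rfl
@[simp] theorem scalar_e (s : S) : (scalar s : Cen R u τ).e = 0 := rfl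
@[simp] theorem scalar_d (s : S) : (scalar s : Cen R u τ).d = s := rfl

theorem scalar_comm (s : S) (X : Cen R u τ) : X * scalar s = scalar s * X := by
  ext1 <;> simp [mul_comm]

theorem isUnit_two (h2 : IsUnit (2 : R)) : IsUnit (2 : Cen R u τ) := by
  have := h2.map ((scalar : S →+* Cen R u τ).comp (algebraMap R S))
  rwa [map_ofNat] at this

/-- The ideal of multiples of an element of the base ring. -/
def multiples (r : R) : Ideal (Cen R u τ) := Ideal.span {scalar (algebraMap R S r)}

theorem mem_multiples_iff_exists {r : R} {X : Cen R u τ} :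
    X ∈ multiples r ↔ ∃ Y, X = scalar (algebraMap R S r) * Y := by
  rw [multiples, Ideal.mem_span_singleton']
  simp only [scalar_comm, eq_comm]

instance (r : R) : (multiples r : Ideal (Cen R u τ)).IsTwoSided where
  mul_mem_of_left := by
    intro X Y hX
    rw [mem_multiples_iff_exists] at *
    obtain ⟨Z, rfl⟩ := hX
    exact ⟨Z * Y, mul_assoc _ _ _⟩

theorem algebraMap_dvd_iff {r : R} {s : S} : algebraMap R S r ∣ s ↔ r ∣ s.re ∧ r ∣ s.im := by
  constructor
  · rintro ⟨t, rfl⟩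
    exact ⟨⟨t.re, by simp⟩, ⟨t.im, by simp⟩⟩
  · rintro ⟨⟨x, hx⟩, ⟨y, hy⟩⟩
    exact ⟨⟨x, y⟩, by ext <;> simp [hx, hy]⟩

theorem mem_multiples {r : R} {X : Cen R u τ} :
    X ∈ multiples r ↔ algebraMap R S r ∣ X.a ∧ algebraMap R S r ∣ X.c ∧ algebraMap R S r ∣ X.b ∧
      algebraMap R S r ∣ X.e ∧ algebraMap R S r ∣ X.d := by
  rw [mem_multiples_iff_exists]
  constructor
  · rintro ⟨Y, rfl⟩
    exact ⟨⟨Y.a, by simp⟩, ⟨Y.c, by simp⟩, ⟨Y.b, by simp⟩, ⟨Y.e, by simp⟩, ⟨Y.d, by simp⟩⟩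
  · rintro ⟨⟨a, ha⟩, ⟨c, hc⟩, ⟨b, hb⟩, ⟨e, he⟩, ⟨d, hd⟩⟩
    exact ⟨⟨a, c, b, e, d⟩, by ext1 <;> simp [ha, hc, hb, he, hd]⟩

theorem mul_mem_multiples {r s : R} {X Y : Cen R u τ} (hX : X ∈ multiples r)
    (hY : Y ∈ multiples s) : X * Y ∈ multiples (r * s) := by
  rw [mem_multiples_iff_exists] at *
  obtain ⟨X, rfl⟩ := hX
  obtain ⟨Y, rfl⟩ := hY
  refine ⟨X * Y, ?_⟩
  rw [map_mul, map_mul, mul_assoc, ← mul_assoc X, scalar_comm]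
  simp only [mul_assoc]

theorem multiples_le_of_dvd {r s : R} (h : r ∣ s) :
    (multiples s : Ideal (Cen R u τ)) ≤ multiples r := by
  obtain ⟨t, rfl⟩ := h
  intro X hX
  rw [mem_multiples_iff_exists] at *
  obtain ⟨X, rfl⟩ := hX
  exact ⟨scalar (algebraMap R S t) * X, by rw [map_mul, map_mul, mul_assoc]⟩

theorem multiples_zero {X : Cen R u τ} (h : X ∈ multiples (0 : R)) : X = 0 := by
  rw [mem_multiples_iff_exists] at h
  obtain ⟨Y, rfl⟩ := h
  simp

/-- The skew element with the given coordinates over `R`; `v` consists of the two coordinates of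
`b` and of the coordinate of `a + τ c - d`, which are those on which commutators depend. -/
def skewOf (x y : R) (v : R × R × R) : Cen R u τ where
  a := ⟨0, x⟩
  c := ⟨0, y⟩
  b := ⟨v.1, v.2.1⟩
  e := ⟨-v.1, v.2.1⟩
  d := ⟨0, x + τ * y - v.2.2⟩

theorem star_skewOf (x y : R) (v : R × R × R) :
    star (skewOf x y v : Cen R u τ) = -skewOf x y v := by
  ext <;> simp [skewOf]

theorem skewOf_injective {x y x' y' : R} {v v' : R × R × R}
    (h : (skewOf x y v : Cen R u τ) = skewOf x' y' v') : x = x' ∧ y = y' ∧ v = v' := by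
  have h1 := congrArg (fun X => X.a.im) h
  have h2 := congrArg (fun X => X.c.im) h
  have h3 := congrArg (fun X => X.b.re) h
  have h4 := congrArg (fun X => X.b.im) h
  have h5 := congrArg (fun X => X.d.im) h
  simp only [skewOf] at h1 h2 h3 h4 h5
  subst h1 h2
  refine ⟨rfl, rfl, Prod.ext h3 (Prod.ext h4 ?_)⟩
  simpa using h5

theorem eq_zero_of_eq_neg (h2 : IsUnit (2 : R)) {x : R} (h : x = -x) : x = 0 := by
  apply h2.mul_left_cancel
  linear_combination h

/-- A skew element has its entries `a`, `c`, `d` in `R ξ`, and `e = -star b`. -/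
theorem exists_skewOf (h2 : IsUnit (2 : R)) {X : Cen R u τ} (hX : star X = -X) :
    X = skewOf X.a.im X.c.im (X.b.re, X.b.im, X.a.im + τ * X.c.im - X.d.im) := by
  have ha := congrArg (fun X => X.a.re) hX
  have hc := congrArg (fun X => X.c.re) hX
  have hd := congrArg (fun X => X.d.re) hX
  have h1 := congrArg (fun X => X.e.re) hX
  have h3 := congrArg (fun X => X.e.im) hX
  simp at ha hc hd h1 h3
  ext <;> simp only [skewOf, sub_sub_cancel]
  · exact eq_zero_of_eq_neg h2 ha
  · exact eq_zero_of_eq_neg h2 hc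
  · linear_combination h1
  · linear_combination -h3
  · exact eq_zero_of_eq_neg h2 hd

/-- Counting skew elements in terms of their coordinates. -/
theorem card_skew_eq [Finite R] (h2 : IsUnit (2 : R)) (P : Cen R u τ → Prop) (p p' : R → Prop)
    (V : R × R × R → Prop) (h : ∀ x y v, P (skewOf x y v) ↔ p x ∧ p' y ∧ V v) :
    Nat.card {X : Cen R u τ // P X ∧ star X = -X} =
      Nat.card {x // p x} * (Nat.card {y // p' y} * Nat.card {v // V v}) := by
  rw [← Nat.card_prod, ← Nat.card_prod]
  symm
  refine Nat.card_congr (Equiv.ofBijective (fun z : {x // p x} × {y // p' y} × {v // V v} =>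
    (⟨skewOf z.1 z.2.1 z.2.2, (h _ _ _).2 ⟨z.1.2, z.2.1.2, z.2.2.2⟩, star_skewOf _ _ _⟩ :
      {X : Cen R u τ // P X ∧ star X = -X})) ⟨?_, ?_⟩)
  · rintro ⟨⟨x, _⟩, ⟨y, _⟩, ⟨v, _⟩⟩ ⟨⟨x', _⟩, ⟨y', _⟩, ⟨v', _⟩⟩ h
    obtain ⟨rfl, rfl, rfl⟩ := skewOf_injective (congrArg Subtype.val h)
    rfl
  · rintro ⟨X, hX, hs⟩
    have e := exists_skewOf h2 hs
    rw [e, h] at hX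
    exact ⟨⟨⟨_, hX.1⟩, ⟨_, hX.2.1⟩, ⟨_, hX.2.2⟩⟩, Subtype.ext e.symm⟩

/-! ### Linear functionals on the centraliser algebra -/

/-- The coordinates of a linear functional on `Cen` which commutes with the involution. -/
structure Functional (R : Type*) [CommRing R] (u : R) where
  /-- the coefficient of `a` -/
  α : R
  /-- the coefficient of `c` -/
  γ : R
  /-- the coefficient of `b`; that of `e` is its conjugate -/
  β : QuadraticAlgebra R u 0
  /-- the coefficient of `d` -/
  κ : R

namespace Functional

variable (μ : Functional R u)

/-- The value of a functional. -/
def eval (X : Cen R u τ) : S :=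
  algebraMap R S μ.α * X.a + algebraMap R S μ.γ * X.c + μ.β * X.b + star μ.β * X.e +
    algebraMap R S μ.κ * X.d

theorem eval_add (X Y : Cen R u τ) : μ.eval (X + Y) = μ.eval X + μ.eval Y := by
  simp only [eval, add_a, add_c, add_b, add_e, add_d]
  ring

theorem eval_sub (X Y : Cen R u τ) : μ.eval (X - Y) = μ.eval X - μ.eval Y := by
  simp only [eval, sub_a, sub_c, sub_b, sub_e, sub_d]
  ring

theorem eval_scalar_mul (s : S) (X : Cen R u τ) : μ.eval (scalar s * X) = s * μ.eval X := by
  simp only [eval, mul_a, mul_c, mul_b, mul_e, mul_d, scalar_a, scalar_c, scalar_b, scalar_e,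
    scalar_d]
  ring

theorem eval_star (X : Cen R u τ) : μ.eval (star X) = star (μ.eval X) := by
  simp only [eval, star_a, star_c, star_b, star_e, star_d, star_add, star_mul, star_algebraMap',
    star_star]
  ring

/-- The centraliser of a functional. -/
def centralizer (τ : R) : Subring (Cen R u τ) where
  carrier := {Y | ∀ X, μ.eval (Y * X) = μ.eval (X * Y)}
  one_mem' X := by simp
  zero_mem' X := by simp
  mul_mem' {Y Z} hY hZ X := by
    rw [mul_assoc, hY, mul_assoc, hZ, mul_assoc]
  add_mem' {Y Z} hY hZ X := by
    rw [add_mul, mul_add, eval_add, eval_add, hY, hZ]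
  neg_mem' {Y} hY X := by
    rw [neg_mul, ← mul_neg, hY, mul_neg, neg_mul]

end Functional

end Cen

/-! ### Truncated valuation rings -/

/-- The properties of the quotient by the `ℓ`-th power of the maximal ideal `(π)` of a discrete
valuation ring with residue field of odd cardinality `q`. -/
structure IsTruncated {R : Type*} [CommRing R] (π : R) (ℓ q : ℕ) : Prop where
  pos : 0 < ℓ
  one_lt : 1 < q
  pow_eq_zero : π ^ ℓ = 0
  isUnit_or_dvd : ∀ x, IsUnit x ∨ π ∣ x
  dvd_of_mul_eq_zero : ∀ i j, i + j = ℓ → ∀ x, π ^ i * x = 0 → π ^ j ∣ x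
  card_dvd : ∀ i j, i + j = ℓ → Nat.card {x // π ^ i ∣ x} = q ^ j
  isUnit_two : IsUnit (2 : R)

namespace IsTruncated

variable {R : Type*} [CommRing R] {π : R} {ℓ q : ℕ} (hR : IsTruncated π ℓ q)

include hR

theorem nontrivial : Nontrivial R := by
  have h := hR.card_dvd 0 ℓ (zero_add _)
  have h1 : 1 < Nat.card {x : R // π ^ 0 ∣ x} := by
    rw [h]; exact Nat.one_lt_pow hR.pos.ne' hR.one_lt
  have : Nontrivial {x : R // π ^ 0 ∣ x} :=
    have := Nat.finite_of_card_ne_zero (zero_lt_one.trans h1).ne'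
    Finite.one_lt_card_iff_nontrivial.1 h1
  exact Function.Injective.nontrivial (Subtype.val_injective (p := fun x : R => π ^ 0 ∣ x))

theorem not_isUnit : ¬ IsUnit π := fun h => by
  have := hR.nontrivial
  exact not_isUnit_zero (hR.pow_eq_zero ▸ h.pow ℓ)

theorem not_dvd_of_isUnit {x : R} (h : IsUnit x) : ¬ π ∣ x := fun hd =>
  hR.not_isUnit (isUnit_of_dvd_unit hd h)

theorem isUnit_of_not_dvd {x : R} (h : ¬ π ∣ x) : IsUnit x := (hR.isUnit_or_dvd x).resolve_right h

theorem pow_eq_zero_of_le {n : ℕ} (h : ℓ ≤ n) : π ^ n = 0 :=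
  _root_.pow_eq_zero_of_le h hR.pow_eq_zero

theorem mul_eq_zero_iff {i j : ℕ} (hij : i + j = ℓ) {x : R} : π ^ i * x = 0 ↔ π ^ j ∣ x := by
  refine ⟨hR.dvd_of_mul_eq_zero i j hij x, ?_⟩
  rintro ⟨y, rfl⟩
  rw [← mul_assoc, ← pow_add, hij, hR.pow_eq_zero, zero_mul]

theorem pow_pred_ne_zero : π ^ (ℓ - 1) ≠ 0 := fun h => by
  have := hR.dvd_of_mul_eq_zero (ℓ - 1) 1 (by have := hR.pos; omega) 1 (by rw [h, zero_mul])
  rw [pow_one] at this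
  exact hR.not_dvd_of_isUnit isUnit_one this

/-- Every nonzero element divides a generator of the socle. -/
theorem dvd_pow_pred {x : R} (hx : x ≠ 0) : x ∣ π ^ (ℓ - 1) := by
  classical
  obtain ⟨n, hn, hmax⟩ : ∃ n, π ^ n ∣ x ∧ ¬ π ^ (n + 1) ∣ x := by
    by_contra! hcon
    have : ∀ n, π ^ n ∣ x := fun n => by
      induction n with
      | zero => simp
      | succ n ih => exact hcon n ih
    have h := this ℓ
    rw [hR.pow_eq_zero, zero_dvd_iff] at h
    exact hx h
  obtain ⟨y, rfl⟩ := hn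
  have hy : IsUnit y := hR.isUnit_of_not_dvd fun h => hmax (by
    rw [pow_succ]; exact mul_dvd_mul_left _ h)
  have hnl : n < ℓ := by
    by_contra! h
    exact hx (by rw [hR.pow_eq_zero_of_le h, zero_mul])
  rw [hy.mul_right_dvd]
  exact pow_dvd_pow _ (by omega)

/-- There is an additive character which detects all elements, and through which all additive
characters factor. -/
theorem exists_primitive [Finite R] : ∃ ψ : AddChar R ℂ, (∀ a, (∀ r, ψ (r * a) = 1) → a = 0) ∧
    ∀ Λ : AddChar R ℂ, ∃ a, ∀ r, Λ r = ψ (r * a) := by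
  classical
  have := Fintype.ofFinite R
  obtain ⟨ψ, hψ⟩ := AddChar.exists_apply_ne_zero.2 hR.pow_pred_ne_zero
  have hprim : ∀ a, (∀ r, ψ (r * a) = 1) → a = 0 := by
    intro a h
    by_contra ha
    obtain ⟨y, hy⟩ := hR.dvd_pow_pred ha
    exact hψ (by rw [hy, mul_comm]; exact h y)
  refine ⟨ψ, hprim, ?_⟩
  let f : R → AddChar R ℂ := fun a => ψ.compAddMonoidHom (AddMonoidHom.mulRight a)
  have hf : Function.Injective f := by
    intro a b hab
    rw [← sub_eq_zero]
    refine hprim _ fun r => ?_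
    have h := DFunLike.congr_fun hab r
    simp only [f, AddChar.compAddMonoidHom_apply, AddMonoidHom.coe_mulRight] at h
    rw [mul_sub, AddChar.map_sub_eq_div, h, div_self]
    exact fun h0 => by
      have := ψ.map_zero_eq_one
      rw [← add_neg_cancel (r * b), AddChar.map_add_eq_mul, h0, zero_mul] at this
      exact zero_ne_one this
  have hb : Function.Bijective f := (Fintype.bijective_iff_injective_and_card f).2
    ⟨hf, AddChar.card_eq.symm⟩
  intro Λ
  obtain ⟨a, ha⟩ := hb.2 Λ
  exact ⟨a, fun r => by rw [← ha]; rfl⟩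

/-- Counting the vectors divisible by `π ^ i` which are proportional modulo `π ^ j` to a
vector `w` with an invertible last coordinate. -/
theorem card_proportional_aux {i i' j j' : ℕ} (hi : i + i' = ℓ) (hj : j + j' = ℓ) (hij : i ≤ j)
    {w : R × R × R} (hw : IsUnit w.2.2) :
    Nat.card {v : R × R × R // (π ^ i ∣ v.1 ∧ π ^ i ∣ v.2.1 ∧ π ^ i ∣ v.2.2) ∧
      π ^ j ∣ v.1 * w.2.2 - v.2.2 * w.1 ∧ π ^ j ∣ v.2.1 * w.2.2 - v.2.2 * w.2.1} =
      q ^ (i' + 2 * j') := by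
  obtain ⟨c, hc⟩ := hw.exists_left_inv
  have hdvd : ∀ z, π ^ j ∣ z → π ^ i ∣ z := fun z => (pow_dvd_pow π hij).trans
  rw [pow_add, two_mul, pow_add, ← hR.card_dvd i i' hi, ← hR.card_dvd j j' hj, ← Nat.card_prod,
    ← Nat.card_prod]
  refine Nat.card_congr (Equiv.ofBijective (fun v => (⟨v.1.2.2, v.2.1.2.2⟩,
    ⟨v.1.1 - c * w.1 * v.1.2.2, ?_⟩, ⟨v.1.2.1 - c * w.2.1 * v.1.2.2, ?_⟩)) ⟨?_, ?_⟩)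
  · have := v.2.2.1.mul_left c
    convert this using 1
    linear_combination (-v.1.1) * hc
  · have := v.2.2.2.mul_left c
    convert this using 1
    linear_combination (-v.1.2.1) * hc
  · rintro ⟨⟨a, b, r⟩, _⟩ ⟨⟨a', b', r'⟩, _⟩ h
    simp only [Prod.mk.injEq, Subtype.mk.injEq] at h
    obtain ⟨rfl, h2, h3⟩ := h
    simp only [sub_left_inj] at h2 h3
    subst h2 h3
    rfl
  · rintro ⟨⟨r, hr⟩, ⟨z, hz⟩, ⟨z', hz'⟩⟩
    refine ⟨⟨(z + c * w.1 * r, z' + c * w.2.1 * r, r), ⟨(hdvd _ hz).add (hr.mul_left _),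
      (hdvd _ hz').add (hr.mul_left _), hr⟩, ?_, ?_⟩, ?_⟩
    · have := hz.mul_right w.2.2
      convert this using 1
      linear_combination (w.1 * r) * hc
    · have := hz'.mul_right w.2.2
      convert this using 1
      linear_combination (w.2.1 * r) * hc
    · simp

/-- Counting the vectors divisible by `π ^ i` which are proportional modulo `π ^ j` to a
unimodular vector. -/
theorem card_proportional {i i' j j' : ℕ} (hi : i + i' = ℓ) (hj : j + j' = ℓ) (hij : i ≤ j)
    {w : R × R × R} (hw : IsUnit w.1 ∨ IsUnit w.2.1 ∨ IsUnit w.2.2) :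
    Nat.card {v : R × R × R // (π ^ i ∣ v.1 ∧ π ^ i ∣ v.2.1 ∧ π ^ i ∣ v.2.2) ∧
      π ^ j ∣ v.1 * w.2.1 - v.2.1 * w.1 ∧ π ^ j ∣ v.1 * w.2.2 - v.2.2 * w.1 ∧
      π ^ j ∣ v.2.1 * w.2.2 - v.2.2 * w.2.1} = q ^ (i' + 2 * j') := by
  have hneg : ∀ a b : R, π ^ j ∣ a * b → IsUnit b → π ^ j ∣ a := fun a b h hb =>
    (hb.dvd_mul_right).1 h
  -- the three coordinates are treated by permuting them
  rcases hw with hw | hw | hw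
  · rw [← hR.card_proportional_aux hi hj hij (w := (w.2.1, w.2.2, w.1)) hw]
    refine Nat.card_congr (Equiv.subtypeEquiv ⟨fun v => (v.2.1, v.2.2, v.1),
      fun v => (v.2.2, v.1, v.2.1), fun _ => rfl, fun _ => rfl⟩ fun v => ?_)
    simp only [Equiv.coe_fn_mk]
    constructor
    · rintro ⟨⟨h1, h2, h3⟩, h4, h5, h6⟩
      exact ⟨⟨h2, h3, h1⟩, (dvd_sub_comm).1 h4, (dvd_sub_comm).1 h5⟩
    · rintro ⟨⟨h1, h2, h3⟩, h4, h5⟩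
      refine ⟨⟨h3, h1, h2⟩, (dvd_sub_comm).1 h4, (dvd_sub_comm).1 h5, hneg _ _ ?_ hw⟩
      have := (h4.mul_left w.2.2).sub (h5.mul_left w.2.1)
      convert this using 1
      ring
  · rw [← hR.card_proportional_aux hi hj hij (w := (w.1, w.2.2, w.2.1)) hw]
    refine Nat.card_congr (Equiv.subtypeEquiv ⟨fun v => (v.1, v.2.2, v.2.1),
      fun v => (v.1, v.2.2, v.2.1), fun _ => rfl, fun _ => rfl⟩ fun v => ?_)
    simp only [Equiv.coe_fn_mk]
    constructor
    · rintro ⟨⟨h1, h2, h3⟩, h4, h5, h6⟩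
      exact ⟨⟨h1, h3, h2⟩, h4, (dvd_sub_comm).1 h6⟩
    · rintro ⟨⟨h1, h2, h3⟩, h4, h5⟩
      refine ⟨⟨h1, h3, h2⟩, h4, hneg _ _ ?_ hw, (dvd_sub_comm).1 h5⟩
      have := (h4.mul_left w.2.2).sub (h5.mul_left w.1)
      convert this using 1
      ring
  · rw [← hR.card_proportional_aux hi hj hij (w := w) hw]
    refine Nat.card_congr (Equiv.subtypeEquiv (Equiv.refl _) fun v => ?_)
    simp only [Equiv.refl_apply]
    constructor
    · rintro ⟨h1, h4, h5, h6⟩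
      exact ⟨h1, h5, h6⟩
    · rintro ⟨h1, h5, h6⟩
      refine ⟨h1, hneg _ _ ?_ hw, h5, h6⟩
      have := (h5.mul_left w.2.1).sub (h6.mul_left w.1)
      convert this using 1
      ring

end IsTruncated

namespace Cen

variable {R : Type*} [CommRing R] {u τ : R}

local notation "S" => QuadraticAlgebra R u 0

namespace Functional

variable (μ : Functional R u)

/-- The difference of the diagonal entries of the block with rows `(a + τ c, b)`, `(τ e, d)`.
Commutators depend only on `b`, `e` and this coordinate. -/
def _root_.Cen.gap (X : Cen R u τ) : S := X.a + algebraMap R S τ * X.c - X.d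

/-- The coefficient of a functional which is dual to `gap` under the commutator pairing. -/
def slope (τ : R) : R := μ.γ - μ.κ * τ

/-- The commutator pairing is a determinant: it is the triple product of the coordinate vectors
`(b, e, gap)` of `Y` and `X` with the vector `(star β, β, slope)` of coefficients of `μ`. -/
theorem eval_mul_sub (X Y : Cen R u τ) : μ.eval (Y * X) - μ.eval (X * Y) =
    algebraMap R S (μ.slope τ) * (Y.b * X.e - Y.e * X.b) +
      μ.β * (Y.gap * X.b - X.gap * Y.b) + star μ.β * (Y.e * X.gap - X.e * Y.gap) := by
  simp only [eval, mul_a, mul_c, mul_b, mul_e, mul_d, gap, slope, map_sub, map_mul]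
  ring

/-- Commutators with `Y` are killed by `r μ` if and only if `r` kills the cross product of
`(b, e, gap)` with the coefficients of `μ`. -/
theorem mul_eval_sub_eq_zero_iff (r : S) (Y : Cen R u τ) :
    (∀ X, r * (μ.eval (Y * X) - μ.eval (X * Y)) = 0) ↔
      r * (algebraMap R S (μ.slope τ) * Y.b - star μ.β * Y.gap) = 0 ∧
      r * (algebraMap R S (μ.slope τ) * Y.e - μ.β * Y.gap) = 0 ∧
      r * (star μ.β * Y.e - μ.β * Y.b) = 0 := by
  constructor
  · intro h
    refine ⟨?_, ?_, ?_⟩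
    · have := h ⟨0, 0, 0, 1, 0⟩
      rw [eval_mul_sub] at this
      simp only [gap] at *
      linear_combination this
    · have := h ⟨0, 0, 1, 0, 0⟩
      rw [eval_mul_sub] at this
      simp only [gap] at *
      linear_combination -this
    · have := h ⟨1, 0, 0, 0, 0⟩
      rw [eval_mul_sub] at this
      simp only [gap] at *
      linear_combination this
  · rintro ⟨h1, h2, h3⟩ X
    rw [eval_mul_sub]
    linear_combination X.e * h1 - X.b * h2 + X.gap * h3

theorem mem_centralizer_iff {Y : Cen R u τ} : Y ∈ μ.centralizer τ ↔
    algebraMap R S (μ.slope τ) * Y.b = star μ.β * Y.gap ∧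
      algebraMap R S (μ.slope τ) * Y.e = μ.β * Y.gap ∧ star μ.β * Y.e = μ.β * Y.b := by
  have := μ.mul_eval_sub_eq_zero_iff 1 Y
  simp only [one_mul, sub_eq_zero] at this
  exact this

theorem star_mem_centralizer {Y : Cen R u τ} (hY : Y ∈ μ.centralizer τ) :
    star Y ∈ μ.centralizer τ := by
  intro X
  have h1 := hY (star X)
  have h2 := congrArg star h1
  rw [← eval_star, ← eval_star, star_mul, star_mul, star_star] at h2
  exact h2.symm

/-- The coefficients of `μ` which enter the commutator pairing are unimodular. -/
def Regular (τ : R) : Prop := IsUnit μ.β.im ∨ IsUnit μ.β.re ∨ IsUnit (μ.slope τ)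

variable {μ}

/-- Regularity as a Bézout identity over `S`, for the coefficients which occur in the commutator
pairing. -/
theorem Regular.exists_bezout (h : μ.Regular τ) (h2 : IsUnit (2 : R)) (hu : IsUnit u) :
    ∃ p p' p'' : S, p * star μ.β + p' * μ.β + p'' * algebraMap R S (μ.slope τ) = 1 := by
  rcases h with h | h | h
  · obtain ⟨c, hc⟩ := ((h2.mul hu).mul h).exists_left_inv
    refine ⟨⟨0, -c⟩, ⟨0, c⟩, 0, ?_⟩
    ext <;> simp [QuadraticAlgebra.re_one, QuadraticAlgebra.im_one]
    linear_combination hc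
  · obtain ⟨c, hc⟩ := (h2.mul h).exists_left_inv
    refine ⟨algebraMap R S c, algebraMap R S c, 0, ?_⟩
    ext <;> simp [QuadraticAlgebra.re_one, QuadraticAlgebra.im_one]
    linear_combination hc
  · obtain ⟨c, hc⟩ := h.exists_left_inv
    refine ⟨0, 0, algebraMap R S c, ?_⟩
    ext <;> simp [QuadraticAlgebra.re_one, QuadraticAlgebra.im_one]
    exact hc

/-- The centraliser of a regular functional is commutative, since its elements have proportional
coordinates `(b, e, gap)`. -/
theorem Regular.mul_comm (h : μ.Regular τ) (h2 : IsUnit (2 : R)) (hu : IsUnit u)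
    {Y Z : Cen R u τ} (hY : Y ∈ μ.centralizer τ) (hZ : Z ∈ μ.centralizer τ) : Y * Z = Z * Y := by
  obtain ⟨p, p', p'', hp⟩ := h.exists_bezout h2 hu
  rw [mem_centralizer_iff] at hY hZ
  have key : ∀ Y : Cen R u τ, (algebraMap R S (μ.slope τ) * Y.b = star μ.β * Y.gap ∧
      algebraMap R S (μ.slope τ) * Y.e = μ.β * Y.gap ∧ star μ.β * Y.e = μ.β * Y.b) →
      ∃ y, Y.b = y * star μ.β ∧ Y.e = y * μ.β ∧
        Y.d = Y.a + algebraMap R S τ * Y.c - y * algebraMap R S (μ.slope τ) := by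
    rintro Y ⟨h1, h2, h3⟩
    -- the factor of proportionality is the Bézout combination of the coordinates of `Y`
    refine ⟨p * Y.b + p' * Y.e + p'' * Y.gap, ?_, ?_, ?_⟩
    · linear_combination (-Y.b) * hp + p'' * h1 - p' * h3
    · linear_combination (-Y.e) * hp + p'' * h2 + p * h3
    · have : Y.gap = (p * Y.b + p' * Y.e + p'' * Y.gap) * algebraMap R S (μ.slope τ) := by
        linear_combination (-Y.gap) * hp - p * h1 - p' * h2
      rw [← this, gap]
      ring
  obtain ⟨y, h1, h2, h3⟩ := key Y hY
  obtain ⟨z, h4, h5, h6⟩ := key Z hZ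
  ext1 <;> simp only [mul_a, mul_c, mul_b, mul_e, mul_d, h1, h2, h3, h4, h5, h6] <;> ring

/-- An element whose commutators are almost killed by `μ` is close to the centraliser of `μ`. -/
theorem Regular.exists_centralizer (h : μ.Regular τ) (h2 : IsUnit (2 : R)) (hu : IsUnit u)
    {r : R} {Y : Cen R u τ}
    (h1 : algebraMap R S r ∣ algebraMap R S (μ.slope τ) * Y.b - star μ.β * Y.gap)
    (h2' : algebraMap R S r ∣ algebraMap R S (μ.slope τ) * Y.e - μ.β * Y.gap)
    (h3 : algebraMap R S r ∣ star μ.β * Y.e - μ.β * Y.b) :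
    ∃ Z ∈ μ.centralizer τ, Y - Z ∈ multiples r := by
  obtain ⟨p, p', p'', hp⟩ := h.exists_bezout h2 hu
  -- `Y` is projected to the line of the coefficients of `μ`
  set y := p * Y.b + p' * Y.e + p'' * Y.gap with hy
  refine ⟨⟨Y.a, Y.c, y * star μ.β, y * μ.β,
    Y.a + algebraMap R S τ * Y.c - y * algebraMap R S (μ.slope τ)⟩, ?_, ?_⟩
  · rw [mem_centralizer_iff]
    simp only [gap]
    refine ⟨by ring, by ring, by ring⟩
  · rw [mem_multiples]
    simp only [sub_a, sub_c, sub_b, sub_e, sub_d, sub_self, dvd_zero, true_and]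
    refine ⟨?_, ?_, ?_⟩
    · have := (h1.mul_left p'').sub (h3.mul_left p')
      convert this using 1
      rw [hy]
      linear_combination (-Y.b) * hp
    · have := (h2'.mul_left p'').add (h3.mul_left p)
      convert this using 1
      rw [hy]
      linear_combination (-Y.e) * hp
    · have := (h1.mul_left p).add (h2'.mul_left p')
      convert this using 1
      have hg : Y.d = Y.a + algebraMap R S τ * Y.c - Y.gap := by rw [gap]; ring
      rw [hy, hg]
      linear_combination (Y.gap) * hp

end Functional

/-- A linear function which vanishes on the skew elements vanishes. -/
theorem eq_zero_of_skew (h2 : IsUnit (2 : R)) (hu : IsUnit u) (F : Cen R u τ → S)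
    (hadd : ∀ X Y, F (X + Y) = F X + F Y) (hmul : ∀ s X, F (scalar s * X) = s * F X)
    (h0 : ∀ X, star X = -X → F X = 0) (X : Cen R u τ) : F X = 0 := by
  have e1 : F (X + -star X) = 0 := h0 _ (by
    rw [star_add, star_neg, star_star]; abel)
  -- the hermitian part becomes skew after multiplication by `ξ`
  have e2 : F (scalar ⟨0, 1⟩ * (X + star X)) = 0 := h0 _ (by
    ext <;> simp <;> ring)
  rw [hmul] at e2
  have e3 : algebraMap R S u * F (X + star X) = 0 := by
    have : algebraMap R S u = ⟨0, 1⟩ * ⟨0, 1⟩ := by ext <;> simp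
    rw [this, mul_assoc, e2, mul_zero]
  have e4 : F (X + star X) = 0 := by
    apply (hu.map (algebraMap R S)).mul_left_cancel
    rw [e3, mul_zero]
  have e5 : F X + F X = 0 := by
    have : X + X = (X + -star X) + (X + star X) := by abel
    rw [← hadd, this, hadd, e1, e4, add_zero]
  apply (h2.map (algebraMap R S)).mul_left_cancel
  rw [map_ofNat, mul_zero, two_mul, e5]

/-- The coordinates `skewOf`, as an additive map. -/
def skewHom : R × R × R × R × R →+ Cen R u τ where
  toFun z := skewOf z.1 z.2.1 z.2.2
  map_zero' := by ext <;> simp [skewOf]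
  map_add' z w := by ext <;> simp [skewOf] <;> ring

/-- On skew elements, additive characters are given by linear functionals. -/
theorem exists_functional (h2 : IsUnit (2 : R)) {ψ : AddChar R ℂ}
    (hψ : ∀ Λ : AddChar R ℂ, ∃ a, ∀ r, Λ r = ψ (r * a)) (Λ : AddChar (Cen R u τ) ℂ) :
    ∃ μ : Functional R u, ∀ X, star X = -X → Λ X = ψ (μ.eval X).im := by
  let i₁ : R →+ R × R × R × R × R := AddMonoidHom.inl _ _
  let i₂ : R →+ R × R × R × R × R := (AddMonoidHom.inr _ _).comp (AddMonoidHom.inl _ _)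
  let i₃ : R →+ R × R × R × R × R := (AddMonoidHom.inr _ _).comp
    ((AddMonoidHom.inr _ _).comp (AddMonoidHom.inl _ _))
  let i₄ : R →+ R × R × R × R × R := (AddMonoidHom.inr _ _).comp
    ((AddMonoidHom.inr _ _).comp ((AddMonoidHom.inr _ _).comp (AddMonoidHom.inl _ _)))
  let i₅ : R →+ R × R × R × R × R := (AddMonoidHom.inr _ _).comp
    ((AddMonoidHom.inr _ _).comp ((AddMonoidHom.inr _ _).comp (AddMonoidHom.inr _ _)))
  obtain ⟨c₁, h₁⟩ := hψ (Λ.compAddMonoidHom (skewHom.comp i₁))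
  obtain ⟨c₂, h₂⟩ := hψ (Λ.compAddMonoidHom (skewHom.comp i₂))
  obtain ⟨c₃, h₃⟩ := hψ (Λ.compAddMonoidHom (skewHom.comp i₃))
  obtain ⟨c₄, h₄⟩ := hψ (Λ.compAddMonoidHom (skewHom.comp i₄))
  obtain ⟨c₅, h₅⟩ := hψ (Λ.compAddMonoidHom (skewHom.comp i₅))
  obtain ⟨t, ht⟩ := h2.exists_left_inv
  refine ⟨⟨c₁ + c₅, c₂ + c₅ * τ, ⟨t * c₄, t * c₃⟩, -c₅⟩, fun X hX => ?_⟩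
  rw [exists_skewOf h2 hX]
  set x := X.a.im
  set y := X.c.im
  set v₁ := X.b.re
  set v₂ := X.b.im
  set v₃ := X.a.im + τ * X.c.im - X.d.im
  have hsum : (skewOf x y (v₁, v₂, v₃) : Cen R u τ) = skewHom (i₁ x) + skewHom (i₂ y) +
      skewHom (i₃ v₁) + skewHom (i₄ v₂) + skewHom (i₅ v₃) := by
    rw [← map_add, ← map_add, ← map_add, ← map_add]
    change skewHom (x, y, v₁, v₂, v₃) = _
    congr 1
    simp [i₁, i₂, i₃, i₄, i₅]
  simp only [AddChar.compAddMonoidHom_apply, AddMonoidHom.comp_apply] at h₁ h₂ h₃ h₄ h₅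
  have e := congrArg Λ hsum
  rw [AddChar.map_add_eq_mul, AddChar.map_add_eq_mul, AddChar.map_add_eq_mul,
    AddChar.map_add_eq_mul, h₁, h₂, h₃, h₄, h₅, ← AddChar.map_add_eq_mul,
    ← AddChar.map_add_eq_mul, ← AddChar.map_add_eq_mul, ← AddChar.map_add_eq_mul] at e
  rw [e]
  congr 1
  simp [Functional.eval, skewOf]
  linear_combination (-(v₁ * c₃ + v₂ * c₄)) * ht

end Cen

/-! ### Lifting and counting unitary elements -/

section Lifting

variable {A B : Type*} [Ring A] [StarRing A] [Ring B] [StarRing B]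

/-- The map on unitary elements induced by a ring homomorphism compatible with the involutions. -/
def unitaryMap (f : A →+* B) (hf : ∀ x, f (star x) = star (f x)) : unitary A →* unitary B where
  toFun g := ⟨f g, Unitary.mem_iff.2
    ⟨by rw [← hf, ← map_mul, Unitary.star_mul_self_of_mem (Subtype.prop _), map_one],
      by rw [← hf, ← map_mul, Unitary.mul_star_self_of_mem (Subtype.prop _), map_one]⟩⟩
  map_one' := Subtype.ext (map_one f)
  map_mul' g h := Subtype.ext (map_mul f _ _)

@[simp] theorem coe_unitaryMap (f : A →+* B) (hf : ∀ x, f (star x) = star (f x)) (g : unitary A) :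
    (unitaryMap f hf g : B) = f g := rfl

/-- The elements of an ideal which lie in a subring. -/
def interIdeal (C : Subring A) (I : Ideal A) : NonUnitalSubring A where
  carrier := {x | x ∈ C ∧ x ∈ I}
  zero_mem' := ⟨C.zero_mem, I.zero_mem⟩
  add_mem' ha hb := ⟨C.add_mem ha.1 hb.1, I.add_mem ha.2 hb.2⟩
  mul_mem' ha hb := ⟨C.mul_mem ha.1 hb.1, I.mul_mem_left _ hb.2⟩
  neg_mem' ha := ⟨C.neg_mem ha.1, I.neg_mem ha.2⟩

/-- An element of a star-closed subring which is unitary modulo a nil ideal is congruent to a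
unitary element of the subring. -/
theorem exists_unitary_sub_mem [Finite A] (h2 : IsUnit (2 : A)) (C : Subring A)
    (hC : ∀ x ∈ C, star x ∈ C) (I : Ideal A) [I.IsTwoSided] (hI : ∀ x ∈ I, IsNilpotent x)
    {Y : A} (hY : Y ∈ C) (hYI : star Y * Y - 1 ∈ I) :
    ∃ t : unitary A, (t : A) ∈ C ∧ (t : A) - Y ∈ I := by
  have hYC : star Y * Y ∈ C := C.mul_mem (hC Y hY) hY
  obtain ⟨k, hk⟩ := exists_mul_pow_mem_unitary h2 (interIdeal C I) (fun x hx => hI x hx.2)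
    (Y := Y) ⟨C.sub_mem hYC C.one_mem, hYI⟩
  refine ⟨⟨_, hk⟩, C.mul_mem hY (C.pow_mem hYC k), ?_⟩
  have h1 : (star Y * Y) ^ k - 1 ∈ I := by
    rw [← Ideal.Quotient.mk_eq_mk_iff_sub_mem] at hYI ⊢
    rw [map_pow, hYI, map_one, one_pow]
  have : Y * (star Y * Y) ^ k - Y = Y * ((star Y * Y) ^ k - 1) := by noncomm_ring
  rw [this]
  exact I.mul_mem_left _ h1

/-- Unitary elements of the image of a star-closed subring lift to unitary elements of the
subring. -/
theorem exists_unitary_lift [Finite A] (h2 : IsUnit (2 : A)) (f : A →+* B)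
    (hf : ∀ x, f (star x) = star (f x)) (hnil : ∀ x, f x = 0 → IsNilpotent x)
    (C : Subring A) (hC : ∀ x ∈ C, star x ∈ C) {Y : A} (hY : Y ∈ C) (hu : f Y ∈ unitary B) :
    ∃ t : unitary A, (t : A) ∈ C ∧ f t = f Y := by
  obtain ⟨t, ht, h⟩ := exists_unitary_sub_mem h2 C hC (RingHom.ker f) hnil hY (by
    rw [RingHom.mem_ker, map_sub, map_mul, hf, map_one, (Unitary.mem_iff.1 hu).1, sub_self])
  refine ⟨t, ht, ?_⟩
  rw [RingHom.mem_ker, map_sub, sub_eq_zero] at h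
  exact h

/-- The unitary elements of a subring. -/
def unitaryIn (C : Subring A) (hC : ∀ x ∈ C, star x ∈ C) : Subgroup (unitary A) where
  carrier := {g | (g : A) ∈ C}
  one_mem' := C.one_mem
  mul_mem' ha hb := C.mul_mem ha hb
  inv_mem' ha := by
    rw [Set.mem_ofPred_eq, coe_inv_unitary]
    exact hC _ ha

theorem mem_unitaryIn {C : Subring A} {hC : ∀ x ∈ C, star x ∈ C} {g : unitary A} :
    g ∈ unitaryIn C hC ↔ (g : A) ∈ C := Iff.rfl

/-- The number of unitary elements of a subring which are congruent to `1` modulo a nil ideal. -/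
theorem card_unitaryIn_congr [Finite A] (h2 : IsUnit (2 : A)) (C : Subring A) (I : Ideal A)
    (hI : ∀ x ∈ I, IsNilpotent x) :
    Nat.card {g : unitary A // (g : A) ∈ C ∧ (g : A) - 1 ∈ I} =
      Nat.card {X : A // (X ∈ C ∧ X ∈ I) ∧ star X = -X} := by
  refine Eq.trans (Nat.card_congr (Equiv.subtypeEquiv (Equiv.refl _) fun g => ?_))
    (card_unitary_sub_one_mem h2 (interIdeal C I) fun x hx => hI x hx.2)
  refine and_congr_left fun _ => ⟨fun h => C.sub_mem h C.one_mem, fun h => ?_⟩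
  rw [← sub_add_cancel (g : A) 1]
  exact C.add_mem h C.one_mem

/-- The group of unitary elements of `C` is an extension of its image under `f`, which consists of
all unitary elements in the image of `C`, by its intersection with `1 + ker f`. -/
theorem card_unitaryIn [Finite A] (h2 : IsUnit (2 : A)) (f : A →+* B)
    (hf : ∀ x, f (star x) = star (f x)) (hnil : ∀ x, f x = 0 → IsNilpotent x)
    (C : Subring A) (hC : ∀ x ∈ C, star x ∈ C) :
    Nat.card (unitaryIn C hC) = Nat.card {X : A // (X ∈ C ∧ f X = 0) ∧ star X = -X} *
      Nat.card {y : unitary B // ∃ Y ∈ C, f Y = y} := by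
  set φ := (unitaryMap f hf).comp (unitaryIn C hC).subtype with hφ
  rw [← φ.ker.card_mul_index, Subgroup.index_ker]
  congr 1
  · refine Eq.trans ?_ (card_unitaryIn_congr h2 C (RingHom.ker f) hnil)
    refine Nat.card_congr ⟨fun g => ⟨g.1.1, g.1.2, ?_⟩, fun g => ⟨⟨g.1, g.2.1⟩, ?_⟩,
      fun _ => rfl, fun _ => rfl⟩
    · have := congrArg Subtype.val g.2
      rw [RingHom.mem_ker, map_sub, map_one, sub_eq_zero]
      exact this
    · have := g.2.2
      rw [RingHom.mem_ker, map_sub, map_one, sub_eq_zero] at this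
      exact Subtype.ext this
  · refine Nat.card_congr (Equiv.subtypeEquiv (Equiv.refl _) fun y => ?_)
    constructor
    · rintro ⟨g, rfl⟩
      exact ⟨g.1, g.2, rfl⟩
    · rintro ⟨Y, hY, hy⟩
      obtain ⟨t, ht, htY⟩ := exists_unitary_lift h2 f hf hnil C hC hY (hy ▸ y.2)
      exact ⟨⟨t, ht⟩, Subtype.ext (htY.trans hy)⟩

/-- The order of the product of two subgroups, the first of which is normal. -/
theorem Subgroup.card_mul_card_of_exists_mul {G : Type*} [Group G] (H C T : Subgroup G)
    [H.Normal] (hH : H ≤ T) (hC : C ≤ T) (hT : ∀ g ∈ T, ∃ h ∈ H, ∃ t ∈ C, g = h * t) :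
    Nat.card T * Nat.card (H.subgroupOf C) = Nat.card H * Nat.card C := by
  have e : T = H ⊔ C := by
    refine le_antisymm (fun g hg => ?_) (sup_le hH hC)
    obtain ⟨h, hh, t, ht, rfl⟩ := hT g hg
    exact mul_mem (Subgroup.mem_sup_left hh) (Subgroup.mem_sup_right ht)
  have h1 := (H.subgroupOf T).card_mul_index
  have h2 := (H.subgroupOf C).card_mul_index
  have h3 : (H.subgroupOf T).index = (H.subgroupOf C).index := by
    subst e
    exact Subgroup.relIndex_sup_left (K := H) (H := C)
  rw [Nat.card_congr (Subgroup.subgroupOfEquivOfLe hH).toEquiv] at h1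
  rw [← h1, ← h2, h3]
  ring

end Lifting

/-! ### Regular functionals are polarised -/

namespace AddChar

theorem map_sub_eq_one_iff {B : Type*} [AddCommGroup B] (ψ : AddChar B ℂ) {a b : B} :
    ψ (a - b) = 1 ↔ ψ a = ψ b := by
  have h0 : ψ b ≠ 0 := fun h => by
    have := ψ.map_zero_eq_one
    rw [← add_neg_cancel b, AddChar.map_add_eq_mul, h, zero_mul] at this
    exact zero_ne_one this
  rw [AddChar.map_sub_eq_div, div_eq_one_iff_eq h0]

end AddChar

namespace Cen

open HeisPair

variable {R : Type*} [CommRing R] {u τ : R}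

local notation "S" => QuadraticAlgebra R u 0

theorem isNilpotent_of_mem_multiples {r : R} (hr : IsNilpotent r) {X : Cen R u τ}
    (hX : X ∈ multiples r) : IsNilpotent X := by
  obtain ⟨n, hn⟩ := hr
  obtain ⟨Y, rfl⟩ := mem_multiples_iff_exists.1 hX
  refine ⟨n, ?_⟩
  have hc : Commute (scalar (algebraMap R S r)) Y := (scalar_comm _ _).symm
  rw [hc.mul_pow, ← map_pow, ← map_pow, hn, map_zero, map_zero, zero_mul]

theorem star_scalar (r : R) :
    star (scalar (algebraMap R S r) : Cen R u τ) = scalar (algebraMap R S r) := by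
  ext <;> simp

theorem star_scalar_mul {r : R} {X : Cen R u τ} (hX : star X = -X) :
    star (scalar (algebraMap R S r) * X) = -(scalar (algebraMap R S r) * X) := by
  rw [star_mul, star_scalar, hX, scalar_comm, mul_neg]

/-- A linear function compatible with the involutions vanishes, if a primitive additive character
vanishes on its values at skew elements. -/
theorem eq_zero_of_addChar (h2 : IsUnit (2 : R)) (hu : IsUnit u) {ψ : AddChar R ℂ}
    (hψ : ∀ a, (∀ r, ψ (r * a) = 1) → a = 0) (F : Cen R u τ → S)
    (hadd : ∀ X Y, F (X + Y) = F X + F Y) (hmul : ∀ s X, F (scalar s * X) = s * F X)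
    (hre : ∀ X, star X = -X → star (F X) = -F X)
    (h : ∀ X, star X = -X → ψ (F X).im = 1) (X : Cen R u τ) : F X = 0 := by
  refine eq_zero_of_skew h2 hu F hadd hmul (fun X hX => ?_) X
  have h1 := congrArg QuadraticAlgebra.re (hre X hX)
  ext
  · refine eq_zero_of_eq_neg h2 ?_
    simpa using h1
  · refine hψ _ fun r => ?_
    have := h _ (star_scalar_mul (r := r) hX)
    rw [hmul] at this
    simpa using this

variable {ψ : AddChar R ℂ} {Λ : AddChar (Cen R u τ) ℂ} {μ : Functional R u}

/-- If conjugation with `g` fixes the character `Λ` on the skew multiples of `r`, then the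
commutators with `g` are killed by `r μ`. -/
theorem mul_eval_sub_eq_zero_of_conj (h2 : IsUnit (2 : R)) (hu : IsUnit u)
    (hψ : ∀ a, (∀ r, ψ (r * a) = 1) → a = 0) (hμ : ∀ X, star X = -X → Λ X = ψ (μ.eval X).im)
    (r : R) (g : unitary (Cen R u τ))
    (hg : ∀ X : Cen R u τ, X ∈ skewIn (multiples r) →
      Λ ((g : Cen R u τ) * X * star (g : Cen R u τ)) = Λ X)
    (X : Cen R u τ) :
    algebraMap R S r * (μ.eval ((g : Cen R u τ) * X) - μ.eval (X * (g : Cen R u τ))) = 0 := by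
  have hconj : ∀ X : Cen R u τ, star X = -X →
      star ((g : Cen R u τ) * X * star (g : Cen R u τ)) =
        -((g : Cen R u τ) * X * star (g : Cen R u τ)) := fun X hX => by
    rw [star_mul, star_mul, star_star, hX]; noncomm_ring
  have key := eq_zero_of_addChar h2 hu hψ
    (fun X : Cen R u τ => algebraMap R S r *
      (μ.eval ((g : Cen R u τ) * X * star (g : Cen R u τ)) - μ.eval X))
    (fun X Y => by rw [mul_add, add_mul, μ.eval_add, μ.eval_add]; ring)
    (fun s X => by
      rw [← mul_assoc, scalar_comm, mul_assoc, mul_assoc, μ.eval_scalar_mul, μ.eval_scalar_mul,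
        ← mul_assoc (g : Cen R u τ)]
      ring)
    (fun X hX => by
      rw [star_mul, star_sub, ← μ.eval_star, ← μ.eval_star, hconj X hX, hX, star_algebraMap',
        ← zero_sub ((g : Cen R u τ) * X * star (g : Cen R u τ)), ← zero_sub X, μ.eval_sub,
        μ.eval_sub]
      ring)
    (fun X hX => by
      have h1 := hg (scalar (algebraMap R S r) * X)
        ⟨mem_multiples_iff_exists.2 ⟨X, rfl⟩, star_scalar_mul hX⟩
      have h3 : (g : Cen R u τ) * (scalar (algebraMap R S r) * X) * star (g : Cen R u τ) =
          scalar (algebraMap R S r) * ((g : Cen R u τ) * X * star (g : Cen R u τ)) := by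
        rw [← mul_assoc (g : Cen R u τ), scalar_comm]
        simp only [mul_assoc]
      rw [h3, hμ _ (star_scalar_mul hX), hμ _ (star_scalar_mul (hconj X hX)),
        μ.eval_scalar_mul, μ.eval_scalar_mul, ← AddChar.map_sub_eq_one_iff] at h1
      rw [mul_sub, QuadraticAlgebra.im_sub]
      exact h1) (X * g)
  have hXg : (g : Cen R u τ) * (X * g) * star (g : Cen R u τ) = (g : Cen R u τ) * X := by
    rw [← mul_assoc, mul_assoc, Unitary.mul_star_self_of_mem (Subtype.prop _), mul_one]
  rw [hXg] at key
  exact key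

/-- The stabiliser of the character given by `μ` consists of the unitary elements of the
centraliser of `μ`. -/
theorem mem_stabSkew_iff (h2 : IsUnit (2 : R)) (hu : IsUnit u)
    (hψ : ∀ a, (∀ r, ψ (r * a) = 1) → a = 0) (hμ : ∀ X, star X = -X → Λ X = ψ (μ.eval X).im)
    {t : unitary (Cen R u τ)} : t ∈ stabSkew Λ ↔ (t : Cen R u τ) ∈ μ.centralizer τ := by
  rw [mem_stabSkew]
  constructor
  · intro h X
    have := mul_eval_sub_eq_zero_of_conj h2 hu hψ hμ 1 t (fun X hX => h X hX.2) X
    rw [map_one, one_mul, sub_eq_zero] at this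
    exact this
  · intro h X hX
    rw [hμ X hX, hμ _ (by rw [star_mul, star_mul, star_star, hX]; noncomm_ring), mul_assoc, h,
      mul_assoc, Unitary.star_mul_self_of_mem (Subtype.prop _), mul_one]

/-- The radical consists of the elements whose commutators are killed by a multiple of `μ`. -/
theorem mem_radical_iff (h2 : IsUnit (2 : R)) (hu : IsUnit u)
    (hψ : ∀ a, (∀ r, ψ (r * a) = 1) → a = 0) (hμ : ∀ X, star X = -X → Λ X = ψ (μ.eval X).im)
    {r : R} {X : skewIn (multiples r : Ideal (Cen R u τ))} : X ∈ radical (multiples r) Λ ↔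
      ∀ Y : Cen R u τ, algebraMap R S r *
        (μ.eval ((X : Cen R u τ) * Y) - μ.eval (Y * (X : Cen R u τ))) = 0 := by
  rw [mem_radical]
  constructor
  · intro h
    refine eq_zero_of_addChar h2 hu hψ _ (fun Y Z => ?_) (fun s Y => ?_) (fun Y hY => ?_)
      (fun Y hY => ?_)
    · rw [mul_add, add_mul, μ.eval_add, μ.eval_add]; ring
    · rw [← mul_assoc, scalar_comm, mul_assoc, mul_assoc, μ.eval_scalar_mul, μ.eval_scalar_mul]
      ring
    · have h1 : star ((X : Cen R u τ) * Y) = Y * X := by rw [star_mul, hY, X.2.2]; noncomm_ring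
      have h3 : star (Y * (X : Cen R u τ)) = X * Y := by rw [star_mul, hY, X.2.2]; noncomm_ring
      rw [star_mul, star_sub, ← μ.eval_star, ← μ.eval_star, h1, h3, star_algebraMap']
      ring
    · have := h ⟨scalar (algebraMap R S r) * Y,
        mem_multiples_iff_exists.2 ⟨Y, rfl⟩, star_scalar_mul hY⟩
      rw [hμ _ (brk _ _).2.2, coe_brk, ← mul_assoc, scalar_comm, mul_assoc, mul_assoc, μ.eval_sub,
        μ.eval_scalar_mul, μ.eval_scalar_mul, ← mul_sub] at this
      exact this
  · intro h Y
    obtain ⟨Z, hZ⟩ := mem_multiples_iff_exists.1 Y.2.1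
    rw [hμ _ (brk _ _).2.2, coe_brk, hZ, ← mul_assoc, scalar_comm, mul_assoc, mul_assoc, μ.eval_sub,
        μ.eval_scalar_mul, μ.eval_scalar_mul, ← mul_sub, h]
    simp

section Truncated

variable {π : R} {ℓ q : ℕ} (hR : IsTruncated π ℓ q)

include hR in
theorem algebraMap_pow_mul_eq_zero_iff {i j : ℕ} (hij : i + j = ℓ) {s : S} :
    algebraMap R S (π ^ i) * s = 0 ↔ algebraMap R S (π ^ j) ∣ s := by
  rw [algebraMap_dvd_iff, ← hR.mul_eq_zero_iff hij, ← hR.mul_eq_zero_iff hij,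
    QuadraticAlgebra.ext_iff]
  generalize π ^ i = x
  simp

include hR in
/-- The bounds hold for `h = ⌊ℓ / 2⌋` and `m = ⌈ℓ / 2⌉` if `ℓ ≥ 2`; the second one gives
`𝔥² ≤ 𝔨`. -/
theorem heisPair {h m : ℕ} (hhm : h + m = ℓ) (h1 : h ≤ m) (h2 : m ≤ 2 * h) :
    HeisPair (multiples (π ^ h) : Ideal (Cen R u τ)) (multiples (π ^ m)) where
  le := multiples_le_of_dvd (pow_dvd_pow _ h1)
  mul_mem hx hy := multiples_le_of_dvd (by rw [← pow_add]; exact pow_dvd_pow _ (by omega))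
    (mul_mem_multiples hx hy)
  mul_eq_zero hx hy := multiples_zero (by
    have := mul_mem_multiples hx hy
    rwa [← pow_add, hhm, hR.pow_eq_zero] at this)
  mul_eq_zero' hx hy := multiples_zero (by
    have := mul_mem_multiples hy hx
    rwa [← pow_add, add_comm, hhm, hR.pow_eq_zero] at this)

include hR in
/-- The cross product condition, modulo a power of `π`. -/
theorem dvd_cross_of_mul_eval_sub {i j : ℕ} (hij : i + j = ℓ) {Y : Cen R u τ} :
    (∀ X, algebraMap R S (π ^ i) * (μ.eval (Y * X) - μ.eval (X * Y)) = 0) ↔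
      algebraMap R S (π ^ j) ∣ algebraMap R S (μ.slope τ) * Y.b - star μ.β * Y.gap ∧
      algebraMap R S (π ^ j) ∣ algebraMap R S (μ.slope τ) * Y.e - μ.β * Y.gap ∧
      algebraMap R S (π ^ j) ∣ star μ.β * Y.e - μ.β * Y.b := by
  rw [μ.mul_eval_sub_eq_zero_iff]
  simp only [algebraMap_pow_mul_eq_zero_iff hR hij]

include hR in
/-- The stabiliser of a regular functional is commutative, and elements which centralise it only
approximately differ from elements of the centraliser by multiples of `π ^ h`. The factor in the
centraliser can be made unitary since `1 + (π ^ h)` has odd order. -/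
theorem polarised [Finite R] (hu : IsUnit u) (hμr : μ.Regular τ)
    (hψ : ∀ a, (∀ r, ψ (r * a) = 1) → a = 0) (hμ : ∀ X, star X = -X → Λ X = ψ (μ.eval X).im)
    {h m : ℕ} (hhm : h + m = ℓ) (h0 : 0 < h) :
    Polarised (multiples (π ^ h)) (multiples (π ^ m)) Λ where
  comm s hs t ht := by
    rw [mem_stabSkew_iff hR.isUnit_two hu hψ hμ] at hs ht
    exact Subtype.ext (hμr.mul_comm hR.isUnit_two hu hs ht)
  exists_mul g hg := by
    have h1 := mul_eval_sub_eq_zero_of_conj hR.isUnit_two hu hψ hμ (π ^ m) g hg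
    obtain ⟨h1, h2, h3⟩ := (dvd_cross_of_mul_eval_sub hR (by omega : m + h = ℓ)).1 h1
    obtain ⟨Z, hZ, hgZ⟩ := hμr.exists_centralizer hR.isUnit_two hu h1 h2 h3
    have hnil : ∀ x ∈ (multiples (π ^ h) : Ideal (Cen R u τ)), IsNilpotent x := fun x hx =>
      isNilpotent_of_mem_multiples ⟨ℓ, by
        rw [← pow_mul]; exact hR.pow_eq_zero_of_le (Nat.le_mul_of_pos_left _ h0)⟩ hx
    have hstar : ∀ x ∈ (multiples (π ^ h) : Ideal (Cen R u τ)), star x ∈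
        (multiples (π ^ h) : Ideal (Cen R u τ)) := fun x hx => by
      obtain ⟨y, rfl⟩ := mem_multiples_iff_exists.1 hx
      exact mem_multiples_iff_exists.2 ⟨star y, by rw [star_mul, star_scalar, scalar_comm]⟩
    obtain ⟨t, ht, htZ⟩ := exists_unitary_sub_mem (isUnit_two hR.isUnit_two) (μ.centralizer τ)
      (fun x hx => μ.star_mem_centralizer hx) (multiples (π ^ h)) hnil hZ (by
        have : star Z * Z - 1 = -(star (g - Z) * Z) - star (g : Cen R u τ) * (g - Z) := by
          rw [star_sub, mul_sub, Unitary.star_mul_self_of_mem (Subtype.prop _)]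
          noncomm_ring
        rw [this]
        exact sub_mem (neg_mem (Ideal.mul_mem_right _ _ (hstar _ hgZ)))
          (Ideal.mul_mem_left _ _ hgZ))
    refine ⟨g * t⁻¹, ?_, t, (mem_stabSkew_iff hR.isUnit_two hu hψ hμ).2 ht, by group⟩
    rw [mem_unitaryCongr, Submonoid.coe_mul, coe_inv_unitary]
    have : (g : Cen R u τ) * star (t : Cen R u τ) - 1 =
        ((g - Z) - (t - Z)) * star (t : Cen R u τ) := by
      rw [sub_sub_sub_cancel_right, sub_mul, Unitary.mul_star_self_of_mem (Subtype.prop _)]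
    rw [this]
    exact Ideal.mul_mem_right _ _ (sub_mem hgZ htZ)
  conj_sub_mem t ht X hX := by
    rw [mem_stabSkew_iff hR.isUnit_two hu hψ hμ] at ht
    rw [mem_radical_iff hR.isUnit_two hu hψ hμ] at hX
    obtain ⟨h1, h2, h3⟩ := (dvd_cross_of_mul_eval_sub hR hhm).1 hX
    obtain ⟨Z, hZ, hXZ⟩ := hμr.exists_centralizer hR.isUnit_two hu h1 h2 h3
    have hcomm := hμr.mul_comm hR.isUnit_two hu ht hZ
    have : ((conjSkew t X : Cen R u τ) - X) =
        t * (X - Z) * star (t : Cen R u τ) - (X - Z) := by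
      change t * (X : Cen R u τ) * star (t : Cen R u τ) - X = _
      rw [mul_sub, sub_mul, hcomm, mul_assoc Z, Unitary.mul_star_self_of_mem (Subtype.prop _),
        mul_one]
      abel
    rw [this]
    exact sub_mem (Ideal.mul_mem_right _ _ (Ideal.mul_mem_left _ _ hXZ)) hXZ

end Truncated

end Cen

/-! ### Reduction to the residue field -/

/-- The map of quadratic algebras induced by a ring homomorphism. -/
def quadMap {R R' : Type*} [CommRing R] [CommRing R'] (f : R →+* R') {u : R} {u' : R'}
    (hu : f u = u') : QuadraticAlgebra R u 0 →+* QuadraticAlgebra R' u' 0 where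
  toFun s := ⟨f s.re, f s.im⟩
  map_one' := by ext <;> simp [QuadraticAlgebra.re_one, QuadraticAlgebra.im_one]
  map_mul' s t := by ext <;> simp [hu]
  map_zero' := by ext <;> simp
  map_add' s t := by ext <;> simp

section

variable {R R' : Type*} [CommRing R] [CommRing R'] (f : R →+* R') {u : R} {u' : R'} (hu : f u = u')

@[simp] theorem re_quadMap (s : QuadraticAlgebra R u 0) : (quadMap f hu s).re = f s.re := rfl
@[simp] theorem im_quadMap (s : QuadraticAlgebra R u 0) : (quadMap f hu s).im = f s.im := rfl

theorem quadMap_algebraMap (r : R) :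
    quadMap f hu (algebraMap R _ r) = algebraMap R' _ (f r) := by
  ext <;> simp

theorem quadMap_star (s : QuadraticAlgebra R u 0) :
    quadMap f hu (star s) = star (quadMap f hu s) := by
  ext <;> simp

theorem quadMap_surjective (hf : Function.Surjective f) : Function.Surjective (quadMap f hu) := by
  rintro ⟨x, y⟩
  obtain ⟨x, rfl⟩ := hf x
  obtain ⟨y, rfl⟩ := hf y
  exact ⟨⟨x, y⟩, rfl⟩

theorem quadMap_eq_zero_iff {π : R} (hr : ∀ x, f x = 0 ↔ π ∣ x) (s : QuadraticAlgebra R u 0) :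
    quadMap f hu s = 0 ↔ algebraMap R (QuadraticAlgebra R u 0) π ∣ s := by
  rw [Cen.algebraMap_dvd_iff, QuadraticAlgebra.ext_iff]
  simp [hr]

end

namespace Cen

open HeisPair

variable {R : Type*} [CommRing R] {u τ : R}

local notation "S" => QuadraticAlgebra R u 0

section Residue

variable {k : Type*} [CommRing k] (r : R →+* k) (hτ : r τ = 0)

/-- The diagonal of an element of `Cen` over the residue field. -/
def resid : Cen R u τ →+* QuadraticAlgebra k (r u) 0 × QuadraticAlgebra k (r u) 0 where
  toFun X := (quadMap r rfl X.a, quadMap r rfl X.d)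
  map_one' := by simp
  map_mul' X Y := by
    ext1
    · simp
    · simp [quadMap_algebraMap, hτ]
  map_zero' := by simp
  map_add' X Y := by simp

theorem resid_apply (X : Cen R u τ) : resid r hτ X = (quadMap r rfl X.a, quadMap r rfl X.d) := rfl

theorem resid_star (X : Cen R u τ) : resid r hτ (star X) = star (resid r hτ X) := by
  rw [resid_apply, resid_apply, star_a, star_d, quadMap_star, quadMap_star]
  rfl

/-- The kernel of the diagonal over the residue field is a nil ideal. -/
theorem isNilpotent_of_resid {π : R} (hr : ∀ x, r x = 0 ↔ π ∣ x) (hπ : IsNilpotent π)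
    {X : Cen R u τ} (hX : resid r hτ X = 0) : IsNilpotent X := by
  rw [resid_apply, Prod.mk_eq_zero, quadMap_eq_zero_iff r rfl hr,
    quadMap_eq_zero_iff r rfl hr] at hX
  -- modulo `π` the element `X` is strictly triangular
  suffices h : X * X * X ∈ multiples π by
    obtain ⟨n, hn⟩ := isNilpotent_of_mem_multiples hπ h
    exact ⟨3 * n, by rw [pow_mul, pow_three', hn]⟩
  let φ := Ideal.Quotient.mk (Ideal.span {algebraMap R S π})
  have hφ : ∀ s, algebraMap R S π ∣ s ↔ φ s = 0 := fun s => by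
    rw [Ideal.Quotient.eq_zero_iff_mem, Ideal.mem_span_singleton]
  have hτ' : φ (algebraMap R S τ) = 0 := by
    rw [← hφ]
    exact map_dvd _ ((hr _).1 hτ)
  simp only [hφ] at hX
  rw [mem_multiples]
  simp [hφ, hX.1, hX.2, hτ']

end Residue

theorem skewOf_mem_multiples {r x y : R} {v : R × R × R} :
    (skewOf x y v : Cen R u τ) ∈ multiples r ↔ r ∣ x ∧ r ∣ y ∧ r ∣ v.1 ∧ r ∣ v.2.1 ∧ r ∣ v.2.2 := by
  rw [mem_multiples]
  simp only [algebraMap_dvd_iff, skewOf, dvd_zero, true_and, dvd_neg]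
  constructor
  · rintro ⟨h1, h2, ⟨h3, h4⟩, -, h5⟩
    refine ⟨h1, h2, h3, h4, ?_⟩
    have := (h1.add (h2.mul_left τ)).sub h5
    rwa [sub_sub_cancel] at this
  · rintro ⟨h1, h2, h3, h4, h5⟩
    exact ⟨h1, h2, ⟨h3, h4⟩, ⟨h3, h4⟩, (h1.add (h2.mul_left τ)).sub h5⟩

/-- The coordinate vector to which the elements of the centraliser of `μ` are proportional. -/
def Functional.direction (μ : Functional R u) (τ : R) : R × R × R :=
  (-(u * μ.β.im), μ.β.re, μ.slope τ)

theorem Functional.Regular.direction {μ : Functional R u} (h : μ.Regular τ) (hu : IsUnit u) :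
    IsUnit (μ.direction τ).1 ∨ IsUnit (μ.direction τ).2.1 ∨ IsUnit (μ.direction τ).2.2 := by
  rcases h with h | h | h
  · exact Or.inl (hu.mul h).neg
  · exact Or.inr (Or.inl h)
  · exact Or.inr (Or.inr h)

/-- For a skew element the three conditions over `S` reduce to proportionality over `R` of its
coordinate vector to the direction of `μ`. -/
theorem dvd_cross_skewOf (h2 : IsUnit (2 : R)) (μ : Functional R u) {r x y : R} {v : R × R × R} :
    (algebraMap R S r ∣ algebraMap R S (μ.slope τ) * (skewOf x y v : Cen R u τ).b -
        star μ.β * (skewOf x y v : Cen R u τ).gap ∧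
      algebraMap R S r ∣ algebraMap R S (μ.slope τ) * (skewOf x y v : Cen R u τ).e -
        μ.β * (skewOf x y v : Cen R u τ).gap ∧
      algebraMap R S r ∣ star μ.β * (skewOf x y v : Cen R u τ).e -
        μ.β * (skewOf x y v : Cen R u τ).b) ↔
    r ∣ v.1 * (μ.direction τ).2.1 - v.2.1 * (μ.direction τ).1 ∧
      r ∣ v.1 * (μ.direction τ).2.2 - v.2.2 * (μ.direction τ).1 ∧
      r ∣ v.2.1 * (μ.direction τ).2.2 - v.2.2 * (μ.direction τ).2.1 := by
  have hg : (skewOf x y v : Cen R u τ).gap = ⟨0, v.2.2⟩ := by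
    ext <;> simp [gap, skewOf]
  have e1 : algebraMap R S (μ.slope τ) * (skewOf x y v : Cen R u τ).b -
      star μ.β * (skewOf x y v : Cen R u τ).gap =
      ⟨v.1 * (μ.direction τ).2.2 - v.2.2 * (μ.direction τ).1,
        v.2.1 * (μ.direction τ).2.2 - v.2.2 * (μ.direction τ).2.1⟩ := by
    rw [hg]
    ext <;> simp [skewOf, Functional.direction] <;> ring
  have e2 : algebraMap R S (μ.slope τ) * (skewOf x y v : Cen R u τ).e -
      μ.β * (skewOf x y v : Cen R u τ).gap =
      ⟨-(v.1 * (μ.direction τ).2.2 - v.2.2 * (μ.direction τ).1),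
        v.2.1 * (μ.direction τ).2.2 - v.2.2 * (μ.direction τ).2.1⟩ := by
    rw [hg]
    ext <;> simp [skewOf, Functional.direction] <;> ring
  have e3 : star μ.β * (skewOf x y v : Cen R u τ).e - μ.β * (skewOf x y v : Cen R u τ).b =
      ⟨-(2 * (v.1 * (μ.direction τ).2.1 - v.2.1 * (μ.direction τ).1)), 0⟩ := by
    ext <;> simp [skewOf, Functional.direction]
    ring
  rw [e1, e2, e3]
  simp only [algebraMap_dvd_iff, dvd_neg, h2.dvd_mul_left, dvd_zero, and_true]
  tauto

section Truncated

variable {π : R} {ℓ q : ℕ} (hR : IsTruncated π ℓ q)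

include hR in
theorem mem_centralizer_iff_dvd {μ : Functional R u} {Y : Cen R u τ} : Y ∈ μ.centralizer τ ↔
    algebraMap R S (π ^ ℓ) ∣ algebraMap R S (μ.slope τ) * Y.b - star μ.β * Y.gap ∧
      algebraMap R S (π ^ ℓ) ∣ algebraMap R S (μ.slope τ) * Y.e - μ.β * Y.gap ∧
      algebraMap R S (π ^ ℓ) ∣ star μ.β * Y.e - μ.β * Y.b := by
  rw [← dvd_cross_of_mul_eval_sub hR (zero_add ℓ)]
  simp only [pow_zero, map_one, one_mul, sub_eq_zero]
  rfl

include hR in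
/-- The number of skew multiples of `π ^ i` which centralise `μ` modulo `π ^ j`. -/
theorem card_skew_cross [Finite R] (hu : IsUnit u) {μ : Functional R u} (hμr : μ.Regular τ)
    {i i' j j' : ℕ} (hi : i + i' = ℓ) (hj : j + j' = ℓ) (hij : i ≤ j) :
    Nat.card {X : Cen R u τ // (X ∈ multiples (π ^ i) ∧
      algebraMap R S (π ^ j) ∣ algebraMap R S (μ.slope τ) * X.b - star μ.β * X.gap ∧
      algebraMap R S (π ^ j) ∣ algebraMap R S (μ.slope τ) * X.e - μ.β * X.gap ∧
      algebraMap R S (π ^ j) ∣ star μ.β * X.e - μ.β * X.b) ∧ star X = -X} =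
      q ^ (3 * i' + 2 * j') := by
  rw [card_skew_eq hR.isUnit_two _ (fun x => π ^ i ∣ x) (fun x => π ^ i ∣ x) _ (fun x y v => by
      rw [dvd_cross_skewOf hR.isUnit_two, skewOf_mem_multiples, and_assoc, and_assoc]),
    hR.card_dvd i i' hi]
  have := hR.card_proportional hi hj hij (hμr.direction hu)
  rw [this, ← pow_add, ← pow_add]
  congr 1
  ring

include hR in
/-- The skew elements form a free `R`-module of rank five. -/
theorem card_skewIn_multiples [Finite R] {i i' : ℕ} (hi : i + i' = ℓ) :
    Nat.card (skewIn (multiples (π ^ i) : Ideal (Cen R u τ))) = q ^ (5 * i') := by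
  have h := card_skew_eq (τ := τ) (u := u) hR.isUnit_two (fun X => X ∈ multiples (π ^ i))
    (fun x => π ^ i ∣ x) (fun x => π ^ i ∣ x)
    (fun v => π ^ i ∣ v.1 ∧ π ^ i ∣ v.2.1 ∧ π ^ i ∣ v.2.2) (fun x y v => skewOf_mem_multiples)
  have h3 : Nat.card {v : R × R × R // π ^ i ∣ v.1 ∧ π ^ i ∣ v.2.1 ∧ π ^ i ∣ v.2.2} =
      q ^ (3 * i') := by
    rw [Nat.card_congr (Equiv.subtypeProdEquivProd (p := fun x => π ^ i ∣ x)
      (q := fun v : R × R => π ^ i ∣ v.1 ∧ π ^ i ∣ v.2)), Nat.card_prod,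
      Nat.card_congr (Equiv.subtypeProdEquivProd (p := fun x => π ^ i ∣ x)
      (q := fun x => π ^ i ∣ x)), Nat.card_prod, hR.card_dvd i i' hi, ← pow_add, ← pow_add]
    congr 1
    ring
  rw [h3, hR.card_dvd i i' hi, ← pow_add, ← pow_add] at h
  refine Eq.trans ?_ (h.trans ?_)
  · rfl
  · congr 1
    ring

variable {k : Type*} [CommRing k] (r : R →+* k) (hr : ∀ x, r x = 0 ↔ π ∣ x) (hτ : r τ = 0)

include hr hτ in
/-- The conditions on `a` and `d` amount to conditions on the first and the last coordinate, as
`π ∣ τ`. -/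
theorem resid_skewOf {x y : R} {v : R × R × R} :
    resid r hτ (skewOf x y v : Cen R u τ) = 0 ↔ π ∣ x ∧ π ∣ v.2.2 := by
  rw [resid_apply, Prod.mk_eq_zero, quadMap_eq_zero_iff r rfl hr, quadMap_eq_zero_iff r rfl hr]
  simp only [algebraMap_dvd_iff, skewOf, dvd_zero, true_and]
  refine and_congr_right fun h1 => ?_
  exact dvd_sub_right (h1.add (((hr τ).1 hτ).mul_right y))

theorem card_unitary_prod (B : Type*) [Ring B] [StarRing B] :
    Nat.card (unitary (B × B)) = Nat.card (unitary B) ^ 2 := by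
  rw [sq, ← Nat.card_prod]
  refine Nat.card_congr ⟨fun y => (⟨y.1.1, ?_⟩, ⟨y.1.2, ?_⟩), fun y => ⟨(y.1, y.2), ?_⟩,
    fun _ => rfl, fun _ => rfl⟩
  · have := Unitary.mem_iff.1 y.2
    exact Unitary.mem_iff.2 ⟨congrArg Prod.fst this.1, congrArg Prod.fst this.2⟩
  · have := Unitary.mem_iff.1 y.2
    exact Unitary.mem_iff.2 ⟨congrArg Prod.snd this.1, congrArg Prod.snd this.2⟩
  · have h1 := Unitary.mem_iff.1 y.1.2
    have h2 := Unitary.mem_iff.1 y.2.2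
    exact Unitary.mem_iff.2 ⟨Prod.ext h1.1 h2.1, Prod.ext h1.2 h2.2⟩

include hR hr hτ in
/-- The group of unitary elements is an extension of two copies of the norm one group over the
residue field by a group which has, by the Cayley transform, as many elements as there are skew
elements with `a` and `d` divisible by `π`. -/
theorem card_unitary [Finite R] (hrs : Function.Surjective r) : Nat.card (unitary (Cen R u τ)) =
    q ^ (5 * ℓ - 2) * Nat.card (unitary (QuadraticAlgebra k (r u) 0)) ^ 2 := by
  have hl := hR.pos
  have h := card_unitaryIn (isUnit_two hR.isUnit_two) (resid r hτ) (resid_star (u := u) r hτ)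
    (fun x hx => isNilpotent_of_resid r hτ hr ⟨ℓ, hR.pow_eq_zero⟩ hx) ⊤ (fun _ _ => trivial)
  have h1 : unitaryIn (⊤ : Subring (Cen R u τ)) (fun _ _ => trivial) = ⊤ := by
    ext g
    exact ⟨fun _ => trivial, fun _ => trivial⟩
  rw [h1, Subgroup.card_top] at h
  rw [h, card_skew_eq hR.isUnit_two _ (fun x => π ^ 1 ∣ x) (fun x => π ^ 0 ∣ x)
    (fun v => π ^ 0 ∣ v.1 ∧ π ^ 0 ∣ v.2.1 ∧ π ^ 1 ∣ v.2.2) (fun x y v => by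
      rw [resid_skewOf r hr]; simp), hR.card_dvd 1 (ℓ - 1) (by omega), hR.card_dvd 0 ℓ (by omega),
    Nat.card_congr (Equiv.subtypeProdEquivProd (p := fun x => π ^ 0 ∣ x)
      (q := fun v : R × R => π ^ 0 ∣ v.1 ∧ π ^ 1 ∣ v.2)), Nat.card_prod,
    Nat.card_congr (Equiv.subtypeProdEquivProd (p := fun x => π ^ 0 ∣ x)
      (q := fun x => π ^ 1 ∣ x)), Nat.card_prod, hR.card_dvd 1 (ℓ - 1) (by omega),
    hR.card_dvd 0 ℓ (by omega), ← card_unitary_prod]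
  have hall : ∀ y : unitary (QuadraticAlgebra k (r u) 0 × QuadraticAlgebra k (r u) 0),
      ∃ Y ∈ (⊤ : Subring (Cen R u τ)), resid r hτ Y = y := by
    rintro ⟨⟨y, z⟩, -⟩
    obtain ⟨a, rfl⟩ := quadMap_surjective r rfl hrs y
    obtain ⟨d, rfl⟩ := quadMap_surjective r rfl hrs z
    exact ⟨⟨a, 0, 0, 0, d⟩, trivial, rfl⟩
  rw [Nat.card_congr (Equiv.subtypeUnivEquiv hall)]
  congr 1
  rw [← pow_add, ← pow_add, ← pow_add, ← pow_add]
  congr 1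
  omega

include hR hr hτ in
/-- The order of the stabiliser of a functional whose `slope` is invertible. -/
theorem card_centralizer_of_isUnit [Finite R] (hu : IsUnit u) (hrs : Function.Surjective r)
    {μ : Functional R u} (hμ : IsUnit (μ.slope τ)) :
    Nat.card (unitaryIn (μ.centralizer τ) fun _ => μ.star_mem_centralizer) =
      q ^ (3 * ℓ - 2) * Nat.card (unitary (QuadraticAlgebra k (r u) 0)) ^ 2 := by
  have hl := hR.pos
  have hreg : μ.Regular τ := Or.inr (Or.inr hμ)
  rw [card_unitaryIn (isUnit_two hR.isUnit_two) (resid r hτ) (resid_star (u := u) r hτ)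
    (fun x hx => isNilpotent_of_resid r hτ hr ⟨ℓ, hR.pow_eq_zero⟩ hx),
    card_skew_eq hR.isUnit_two _ (fun x => π ^ 1 ∣ x) (fun x => π ^ 0 ∣ x) _ (fun x y v => by
      have : (π ∣ x ∧ π ∣ v.2.2) ∧ (π ^ ℓ ∣ v.1 * (μ.direction τ).2.1 - v.2.1 * (μ.direction τ).1 ∧
          π ^ ℓ ∣ v.1 * (μ.direction τ).2.2 - v.2.2 * (μ.direction τ).1 ∧
          π ^ ℓ ∣ v.2.1 * (μ.direction τ).2.2 - v.2.2 * (μ.direction τ).2.1) ↔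
          π ^ 1 ∣ x ∧ π ^ 0 ∣ y ∧ (π ^ 1 ∣ v.1 ∧ π ^ 1 ∣ v.2.1 ∧ π ^ 1 ∣ v.2.2) ∧
          (π ^ ℓ ∣ v.1 * (μ.direction τ).2.1 - v.2.1 * (μ.direction τ).1 ∧
          π ^ ℓ ∣ v.1 * (μ.direction τ).2.2 - v.2.2 * (μ.direction τ).1 ∧
          π ^ ℓ ∣ v.2.1 * (μ.direction τ).2.2 - v.2.2 * (μ.direction τ).2.1) := by
        simp only [pow_one, pow_zero, isUnit_one.dvd, true_and]
        refine ⟨?_, fun ⟨h1, h2, h3⟩ => ⟨⟨h1, h2.2.2⟩, h3⟩⟩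
        rintro ⟨⟨h1, h2⟩, h3, h4, h5⟩
        have hw : IsUnit (μ.direction τ).2.2 := hμ
        have hπ : π ∣ π ^ ℓ := dvd_pow_self _ hl.ne'
        refine ⟨h1, ⟨?_, ?_, h2⟩, h3, h4, h5⟩
        · have := (hπ.trans h4).add (h2.mul_right (μ.direction τ).1)
          rw [sub_add_cancel] at this
          exact (hw.dvd_mul_right).1 this
        · have := (hπ.trans h5).add (h2.mul_right (μ.direction τ).2.1)
          rw [sub_add_cancel] at this
          exact (hw.dvd_mul_right).1 this
      rw [← this, and_comm, resid_skewOf r hr, mem_centralizer_iff_dvd hR,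
        dvd_cross_skewOf hR.isUnit_two]),
    hR.card_proportional (show 1 + (ℓ - 1) = ℓ by omega) (add_zero ℓ) hl (hreg.direction hu),
    hR.card_dvd 1 (ℓ - 1) (by omega), hR.card_dvd 0 ℓ (by omega), ← card_unitary_prod]
  have hall : ∀ y : unitary (QuadraticAlgebra k (r u) 0 × QuadraticAlgebra k (r u) 0),
      ∃ Y ∈ μ.centralizer τ, resid r hτ Y = y := by
    rintro ⟨⟨y, z⟩, -⟩
    obtain ⟨a, rfl⟩ := quadMap_surjective r rfl hrs y
    obtain ⟨d, rfl⟩ := quadMap_surjective r rfl hrs z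
    obtain ⟨c, hc⟩ := (hμ.map (algebraMap R S)).exists_left_inv
    refine ⟨⟨a, 0, (a - d) * c * star μ.β, (a - d) * c * μ.β, d⟩, ?_, rfl⟩
    rw [μ.mem_centralizer_iff]
    simp only [gap, mul_zero, add_zero]
    refine ⟨?_, ?_, by ring⟩
    · linear_combination ((a - d) * star μ.β) * hc
    · linear_combination ((a - d) * μ.β) * hc
  rw [Nat.card_congr (Equiv.subtypeUnivEquiv hall)]
  congr 1
  rw [← pow_add, ← pow_add]
  congr 1
  omega

include hR hr hτ in
/-- The order of the stabiliser of a regular functional whose `slope` is divisible by `π`. -/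
theorem card_centralizer_of_dvd [Finite R] (hu : IsUnit u) (hrs : Function.Surjective r)
    {μ : Functional R u} (hμ : π ∣ μ.slope τ) (hβ : IsUnit μ.β.im ∨ IsUnit μ.β.re) :
    Nat.card (unitaryIn (μ.centralizer τ) fun _ => μ.star_mem_centralizer) =
      q ^ (3 * ℓ - 1) * Nat.card (unitary (QuadraticAlgebra k (r u) 0)) := by
  have hl := hR.pos
  have hreg : μ.Regular τ := hβ.elim Or.inl (Or.inr ∘ Or.inl)
  rw [card_unitaryIn (isUnit_two hR.isUnit_two) (resid r hτ) (resid_star (u := u) r hτ)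
    (fun x hx => isNilpotent_of_resid r hτ hr ⟨ℓ, hR.pow_eq_zero⟩ hx),
    card_skew_eq hR.isUnit_two _ (fun x => π ^ 1 ∣ x) (fun x => π ^ 0 ∣ x) _ (fun x y v => by
      have : (π ∣ x ∧ π ∣ v.2.2) ∧ (π ^ ℓ ∣ v.1 * (μ.direction τ).2.1 - v.2.1 * (μ.direction τ).1 ∧
          π ^ ℓ ∣ v.1 * (μ.direction τ).2.2 - v.2.2 * (μ.direction τ).1 ∧
          π ^ ℓ ∣ v.2.1 * (μ.direction τ).2.2 - v.2.2 * (μ.direction τ).2.1) ↔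
          π ^ 1 ∣ x ∧ π ^ 0 ∣ y ∧ (π ^ 0 ∣ v.1 ∧ π ^ 0 ∣ v.2.1 ∧ π ^ 0 ∣ v.2.2) ∧
          (π ^ ℓ ∣ v.1 * (μ.direction τ).2.1 - v.2.1 * (μ.direction τ).1 ∧
          π ^ ℓ ∣ v.1 * (μ.direction τ).2.2 - v.2.2 * (μ.direction τ).1 ∧
          π ^ ℓ ∣ v.2.1 * (μ.direction τ).2.2 - v.2.2 * (μ.direction τ).2.1) := by
        simp only [pow_one, pow_zero, isUnit_one.dvd, true_and]
        refine ⟨fun ⟨h1, h3⟩ => ⟨h1.1, h3⟩, ?_⟩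
        rintro ⟨h1, h3, h4, h5⟩
        have hπ : π ∣ π ^ ℓ := dvd_pow_self _ hl.ne'
        refine ⟨⟨h1, ?_⟩, h3, h4, h5⟩
        have hd : π ∣ (μ.direction τ).2.2 := hμ
        rcases hβ with hβ | hβ
        · have hw : IsUnit (μ.direction τ).1 := (hu.mul hβ).neg
          have := (hd.mul_left v.1).sub (hπ.trans h4)
          rw [sub_sub_cancel] at this
          exact (hw.dvd_mul_right).1 this
        · have hw : IsUnit (μ.direction τ).2.1 := hβ
          have := (hd.mul_left v.2.1).sub (hπ.trans h5)
          rw [sub_sub_cancel] at this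
          exact (hw.dvd_mul_right).1 this
      rw [← this, and_comm, resid_skewOf r hr, mem_centralizer_iff_dvd hR,
        dvd_cross_skewOf hR.isUnit_two]),
    hR.card_proportional (zero_add ℓ) (add_zero ℓ) (Nat.zero_le ℓ) (hreg.direction hu),
    hR.card_dvd 1 (ℓ - 1) (by omega), hR.card_dvd 0 ℓ (by omega)]
  congr 1
  · rw [← pow_add, ← pow_add]
    congr 1
    omega
  · -- the image consists of the scalar matrices, as `a` and `d` agree modulo `π`
    have hslope : quadMap r rfl (algebraMap R S (μ.slope τ)) = 0 := by
      rw [quadMap_eq_zero_iff r rfl hr]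
      exact map_dvd _ hμ
    refine Nat.card_congr ⟨fun y => ⟨y.1.1.1, ?_⟩, fun y => ⟨⟨(y, y), ?_⟩, ?_⟩, ?_, fun _ => rfl⟩
    · have := Unitary.mem_iff.1 y.1.2
      exact Unitary.mem_iff.2 ⟨congrArg Prod.fst this.1, congrArg Prod.fst this.2⟩
    · have h1 := Unitary.mem_iff.1 y.2
      exact Unitary.mem_iff.2 ⟨Prod.ext h1.1 h1.1, Prod.ext h1.2 h1.2⟩
    · obtain ⟨y, hy⟩ := y
      obtain ⟨a, rfl⟩ := quadMap_surjective r rfl hrs y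
      refine ⟨scalar a, ?_, rfl⟩
      rw [μ.mem_centralizer_iff]
      simp [gap]
    · rintro ⟨⟨⟨y, z⟩, hyz⟩, Y, hY, h⟩
      refine Subtype.ext (Subtype.ext (Prod.ext rfl ?_))
      change y = z
      rw [resid_apply] at h
      have h1 : quadMap r rfl Y.a = y := congrArg Prod.fst h
      have h2 : quadMap r rfl Y.d = z := congrArg Prod.snd h
      rw [← h1, ← h2]
      rw [μ.mem_centralizer_iff] at hY
      have hg : quadMap r rfl Y.gap = 0 := by
        have e1 : quadMap r rfl (star μ.β) * quadMap r rfl Y.gap = 0 := by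
          rw [← map_mul, ← hY.1, map_mul, hslope, zero_mul]
        have e2 : quadMap r rfl μ.β * quadMap r rfl Y.gap = 0 := by
          rw [← map_mul, ← hY.2.1, map_mul, hslope, zero_mul]
        obtain ⟨p, p', p'', hp⟩ := hreg.exists_bezout hR.isUnit_two hu
        have hp' := congrArg (quadMap r (rfl : r u = r u)) hp
        rw [map_add, map_add, map_mul, map_mul, map_mul, hslope, map_one] at hp'
        linear_combination (-quadMap r rfl Y.gap) * hp' + quadMap r rfl p * e1 +
          quadMap r rfl p' * e2
      rw [gap, map_sub, map_add, map_mul, quadMap_algebraMap, hτ, map_zero, zero_mul, add_zero,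
        sub_eq_zero] at hg
      exact hg

end Truncated

end Cen

namespace Representation

theorem weight_eq_one {G V : Type*} [Group G] [AddCommGroup V] [Module ℂ V]
    {ρ : Representation ℂ G V} {K : Subgroup G} {χ : G → ℂ} (hχ : weightSpace ρ K χ ≠ ⊥) {g : G}
    (hg : g ∈ K) (h1 : ρ g = 1) : χ g = 1 := by
  obtain ⟨w, hw, hw0⟩ := Submodule.exists_mem_ne_zero_of_ne_bot hχ
  refine smul_left_injective ℂ hw0 ?_
  simp only [one_smul]
  rw [← hw g hg, h1, Module.End.one_apply]

end Representation

theorem unitaryCongr_mono {A : Type*} [Ring A] [StarRing A] {I J : Ideal A} [I.IsTwoSided]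
    [J.IsTwoSided] (h : I ≤ J) : unitaryCongr I ≤ unitaryCongr J := fun _ hg => h hg

namespace Cen

open HeisPair Representation

variable {R : Type*} [CommRing R] {u τ : R}

local notation "S" => QuadraticAlgebra R u 0

/-! ### Two small ideals -/

variable (u) in
/-- The elements with `a = d = 0` whose remaining coordinates are divisible by `s`, where `s`
annihilates `τ`. -/
def offDiag {s : R} (hs : s * τ = 0) : Ideal (Cen R u τ) where
  carrier := {X | X.a = 0 ∧ X.d = 0 ∧
    algebraMap R S s ∣ X.c ∧ algebraMap R S s ∣ X.b ∧ algebraMap R S s ∣ X.e}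
  zero_mem' := by simp
  add_mem' := by
    rintro X Y ⟨h1, h2, h3, h4, h5⟩ ⟨h1', h2', h3', h4', h5'⟩
    exact ⟨by simp [h1, h1'], by simp [h2, h2'], h3.add h3', h4.add h4', h5.add h5'⟩
  smul_mem' := by
    rintro Y X ⟨h1, h2, ⟨c, hc⟩, ⟨b, hb⟩, ⟨e, he⟩⟩
    have hs' : algebraMap R S s * algebraMap R S τ = 0 := by rw [← map_mul, hs, map_zero]
    simp only [smul_eq_mul]
    refine ⟨by simp [h1], ?_, ⟨Y.a * c + algebraMap R S τ * Y.c * c + Y.b * e, ?_⟩,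
      ⟨(Y.a + algebraMap R S τ * Y.c) * b, ?_⟩, ⟨Y.e * algebraMap R S τ * c + Y.d * e, ?_⟩⟩
    · rw [mul_d, h2, hb]
      linear_combination (Y.e * b) * hs'
    · rw [mul_c, h1, hc, he]
      ring
    · rw [mul_b, h2, hb]
      ring
    · rw [mul_e, h1, hc, he]
      ring

variable (u) in
/-- The elements whose only nonzero coordinate is `c`, divisible by `s`. -/
def corner {s : R} (hs : s * τ = 0) : Ideal (Cen R u τ) where
  carrier := {X | X.a = 0 ∧ X.d = 0 ∧ X.b = 0 ∧ X.e = 0 ∧ algebraMap R S s ∣ X.c}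
  zero_mem' := by simp
  add_mem' := by
    rintro X Y ⟨h1, h2, h3, h4, h5⟩ ⟨h1', h2', h3', h4', h5'⟩
    exact ⟨by simp [h1, h1'], by simp [h2, h2'], by simp [h3, h3'], by simp [h4, h4'], h5.add h5'⟩
  smul_mem' := by
    rintro Y X ⟨h1, h2, h3, h4, ⟨c, hc⟩⟩
    have hs' : algebraMap R S s * algebraMap R S τ = 0 := by rw [← map_mul, hs, map_zero]
    simp only [smul_eq_mul]
    refine ⟨by simp [h1], by simp [h2, h3], by simp [h2, h3], ?_,
      ⟨Y.a * c + algebraMap R S τ * Y.c * c, ?_⟩⟩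
    · rw [mul_e, h1, hc, h4]
      linear_combination (Y.e * c) * hs'
    · rw [mul_c, h1, hc, h4]
      ring

section

variable {s : R} {hs : s * τ = 0} {X : Cen R u τ}

theorem mem_offDiag : X ∈ offDiag u hs ↔ X.a = 0 ∧ X.d = 0 ∧
    algebraMap R S s ∣ X.c ∧ algebraMap R S s ∣ X.b ∧ algebraMap R S s ∣ X.e := Iff.rfl

theorem mem_corner : X ∈ corner u hs ↔
    X.a = 0 ∧ X.d = 0 ∧ X.b = 0 ∧ X.e = 0 ∧ algebraMap R S s ∣ X.c := Iff.rfl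

instance : (offDiag u hs).IsTwoSided where
  mul_mem_of_left := by
    rintro X Y ⟨h1, h2, ⟨c, hc⟩, ⟨b, hb⟩, ⟨e, he⟩⟩
    have hs' : algebraMap R S s * algebraMap R S τ = 0 := by rw [← map_mul, hs, map_zero]
    refine ⟨by simp [h1], ?_, ⟨c * Y.a + algebraMap R S τ * c * Y.c + b * Y.e, ?_⟩,
      ⟨algebraMap R S τ * c * Y.b + b * Y.d, ?_⟩, ⟨e * (Y.a + algebraMap R S τ * Y.c), ?_⟩⟩
    · rw [mul_d, h2, he]
      linear_combination (e * Y.b) * hs'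
    · rw [mul_c, h1, hc, hb]
      ring
    · rw [mul_b, h1, hc, hb]
      ring
    · rw [mul_e, h2, he]
      ring

instance : (corner u hs).IsTwoSided where
  mul_mem_of_left := by
    rintro X Y ⟨h1, h2, h3, h4, ⟨c, hc⟩⟩
    have hs' : algebraMap R S s * algebraMap R S τ = 0 := by rw [← map_mul, hs, map_zero]
    refine ⟨by simp [h1], by simp [h2, h4], ?_, by simp [h2, h4],
      ⟨c * Y.a + algebraMap R S τ * c * Y.c, ?_⟩⟩
    · rw [mul_b, h1, hc, h3]
      linear_combination (c * Y.b) * hs'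
    · rw [mul_c, h1, hc, h3]
      ring

theorem corner_le_offDiag : corner u hs ≤ offDiag u hs := fun X ⟨h1, h2, h3, h4, h5⟩ =>
  ⟨h1, h2, h5, by rw [h3]; exact dvd_zero _, by rw [h4]; exact dvd_zero _⟩

theorem offDiag_le_multiples {t : R} (ht : t ∣ s) : offDiag u hs ≤ multiples t := by
  rintro X ⟨h1, h2, h3, h4, h5⟩
  have := map_dvd (algebraMap R S) ht
  rw [mem_multiples, h1, h2]
  exact ⟨dvd_zero _, this.trans h3, this.trans h4, this.trans h5, dvd_zero _⟩

end

section Truncated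

variable {π : R} {ℓ q : ℕ} (hR : IsTruncated π ℓ q)

/-- The Cayley transform, for the whole ring. -/
theorem card_unitaryCongr [Finite R] (h2 : IsUnit (2 : R)) (I : Ideal (Cen R u τ)) [I.IsTwoSided]
    (hI : ∀ x ∈ I, IsNilpotent x) :
    Nat.card (unitaryCongr I) = Nat.card {X : Cen R u τ // X ∈ I ∧ star X = -X} := by
  have h := card_unitaryIn_congr (isUnit_two h2) ⊤ I hI
  refine Eq.trans ?_ (h.trans ?_)
  · exact Nat.card_congr (Equiv.subtypeEquiv (Equiv.refl _) fun g =>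
      ⟨fun h => ⟨trivial, h⟩, fun h => h.2⟩)
  · exact Nat.card_congr (Equiv.subtypeEquiv (Equiv.refl _) fun g =>
      ⟨fun h => ⟨h.1.2, h.2⟩, fun h => ⟨⟨trivial, h.1⟩, h.2⟩⟩)

variable (hs : π ^ (ℓ - 1) * τ = 0)

theorem isNilpotent_of_mem_offDiag {s : R} {hs : s * τ = 0} {X : Cen R u τ}
    (hX : X ∈ offDiag u hs) : IsNilpotent X := by
  obtain ⟨h1, h2, ⟨c, hc⟩, ⟨b, hb⟩, ⟨e, he⟩⟩ := hX
  have hs' : algebraMap R S s * algebraMap R S τ = 0 := by rw [← map_mul, hs, map_zero]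
  have hτc : ∀ t, algebraMap R S τ * (algebraMap R S s * t) = 0 := fun t => by
    linear_combination t * hs'
  have hτc' : ∀ t t', algebraMap R S τ * (algebraMap R S s * t * t') = 0 := fun t t' => by
    linear_combination (t * t') * hs'
  refine ⟨3, ?_⟩
  rw [pow_three']
  ext1 <;> simp only [mul_a, mul_c, mul_b, mul_e, mul_d, h1, h2, hc, hb, he, hτc, hτc', zero_a,
    zero_b, zero_c, zero_d, zero_e, zero_mul, mul_zero, zero_add, add_zero]

theorem skewOf_mem_corner {x y : R} {v : R × R × R} {s : R} {hs : s * τ = 0} :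
    (skewOf x y v : Cen R u τ) ∈ corner u hs ↔ x = 0 ∧ s ∣ y ∧ v = 0 := by
  rw [mem_corner]
  simp only [algebraMap_dvd_iff, skewOf, dvd_zero, true_and, QuadraticAlgebra.ext_iff,
    QuadraticAlgebra.re_zero, QuadraticAlgebra.im_zero, neg_eq_zero, Prod.ext_iff, Prod.fst_zero,
    Prod.snd_zero]
  constructor
  · rintro ⟨h1, h2, ⟨h3, h4⟩, -, h5⟩
    obtain ⟨y, rfl⟩ := h5
    refine ⟨h1, ⟨y, rfl⟩, h3, h4, ?_⟩
    rw [h1] at h2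
    linear_combination y * hs - h2
  · rintro ⟨rfl, ⟨y, rfl⟩, h3, h4, h5⟩
    refine ⟨rfl, ?_, ⟨h3, h4⟩, ⟨h3, h4⟩, ⟨y, rfl⟩⟩
    rw [h5]
    linear_combination y * hs

theorem skewOf_mem_offDiag {x y : R} {v : R × R × R} {s : R} {hs : s * τ = 0} :
    (skewOf x y v : Cen R u τ) ∈ offDiag u hs ↔
      x = 0 ∧ s ∣ y ∧ (s ∣ v.1 ∧ s ∣ v.2.1 ∧ v.2.2 = 0) := by
  rw [mem_offDiag]
  simp only [algebraMap_dvd_iff, skewOf, dvd_zero, true_and, QuadraticAlgebra.ext_iff,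
    QuadraticAlgebra.re_zero, QuadraticAlgebra.im_zero, dvd_neg]
  constructor
  · rintro ⟨h1, h2, h5, ⟨h3, h4⟩, -⟩
    obtain ⟨y, rfl⟩ := h5
    refine ⟨h1, ⟨y, rfl⟩, h3, h4, ?_⟩
    rw [h1] at h2
    linear_combination y * hs - h2
  · rintro ⟨rfl, ⟨y, rfl⟩, h3, h4, h5⟩
    refine ⟨rfl, ?_, ⟨y, rfl⟩, ⟨h3, h4⟩, ⟨h3, h4⟩⟩
    rw [h5]
    linear_combination y * hs

include hR in
theorem card_corner [Finite R] : Nat.card (unitaryCongr (corner u hs)) = q := by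
  have hl := hR.pos
  rw [card_unitaryCongr hR.isUnit_two _ fun x hx =>
      isNilpotent_of_mem_offDiag (corner_le_offDiag hx),
    card_skew_eq hR.isUnit_two _ (fun x => x = 0) (fun x => π ^ (ℓ - 1) ∣ x) (fun v => v = 0)
      (fun x y v => skewOf_mem_corner), hR.card_dvd (ℓ - 1) 1 (by omega)]
  simp

include hR in
theorem card_offDiag [Finite R] : Nat.card (unitaryCongr (offDiag u hs)) = q ^ 3 := by
  have hl := hR.pos
  rw [card_unitaryCongr hR.isUnit_two _ fun x hx => isNilpotent_of_mem_offDiag hx,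
    card_skew_eq hR.isUnit_two _ (fun x => x = 0) (fun x => π ^ (ℓ - 1) ∣ x) _
      (fun x y v => skewOf_mem_offDiag), hR.card_dvd (ℓ - 1) 1 (by omega),
    Nat.card_congr (Equiv.subtypeProdEquivProd (p := fun x => π ^ (ℓ - 1) ∣ x)
      (q := fun v : R × R => π ^ (ℓ - 1) ∣ v.1 ∧ v.2 = 0)), Nat.card_prod,
    Nat.card_congr (Equiv.subtypeProdEquivProd (p := fun x => π ^ (ℓ - 1) ∣ x)
      (q := fun x : R => x = 0)), Nat.card_prod, hR.card_dvd (ℓ - 1) 1 (by omega)]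
  simp
  ring

include hR in
theorem pow_pred_mul_eq_zero (hτ : π ∣ τ) : π ^ (ℓ - 1) * τ = 0 :=
  (hR.mul_eq_zero_iff (i := ℓ - 1) (j := 1) (by have := hR.pos; omega)).2 (by rwa [pow_one])

/-! ### Dimensions at level at least two -/

variable {k : Type*} [CommRing k] (r : R →+* k) (hr : ∀ x, r x = 0 ↔ π ∣ x) (hτ : r τ = 0)
  {V : Type*} [AddCommGroup V] [Module ℂ V] [FiniteDimensional ℂ V]
  {ρ : Representation ℂ (unitary (Cen R u τ)) V} {ψ : AddChar R ℂ}

include hR hr hτ in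
/-- The dimension of an irreducible representation which contains a weight all of whose extensions
are given by regular functionals. -/
theorem finrank_mul_of_regular [Finite R] (hu : IsUnit u) (hrs : Function.Surjective r)
    (hψ : ∀ a, (∀ r, ψ (r * a) = 1) → a = 0)
    (hψ' : ∀ Λ : AddChar R ℂ, ∃ a, ∀ r, Λ r = ψ (r * a)) (hρ : ρ.IsIrreducible)
    {h m N : ℕ} (hhm : h + m = ℓ) (h0 : 0 < h) (h1 : h ≤ m) (h2 : m ≤ 2 * h)
    {χ : unitary (Cen R u τ) → ℂ}
    (hχ : weightSpace ρ (unitaryCongr (multiples (π ^ m))) χ ≠ ⊥)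
    (hN : ∀ Λ, (heisPair hR hhm h1 h2).Matches χ Λ → ∀ μ : Functional R u,
      (∀ X : Cen R u τ, star X = -X → Λ X = ψ (μ.eval X).im) → μ.Regular τ ∧
      Nat.card (unitaryIn (μ.centralizer τ) fun _ => μ.star_mem_centralizer) = N) :
    Module.finrank ℂ V * N =
      q ^ (4 * ℓ - 2) * Nat.card (unitary (QuadraticAlgebra k (r u) 0)) ^ 2 := by
  have hl := hR.pos
  have h2A : IsUnit (2 : Cen R u τ) := isUnit_two hR.isUnit_two
  set hp := heisPair (u := u) (τ := τ) hR hhm h1 h2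
  have hpol : ∀ Λ, hp.Matches χ Λ → Polarised (multiples (π ^ h)) (multiples (π ^ m)) Λ := by
    intro Λ hΛ
    obtain ⟨μ, hμ⟩ := exists_functional hR.isUnit_two hψ' Λ
    exact polarised hR hu (hN Λ hΛ μ hμ).1 hψ hμ hhm h0
  obtain ⟨Λ, hΛ, hdim⟩ := hp.exists_matches_finrank_sq h2A hρ hχ hpol
  have hpolΛ := hpol Λ hΛ
  obtain ⟨μ, hμ⟩ := exists_functional hR.isUnit_two hψ' Λ
  obtain ⟨hμr, hcard⟩ := hN Λ hΛ μ hμ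
  have hstab : stabSkew Λ = unitaryIn (μ.centralizer τ) fun _ => μ.star_mem_centralizer := by
    ext t
    rw [mem_stabSkew_iff hR.isUnit_two hu hψ hμ, mem_unitaryIn]
  -- the radical
  have hrad : Nat.card (radical (multiples (π ^ h)) Λ) = q ^ (3 * m + 2 * h) := by
    rw [← card_skew_cross (τ := τ) hR hu hμr hhm (show m + h = ℓ by omega) h1]
    refine Nat.card_congr ⟨fun X => ⟨X.1.1, ⟨X.1.2.1, (dvd_cross_of_mul_eval_sub hR hhm).1
      ((mem_radical_iff hR.isUnit_two hu hψ hμ).1 X.2)⟩, X.1.2.2⟩, fun X =>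
      ⟨⟨X.1, X.2.1.1, X.2.2⟩, (mem_radical_iff hR.isUnit_two hu hψ hμ).2
        ((dvd_cross_of_mul_eval_sub hR hhm).2 X.2.1.2)⟩, fun _ => rfl, fun _ => rfl⟩
  rw [hrad, card_skewIn_multiples hR hhm] at hdim
  have hq : 0 < q := zero_lt_one.trans hR.one_lt
  have hfin : Module.finrank ℂ (weightSpace ρ (unitaryCongr (multiples (π ^ m))) χ) =
      q ^ (m - h) := by
    have h3 : q ^ (5 * m) = q ^ (2 * (m - h)) * q ^ (3 * m + 2 * h) := by
      rw [← pow_add]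
      congr 1
      omega
    rw [h3] at hdim
    have := Nat.eq_of_mul_eq_mul_right (Nat.pow_pos hq) hdim
    rw [mul_comm 2, pow_mul] at this
    exact Nat.pow_left_injective two_ne_zero this
  -- the stabiliser
  have hnil : ∀ x ∈ (multiples (π ^ h) : Ideal (Cen R u τ)), IsNilpotent x := fun x hx =>
    isNilpotent_of_mem_multiples ⟨ℓ, by
      rw [← pow_mul]; exact hR.pow_eq_zero_of_le (Nat.le_mul_of_pos_left _ h0)⟩ hx
  have hS := Subgroup.card_mul_card_of_exists_mul (unitaryCongr (multiples (π ^ h)))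
    (stabSkew Λ) (charStab (unitaryCongr (multiples (π ^ m))) χ)
    (fun g hg => (hp.mem_charStab_iff h2A hΛ).2 fun X hX => by
      -- `1 + 𝔥` acts trivially on `𝔨`
      have e1 : ((g : Cen R u τ) - 1) * X = 0 := hp.mul_eq_zero hg hX.1
      have e2 : (g : Cen R u τ) * X = X := by rwa [sub_mul, one_mul, sub_eq_zero] at e1
      have e3 : X * (((g⁻¹ : unitary (Cen R u τ)) : Cen R u τ) - 1) = 0 :=
        hp.mul_eq_zero' (inv_mem hg : g⁻¹ ∈ unitaryCongr (multiples (π ^ h))) hX.1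
      rw [mul_sub, mul_one, sub_eq_zero, coe_inv_unitary] at e3
      rw [e2, e3])
    (fun t ht => (hp.mem_charStab_iff h2A hΛ).2 fun X hX => ht X hX.2)
    (fun g hg => hpolΛ.exists_mul g ((hp.mem_charStab_iff h2A hΛ).1 hg))
  have hH : Nat.card (unitaryCongr (multiples (π ^ h) : Ideal (Cen R u τ))) = q ^ (5 * m) := by
    rw [card_unitaryCongr hR.isUnit_two _ hnil, ← card_skewIn_multiples (u := u) (τ := τ) hR hhm]
    rfl
  have hHC : Nat.card ((unitaryCongr (multiples (π ^ h) : Ideal (Cen R u τ))).subgroupOf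
      (stabSkew Λ)) = q ^ (3 * m) := by
    have h4 := card_skew_cross (τ := τ) hR hu hμr hhm (add_zero ℓ) (by omega)
    rw [mul_zero, add_zero] at h4
    rw [← h4]
    refine Eq.trans ?_ ((card_unitaryIn_congr h2A (μ.centralizer τ) _ hnil).trans ?_)
    · rw [hstab]
      exact Nat.card_congr ⟨fun g => ⟨g.1.1, g.1.2, g.2⟩, fun g => ⟨⟨g.1, g.2.1⟩, g.2.2⟩,
        fun _ => rfl, fun _ => rfl⟩
    · refine Nat.card_congr (Equiv.subtypeEquiv (Equiv.refl _) fun X => ?_)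
      simp only [Equiv.refl_apply]
      rw [← mem_centralizer_iff_dvd hR, and_comm (a := X ∈ μ.centralizer τ)]
  rw [hH, hHC, hstab, hcard] at hS
  have hS' : Nat.card (charStab (unitaryCongr (multiples (π ^ m))) χ) = q ^ (2 * m) * N := by
    refine Nat.eq_of_mul_eq_mul_right (Nat.pow_pos hq (n := 3 * m)) (hS.trans ?_)
    rw [show 5 * m = 2 * m + 3 * m by ring, pow_add]
    ring
  have hmain := hρ.card_charStab_mul_finrank hχ
  rw [hS', hfin, card_unitary hR r hr hτ hrs] at hmain
  refine Nat.eq_of_mul_eq_mul_right (Nat.pow_pos hq (n := 2 * m)) ?_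
  have e : q ^ (5 * ℓ - 2) * q ^ (m - h) = q ^ (4 * ℓ - 2) * q ^ (2 * m) := by
    rw [← pow_add, ← pow_add]
    congr 1
    omega
  linear_combination hmain + (Nat.card (unitary (QuadraticAlgebra k (r u) 0)) ^ 2) * e

end Truncated

end Cen

namespace HeisPair

variable {A : Type*} [Ring A] [StarRing A] {𝔥 𝔨 I : Ideal A} [𝔨.IsTwoSided] [I.IsTwoSided]

/-- The unitary elements of `1 + 𝔨` commute, as `𝔨² = 0`. -/
theorem mul_comm_of_mem (hp : HeisPair 𝔥 𝔨) {x y : unitary A} (hx : x ∈ unitaryCongr 𝔨)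
    (hy : y ∈ unitaryCongr 𝔨) : x * y = y * x := by
  have h1 : ((x : A) - 1) * ((y : A) - 1) = 0 := hp.mul_eq_zero (hp.le hx) hy
  have h2 : ((y : A) - 1) * ((x : A) - 1) = 0 := hp.mul_eq_zero (hp.le hy) hx
  apply Subtype.ext
  rw [Submonoid.coe_mul, Submonoid.coe_mul, ← sub_eq_zero]
  calc (x : A) * y - y * x = ((x : A) - 1) * ((y : A) - 1) - ((y : A) - 1) * ((x : A) - 1) := by
        noncomm_ring
    _ = 0 := by rw [h1, h2, sub_zero]

/-- The exponential matches the ideals contained in `𝔨` with their congruence subgroups. -/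
theorem exists_expU_of_le (hp : HeisPair 𝔥 𝔨) (h2 : IsUnit (2 : A)) (hI : I ≤ 𝔨) {x : unitary A}
    (hx : x ∈ unitaryCongr I) : ∃ X : skewIn 𝔥, (X : A) ∈ 𝔨 ∧ (X : A) ∈ I ∧ hp.expU X = x := by
  obtain ⟨X, hX, rfl⟩ := hp.exists_expU_of_mem h2 (unitaryCongr_mono hI hx)
  refine ⟨X, hX, ?_, rfl⟩
  rw [mem_unitaryCongr, hp.expU_of_mem hX, add_sub_cancel_left] at hx
  obtain ⟨c, hc⟩ := h2.exists_left_inv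
  have := I.mul_mem_left c hx
  rwa [← mul_assoc, hc, one_mul] at this

omit [𝔨.IsTwoSided] in
theorem expU_mem_of_le (hp : HeisPair 𝔥 𝔨) (hI : I ≤ 𝔨) {X : skewIn 𝔥} (hX : (X : A) ∈ I) :
    hp.expU X ∈ unitaryCongr I := by
  rw [mem_unitaryCongr, hp.expU_of_mem (hI hX), add_sub_cancel_left]
  exact I.mul_mem_left _ hX

end HeisPair

namespace Cen

open HeisPair Representation

variable {R : Type*} [CommRing R] {u τ : R}

local notation "S" => QuadraticAlgebra R u 0

/-- On the off-diagonal ideal, `μ` depends only on the coefficients which decide its regularity. -/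
theorem eval_of_mem_offDiag (μ : Functional R u) {s : R} {hs : s * τ = 0} {X : Cen R u τ}
    (hX : X ∈ offDiag u hs) :
    μ.eval X = algebraMap R S μ.γ * X.c + μ.β * X.b + star μ.β * X.e := by
  rw [Functional.eval, hX.1, hX.2.1]
  ring

section Truncated

variable {π : R} {ℓ q : ℕ} (hR : IsTruncated π ℓ q) (hs : π ^ (ℓ - 1) * τ = 0)
  {k : Type*} [CommRing k] (r : R →+* k) (hr : ∀ x, r x = 0 ↔ π ∣ x) (hτ : r τ = 0)
  {V : Type*} [AddCommGroup V] [Module ℂ V] [FiniteDimensional ℂ V]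
  {ρ : Representation ℂ (unitary (Cen R u τ)) V}

include hR in
theorem mul_pow_pred_eq_zero {t : R} {z : S} (ht : π ∣ t) (hz : algebraMap R S (π ^ (ℓ - 1)) ∣ z) :
    algebraMap R S t * z = 0 := by
  obtain ⟨z, rfl⟩ := hz
  rw [← mul_assoc, ← map_mul, mul_comm t, pow_pred_mul_eq_zero hR ht, map_zero, zero_mul]

include hR in
theorem mul_pow_pred_eq_zero' {β z : S} (h1 : π ∣ β.re) (h2 : π ∣ β.im)
    (hz : algebraMap R S (π ^ (ℓ - 1)) ∣ z) : β * z = 0 := by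
  obtain ⟨β, rfl⟩ := algebraMap_dvd_iff.2 ⟨h1, h2⟩
  rw [mul_right_comm, mul_pow_pred_eq_zero hR dvd_rfl hz, zero_mul]

include hR hr hτ in
/-- At level `ℓ ≥ 2`, the representations which are nontrivial on the corner subgroup have
dimension `q ^ ℓ`. -/
theorem finrank_eq_of_corner [Finite R] [Finite k] (hu : IsUnit u) (hrs : Function.Surjective r)
    (hρ : ρ.IsIrreducible) (h2 : 2 ≤ ℓ) {x : unitary (Cen R u τ)}
    (hx : x ∈ unitaryCongr (corner u hs)) (hx1 : ρ x ≠ 1) : Module.finrank ℂ V = q ^ ℓ := by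
  have h2A : IsUnit (2 : Cen R u τ) := isUnit_two hR.isUnit_two
  obtain ⟨ψ, hψ, hψ'⟩ := hR.exists_primitive
  obtain ⟨h, m, hhm, h0, h1, h3⟩ : ∃ h m, h + m = ℓ ∧ 0 < h ∧ h ≤ m ∧ m ≤ 2 * h :=
    ⟨ℓ / 2, ℓ - ℓ / 2, by omega, by omega, by omega, by omega⟩
  have hp := heisPair (u := u) (τ := τ) hR hhm h1 h3
  have hle : corner u hs ≤ multiples (π ^ m) :=
    corner_le_offDiag.trans (offDiag_le_multiples (pow_dvd_pow _ (by omega)))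
  obtain ⟨χ, hχ, hχ1⟩ := exists_weight_apply_ne_one (ρ := ρ)
    (K := unitaryCongr (multiples (π ^ m)))
    (fun y hy z hz => by rw [commute_iff_eq, ← map_mul, ← map_mul, hp.mul_comm_of_mem hy hz])
    (unitaryCongr_mono hle hx) hx1
  have key := finrank_mul_of_regular hR r hr hτ hu hrs hψ hψ' hρ hhm h0 h1 h3 hχ
    (N := q ^ (3 * ℓ - 2) * Nat.card (unitary (QuadraticAlgebra k (r u) 0)) ^ 2)
    (fun Λ hΛ μ hμ => by
      have hslope : IsUnit (μ.slope τ) := by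
        refine hR.isUnit_of_not_dvd fun hd => hχ1 ?_
        have hγ : π ∣ μ.γ := by
          have := hd.add (((hr τ).1 hτ).mul_left μ.κ)
          rwa [Functional.slope, sub_add_cancel] at this
        obtain ⟨X, hX, hXc, rfl⟩ := hp.exists_expU_of_le h2A hle hx
        rw [hΛ X hX, hμ _ X.2.2, eval_of_mem_offDiag μ (corner_le_offDiag hXc), hXc.2.2.1,
          hXc.2.2.2.1, mul_pow_pred_eq_zero hR hγ hXc.2.2.2.2]
        simp
      exact ⟨Or.inr (Or.inr hslope), card_centralizer_of_isUnit hR r hr hτ hu hrs hslope⟩)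
  have hq : 0 < q := zero_lt_one.trans hR.one_lt
  have hn : 0 < Nat.card (unitary (QuadraticAlgebra k (r u) 0)) := Nat.card_pos
  refine Nat.eq_of_mul_eq_mul_right
    (Nat.mul_pos (Nat.pow_pos hq (n := 3 * ℓ - 2)) (Nat.pow_pos hn (n := 2))) (key.trans ?_)
  rw [← mul_assoc, ← pow_add]
  congr 2
  omega

include hR hr hτ in
/-- At level `ℓ ≥ 2`, the representations which are trivial on the corner subgroup, but not on the
off-diagonal subgroup, have dimension `q ^ (ℓ - 1)` times the number of norm one elements. -/
theorem finrank_eq_of_offDiag [Finite R] [Finite k] (hu : IsUnit u) (hrs : Function.Surjective r)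
    (hρ : ρ.IsIrreducible) (h2 : 2 ≤ ℓ) (hc : ∀ x ∈ unitaryCongr (corner u hs), ρ x = 1)
    {x : unitary (Cen R u τ)} (hx : x ∈ unitaryCongr (offDiag u hs)) (hx1 : ρ x ≠ 1) :
    Module.finrank ℂ V =
      q ^ (ℓ - 1) * Nat.card (unitary (QuadraticAlgebra k (r u) 0)) := by
  have h2A : IsUnit (2 : Cen R u τ) := isUnit_two hR.isUnit_two
  obtain ⟨ψ, hψ, hψ'⟩ := hR.exists_primitive
  obtain ⟨h, m, hhm, h0, h1, h3⟩ : ∃ h m, h + m = ℓ ∧ 0 < h ∧ h ≤ m ∧ m ≤ 2 * h :=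
    ⟨ℓ / 2, ℓ - ℓ / 2, by omega, by omega, by omega, by omega⟩
  have hp := heisPair (u := u) (τ := τ) hR hhm h1 h3
  have hle : offDiag u hs ≤ multiples (π ^ m) := offDiag_le_multiples (pow_dvd_pow _ (by omega))
  obtain ⟨χ, hχ, hχ1⟩ := exists_weight_apply_ne_one (ρ := ρ)
    (K := unitaryCongr (multiples (π ^ m)))
    (fun y hy z hz => by rw [commute_iff_eq, ← map_mul, ← map_mul, hp.mul_comm_of_mem hy hz])
    (unitaryCongr_mono hle hx) hx1
  have key := finrank_mul_of_regular hR r hr hτ hu hrs hψ hψ' hρ hhm h0 h1 h3 hχ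
    (N := q ^ (3 * ℓ - 1) * Nat.card (unitary (QuadraticAlgebra k (r u) 0)))
    (fun Λ hΛ μ hμ => by
      have hγ : π ∣ μ.γ := by
        have : π ^ (ℓ - 1) * μ.γ = 0 := by
          refine hψ _ fun t => ?_
          have hXc : (skewOf 0 (π ^ (ℓ - 1) * t) 0 : Cen R u τ) ∈ corner u hs :=
            skewOf_mem_corner.2 ⟨rfl, dvd_mul_right _ _, rfl⟩
          have hX := hle (corner_le_offDiag hXc)
          have h4 := hΛ ⟨_, hp.le hX, star_skewOf _ _ _⟩ hX
          rw [weight_eq_one hχ (hp.expU_mem_iff_of_mem hX)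
            (hc _ (hp.expU_mem_of_le (corner_le_offDiag.trans hle) hXc)),
            hμ _ (star_skewOf _ _ _), eval_of_mem_offDiag μ (corner_le_offDiag hXc)] at h4
          rw [h4]
          congr 1
          simp [skewOf]
          ring
        have := (hR.mul_eq_zero_iff (i := ℓ - 1) (j := 1) (by omega)).1 this
        rwa [pow_one] at this
      have hslope : π ∣ μ.slope τ := hγ.sub (((hr τ).1 hτ).mul_left μ.κ)
      have hβ : IsUnit μ.β.im ∨ IsUnit μ.β.re := by
        by_contra! hcon
        have hre : π ∣ μ.β.re := (hR.isUnit_or_dvd _).resolve_left hcon.2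
        have him : π ∣ μ.β.im := (hR.isUnit_or_dvd _).resolve_left hcon.1
        refine hχ1 ?_
        obtain ⟨X, hX, hXc, rfl⟩ := hp.exists_expU_of_le h2A hle hx
        rw [hΛ X hX, hμ _ X.2.2, eval_of_mem_offDiag μ hXc,
          mul_pow_pred_eq_zero hR hγ hXc.2.2.1, mul_pow_pred_eq_zero' hR hre him hXc.2.2.2.1,
          mul_pow_pred_eq_zero' hR (by simpa using hre) (by simpa using him) hXc.2.2.2.2]
        simp
      exact ⟨hβ.elim Or.inl (Or.inr ∘ Or.inl),
        card_centralizer_of_dvd hR r hr hτ hu hrs hslope hβ⟩)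
  have hq : 0 < q := zero_lt_one.trans hR.one_lt
  have hn : 0 < Nat.card (unitary (QuadraticAlgebra k (r u) 0)) := Nat.card_pos
  refine Nat.eq_of_mul_eq_mul_right
    (Nat.mul_pos (Nat.pow_pos hq (n := 3 * ℓ - 1)) hn) (key.trans ?_)
  have e : q ^ (4 * ℓ - 2) = q ^ (ℓ - 1) * q ^ (3 * ℓ - 1) := by
    rw [← pow_add]
    congr 1
    omega
  rw [e]
  ring

end Truncated

end Cen

/-! ### Dimensions at level one -/

namespace Cen

open HeisPair Representation

variable {R : Type*} [CommRing R] {u τ : R}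

local notation "S" => QuadraticAlgebra R u 0

/-- For `τ = 0`, products of off-diagonal elements lie in the corner. -/
theorem heisPair_offDiag (hτ : τ = 0) {s : R} (hs : s * τ = 0) :
    HeisPair (offDiag u hs) (corner u hs) where
  le := corner_le_offDiag
  mul_mem := by
    rintro X Y ⟨h1, h2, h3, h4, h5⟩ ⟨h1', h2', h3', h4', h5'⟩
    subst hτ
    refine ⟨by simp [h1], by simp [h2], by simp [h1, h2'], by simp [h1', h2], ?_⟩
    simpa [h1, h1'] using h4.mul_right _
  mul_eq_zero := by
    rintro X Y ⟨h1, h2, h3, h4, h5⟩ ⟨h1', h2', h3', h4', h5'⟩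
    subst hτ
    ext1 <;> simp [h1, h1', h2, h2', h3', h4']
  mul_eq_zero' := by
    rintro X Y ⟨h1, h2, h3, h4, h5⟩ ⟨h1', h2', h3', h4', h5'⟩
    subst hτ
    ext1 <;> simp [h1, h1', h2, h2', h3', h4']

/-- The diagonal elements. -/
def diagonal (R : Type*) [CommRing R] (u τ : R) : Subring (Cen R u τ) where
  carrier := {X | X.c = 0 ∧ X.b = 0 ∧ X.e = 0}
  one_mem' := by simp
  zero_mem' := by simp
  mul_mem' := by
    rintro X Y ⟨h1, h2, h3⟩ ⟨h1', h2', h3'⟩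
    exact ⟨by simp [h1, h1', h2], by simp [h2, h2'], by simp [h3, h3']⟩
  add_mem' := by
    rintro X Y ⟨h1, h2, h3⟩ ⟨h1', h2', h3'⟩
    exact ⟨by simp [h1, h1'], by simp [h2, h2'], by simp [h3, h3']⟩
  neg_mem' := by
    rintro X ⟨h1, h2, h3⟩
    exact ⟨by simp [h1], by simp [h2], by simp [h3]⟩

theorem star_mem_diagonal {X : Cen R u τ} (hX : X ∈ diagonal R u τ) :
    star X ∈ diagonal R u τ := by
  obtain ⟨h1, h2, h3⟩ := hX
  exact ⟨by simp [h1], by simp [h3], by simp [h2]⟩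

/-- The elements with `a = d`, for `τ = 0`. -/
def equalDiag (R : Type*) [CommRing R] (u : R) : Subring (Cen R u 0) where
  carrier := {X | X.a = X.d}
  one_mem' := rfl
  zero_mem' := rfl
  mul_mem' := by
    intro X Y hX hY
    rw [Set.mem_ofPred_eq] at *
    simp [hX, hY]
  add_mem' := by
    intro X Y hX hY
    rw [Set.mem_ofPred_eq] at *
    simp [hX, hY]
  neg_mem' := by
    intro X hX
    rw [Set.mem_ofPred_eq] at *
    simp [hX]

theorem star_mem_equalDiag {X : Cen R u 0} (hX : X ∈ equalDiag R u) : star X ∈ equalDiag R u :=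
  congrArg star hX

section

variable (g : unitary (Cen R u 0))

theorem a_mul_star : (g : Cen R u 0).a * star (g : Cen R u 0).a = 1 :=
  congrArg Cen.a (Unitary.mul_star_self_of_mem g.2)

theorem d_mul_star : (g : Cen R u 0).d * star (g : Cen R u 0).d = 1 := by
  have := congrArg Cen.d (Unitary.mul_star_self_of_mem g.2)
  rw [mul_d, star_d, map_zero, zero_mul, zero_mul, add_zero] at this
  exact this

theorem b_mul_star : (g : Cen R u 0).a * star (g : Cen R u 0).e +
    (g : Cen R u 0).b * star (g : Cen R u 0).d = 0 := by
  have := congrArg Cen.b (Unitary.mul_star_self_of_mem g.2)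
  rw [mul_b, star_b, star_d, map_zero, zero_mul, add_zero] at this
  exact this

/-- The diagonal part of a unitary element. -/
def diagPart : unitary (Cen R u 0) :=
  ⟨⟨(g : Cen R u 0).a, 0, 0, 0, (g : Cen R u 0).d⟩, Unitary.mem_iff.2 (by
    have h1 := a_mul_star g
    have h2 := d_mul_star g
    constructor
    · ext1 <;> simp [mul_comm (star _), h1, h2]
    · ext1 <;> simp [h1, h2])⟩

variable {s : R} {hs : s * 0 = 0} (h1 : s = 1)

include h1 in
theorem mem_offDiag_of_eq_one {X : Cen R u 0} : X ∈ offDiag u hs ↔ X.a = 0 ∧ X.d = 0 := by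
  subst h1
  simp [mem_offDiag]

include h1 in
theorem mem_corner_of_eq_one {X : Cen R u 0} :
    X ∈ corner u hs ↔ X.a = 0 ∧ X.d = 0 ∧ X.b = 0 ∧ X.e = 0 := by
  subst h1
  simp [mem_corner]

include h1 in
theorem mem_unitaryCongr_offDiag {g : unitary (Cen R u 0)} :
    g ∈ unitaryCongr (offDiag u hs) ↔ (g : Cen R u 0).a = 1 ∧ (g : Cen R u 0).d = 1 := by
  rw [mem_unitaryCongr, mem_offDiag_of_eq_one h1]
  simp [sub_eq_zero]

include h1 in
theorem mem_unitaryCongr_corner {g : unitary (Cen R u 0)} :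
    g ∈ unitaryCongr (corner u hs) ↔ (g : Cen R u 0).a = 1 ∧ (g : Cen R u 0).d = 1 ∧
      (g : Cen R u 0).b = 0 ∧ (g : Cen R u 0).e = 0 := by
  rw [mem_unitaryCongr, mem_corner_of_eq_one h1]
  simp [sub_eq_zero]

include h1 in
/-- Off-diagonal unitary elements with the same coordinate `b` differ by a corner element. -/
theorem mul_inv_mem_corner {g g' : unitary (Cen R u 0)} (hg : g ∈ unitaryCongr (offDiag u hs))
    (hg' : g' ∈ unitaryCongr (offDiag u hs)) (hb : (g : Cen R u 0).b = (g' : Cen R u 0).b) :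
    g * g'⁻¹ ∈ unitaryCongr (corner u hs) := by
  have he : ∀ g : unitary (Cen R u 0), g ∈ unitaryCongr (offDiag u hs) →
      (g : Cen R u 0).e = -star (g : Cen R u 0).b := by
    intro g hg
    obtain ⟨h2, h3⟩ := (mem_unitaryCongr_offDiag h1).1 hg
    have := b_mul_star g
    rw [h2, h3] at this
    simp only [one_mul, star_one, mul_one] at this
    have h4 := congrArg star this
    rw [star_add, star_star, star_zero] at h4
    exact eq_neg_of_add_eq_zero_left h4
  have hmem : (g : Cen R u 0) - g' ∈ corner u hs := by
    rw [mem_corner_of_eq_one h1]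
    rw [mem_unitaryCongr_offDiag h1] at *
    simp [he g ((mem_unitaryCongr_offDiag h1).2 hg), he g' ((mem_unitaryCongr_offDiag h1).2 hg'),
      hg.1, hg.2, hg'.1, hg'.2, hb]
  have : ((g * g'⁻¹ : unitary (Cen R u 0)) : Cen R u 0) - 1 = (g - g') * star (g' : Cen R u 0) := by
    rw [Submonoid.coe_mul, coe_inv_unitary, sub_mul,
      Unitary.mul_star_self_of_mem (Subtype.prop g')]
  rw [mem_unitaryCongr, this]
  exact Ideal.mul_mem_right _ _ hmem

end

section LevelOne

variable {π : R} {q : ℕ} (hR : IsTruncated π 1 q) {s : R} {hs : s * 0 = 0} (h1 : s = 1)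
  {k : Type*} [CommRing k] (r : R →+* k) (hr : ∀ x, r x = 0 ↔ π ∣ x)
  {V : Type*} [AddCommGroup V] [Module ℂ V] [FiniteDimensional ℂ V]
  {ρ : Representation ℂ (unitary (Cen R u 0)) V}

include hR in
theorem isUnit_of_ne_zero {x : R} (hx : x ≠ 0) : IsUnit x := by
  refine hR.isUnit_of_not_dvd fun hd => hx ?_
  have := hR.pow_eq_zero
  rw [pow_one] at this
  rwa [this, zero_dvd_iff] at hd

include h1 in
/-- At level one, the representations which are trivial on the off-diagonal subgroup are
one-dimensional. -/
theorem finrank_eq_one_of_offDiag (hρ : ρ.IsIrreducible)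
    (hc : ∀ x ∈ unitaryCongr (offDiag u hs), ρ x = 1) : Module.finrank ℂ V = 1 := by
  refine hρ.finrank_eq_one fun g g' => ?_
  have hw : (g * g') * (g' * g)⁻¹ ∈ unitaryCongr (offDiag u hs) := by
    have hm : (g : Cen R u 0) * g' - g' * g ∈ offDiag u hs := by
      rw [mem_offDiag_of_eq_one h1]
      simp [mul_comm]
    have : (((g * g') * (g' * g)⁻¹ : unitary (Cen R u 0)) : Cen R u 0) - 1 =
        (g * g' - g' * g) * star ((g' * g : unitary (Cen R u 0)) : Cen R u 0) := by
      rw [Submonoid.coe_mul, coe_inv_unitary, sub_mul, ← Submonoid.coe_mul, ← Submonoid.coe_mul,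
        Unitary.mul_star_self_of_mem (Subtype.prop (g' * g))]
    rw [mem_unitaryCongr, this]
    exact Ideal.mul_mem_right _ _ hm
  rw [commute_iff_eq, ← map_mul, ← map_mul, ← inv_mul_cancel_right (g * g') (g' * g), map_mul,
    hc _ hw, one_mul]

include h1 hR in
/-- At level one, the representations which are nontrivial on the corner subgroup have
dimension `q`. -/
theorem finrank_eq_of_corner_one [Finite R] (hρ : ρ.IsIrreducible)
    (hH : Nat.card (unitaryCongr (offDiag u hs)) = q ^ 3)
    (hN : Nat.card (unitaryCongr (corner u hs)) = q) {x : unitary (Cen R u 0)}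
    (hx : x ∈ unitaryCongr (corner u hs)) (hx1 : ρ x ≠ 1) : Module.finrank ℂ V = q := by
  have h2A : IsUnit (2 : Cen R u 0) := isUnit_two hR.isUnit_two
  have hp : HeisPair (offDiag u hs) (corner u hs) := heisPair_offDiag rfl hs
  have hcentral : ∀ y ∈ unitaryCongr (corner u hs), ∀ g : unitary (Cen R u 0), g * y = y * g := by
    intro y hy g
    rw [mem_unitaryCongr_corner h1] at hy
    apply Subtype.ext
    ext1 <;> simp [hy.1, hy.2.1, hy.2.2.1, hy.2.2.2]
    ring
  have hscal : ∀ y ∈ unitaryCongr (corner u hs), ∃ c : ℂ, ρ y = c • 1 := fun y hy =>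
    hρ.exists_eq_smul_one _ fun g => by
      rw [commute_iff_eq, ← map_mul, ← map_mul, hcentral y hy g]
  have key := hρ.finrank_sq_mul_card (unitaryCongr (offDiag u hs))
    (unitaryIn (diagonal R u 0) fun _ => star_mem_diagonal) (unitaryCongr (corner u hs))
    (unitaryCongr_mono corner_le_offDiag) (fun y hy z hz => ?_) (fun g => ?_) hscal
    (fun h hh hhR => ?_) (fun t ht h hh hth => ?_)
  · have hq : 0 < q := zero_lt_one.trans hR.one_lt
    rw [hH, hN, pow_succ] at key
    have := Nat.eq_of_mul_eq_mul_right hq key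
    exact Nat.pow_left_injective two_ne_zero this
  · obtain ⟨hy1, hy2, hy3⟩ := hy
    obtain ⟨hz1, hz2, hz3⟩ := hz
    apply Subtype.ext
    ext1 <;> simp [hy1, hy2, hy3, hz1, hz2, hz3, mul_comm]
  · refine ⟨g * (diagPart g)⁻¹, ?_, diagPart g, ⟨rfl, rfl, rfl⟩, by group⟩
    rw [mem_unitaryCongr_offDiag h1, Submonoid.coe_mul, coe_inv_unitary]
    have e1 := a_mul_star g
    have e2 := d_mul_star g
    constructor <;> simp [diagPart, e1, e2]
  · -- the commutator form on the off-diagonal subgroup is nondegenerate modulo the corner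
    obtain ⟨X, rfl⟩ := hp.exists_expU h2A hh
    obtain ⟨Z, hZ, hZc, rfl⟩ := hp.exists_expU_of_le h2A le_rfl hx
    have hXa := X.2.1.1
    have hXd := X.2.1.2.1
    have hXe : (X : Cen R u 0).e = -star (X : Cen R u 0).b := by
      have := congrArg Cen.e X.2.2
      rw [star_e, neg_e] at this
      rw [this, neg_neg]
    have hXb : (X : Cen R u 0).b ≠ 0 := by
      intro h0
      refine hhR (hp.expU_mem_of_le le_rfl ((mem_corner_of_eq_one h1).2 ⟨hXa, hXd, h0, ?_⟩))
      rw [hXe, h0, star_zero, neg_zero]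
    obtain ⟨p, p', hpp⟩ : ∃ p p' : R,
        4 * (p' * (X : Cen R u 0).b.re - p * (X : Cen R u 0).b.im) = (Z : Cen R u 0).c.im := by
      have h4 : IsUnit (4 : R) := by
        have := hR.isUnit_two.mul hR.isUnit_two
        norm_num at this
        exact this
      obtain ⟨c, hc⟩ := h4.exists_left_inv
      by_cases h0 : (X : Cen R u 0).b.re = 0
      · have h0' : (X : Cen R u 0).b.im ≠ 0 := fun h => hXb (by ext <;> simp [h0, h])
        obtain ⟨t, ht⟩ := (isUnit_of_ne_zero hR h0').exists_left_inv
        refine ⟨-(c * t * (Z : Cen R u 0).c.im), 0, ?_⟩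
        linear_combination ((Z : Cen R u 0).c.im * 4 * c) * ht + (Z : Cen R u 0).c.im * hc
      · obtain ⟨t, ht⟩ := (isUnit_of_ne_zero hR h0).exists_left_inv
        refine ⟨0, c * t * (Z : Cen R u 0).c.im, ?_⟩
        linear_combination ((Z : Cen R u 0).c.im * 4 * c) * ht + (Z : Cen R u 0).c.im * hc
    let Y : skewIn (offDiag u hs) := ⟨skewOf 0 0 (p, p', 0),
      (mem_offDiag_of_eq_one h1).2 ⟨rfl, by ext <;> simp [skewOf]⟩, star_skewOf _ _ _⟩
    obtain ⟨c, hc⟩ := hscal _ hx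
    refine ⟨hp.expU Y, hp.expU_mem Y, c, fun h => hx1 (by rw [hc, h, one_smul]), ?_⟩
    rw [← hc, expU_commutator]
    congr 2
    apply Subtype.ext
    have hZs := exists_skewOf hR.isUnit_two Z.2.2
    obtain ⟨hZ1, hZ2, hZ3, hZ4, -⟩ := hZc
    have hZre : (Z : Cen R u 0).c.re = 0 := by rw [hZs]; rfl
    change ((X : Cen R u 0) * Y - Y * X) + (X * Y - Y * X) = Z
    ext <;> simp [Y, skewOf, hXa, hXd, hXe, hZ1, hZ2, hZ3, hZ4, hZre]
    · ring
    · rw [← hpp]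
      ring
  · -- `t h t⁻¹ = w h` with `w` in the corner forces `w = 1`
    obtain ⟨ht1, ht2, ht3⟩ := ht
    obtain ⟨w, hw⟩ : ∃ w, w = t * h * t⁻¹ * h⁻¹ := ⟨_, rfl⟩
    have hwe : w * h * t = t * h := by rw [hw]; group
    rw [← hw] at hth ⊢
    rw [mem_unitaryCongr_corner h1] at hth
    rw [mem_unitaryCongr_offDiag h1] at hh
    have hc := congrArg (fun g : unitary (Cen R u 0) => (g : Cen R u 0).c) hwe
    simp [hth.1, hth.2.2.1, hh.1, ht1, ht2, ht3] at hc
    have ha := a_mul_star t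
    have hwc : (w : Cen R u 0).c = 0 := by
      linear_combination (star (t : Cen R u 0).a) * hc - (w : Cen R u 0).c * ha
    have : w = 1 := by
      apply Subtype.ext
      ext1 <;> simp [hth.1, hth.2.1, hth.2.2.1, hth.2.2.2, hwc]
    rw [this, map_one]

include hR in
/-- A norm one element different from `1` differs from `1` by a unit. -/
theorem isUnit_sub_one (hu : IsUnit u) {z : S} (hz : z * star z = 1) (hz1 : z ≠ 1) :
    IsUnit (z - 1) := by
  have hnt := hR.nontrivial
  rw [QuadraticAlgebra.isUnit_iff_norm_isUnit]
  have e1 := congrArg QuadraticAlgebra.re hz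
  simp [QuadraticAlgebra.re_one] at e1
  have e2 : QuadraticAlgebra.norm (z - 1) = 2 * (1 - z.re) := by
    rw [QuadraticAlgebra.norm_def]
    simp [QuadraticAlgebra.re_one, QuadraticAlgebra.im_one]
    linear_combination e1
  rw [e2]
  refine hR.isUnit_two.mul (isUnit_of_ne_zero hR fun h => hz1 ?_)
  have hre : z.re = 1 := (sub_eq_zero.1 h).symm
  ext
  · exact hre
  · by_contra him
    have hi := isUnit_of_ne_zero hR him
    have : u * (z.im * z.im) = 0 := by
      rw [hre] at e1
      linear_combination -e1
    exact not_isUnit_zero (this ▸ hu.mul (hi.mul hi))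

include hR hr in
/-- Here the diagonal over the residue field takes its values in the diagonal copy of the norm one
group. -/
theorem card_equalDiag [Finite R] (hrs : Function.Surjective r) :
    Nat.card (unitaryIn (equalDiag R u) fun _ => star_mem_equalDiag) =
      q ^ 3 * Nat.card (unitary (QuadraticAlgebra k (r u) 0)) := by
  have hπ : π = 0 := by simpa using hR.pow_eq_zero
  rw [card_unitaryIn (isUnit_two hR.isUnit_two) (resid r (map_zero r))
    (resid_star (u := u) r (map_zero r))
    (fun x hx => isNilpotent_of_resid r (map_zero r) hr ⟨1, hR.pow_eq_zero⟩ hx)]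
  congr 1
  · rw [card_skew_eq hR.isUnit_two _ (fun x => π ^ 1 ∣ x) (fun x => π ^ 0 ∣ x)
      (fun v => π ^ 0 ∣ v.1 ∧ π ^ 0 ∣ v.2.1 ∧ π ^ 1 ∣ v.2.2) (fun x y v => by
        rw [resid_skewOf r hr]
        change (⟨0, x⟩ : S) = ⟨0, x + 0 * y - v.2.2⟩ ∧ _ ↔ _
        simp only [hπ, zero_dvd_iff, pow_one, pow_zero, isUnit_one.dvd, true_and, zero_mul,
          add_zero]
        refine ⟨fun h => h.2, fun h => ⟨by rw [h.2, sub_zero], h⟩⟩),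
      hR.card_dvd 1 0 rfl, hR.card_dvd 0 1 rfl,
      Nat.card_congr (Equiv.subtypeProdEquivProd (p := fun x => π ^ 0 ∣ x)
      (q := fun v : R × R => π ^ 0 ∣ v.1 ∧ π ^ 1 ∣ v.2)), Nat.card_prod,
      Nat.card_congr (Equiv.subtypeProdEquivProd (p := fun x => π ^ 0 ∣ x)
      (q := fun x => π ^ 1 ∣ x)), Nat.card_prod, hR.card_dvd 1 0 rfl, hR.card_dvd 0 1 rfl]
    ring
  · refine Nat.card_congr ⟨fun y => ⟨y.1.1.1, ?_⟩, fun y => ⟨⟨(y, y), ?_⟩, ?_⟩, ?_, fun _ => rfl⟩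
    · have := Unitary.mem_iff.1 y.1.2
      exact Unitary.mem_iff.2 ⟨congrArg Prod.fst this.1, congrArg Prod.fst this.2⟩
    · have h1 := Unitary.mem_iff.1 y.2
      exact Unitary.mem_iff.2 ⟨Prod.ext h1.1 h1.1, Prod.ext h1.2 h1.2⟩
    · obtain ⟨y, hy⟩ := y
      obtain ⟨a, rfl⟩ := quadMap_surjective r rfl hrs y
      exact ⟨scalar a, rfl, rfl⟩
    · rintro ⟨⟨⟨y, z⟩, hyz⟩, Y, hY, h⟩
      refine Subtype.ext (Subtype.ext (Prod.ext rfl ?_))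
      change y = z
      have e1 : quadMap r rfl Y.a = y := congrArg Prod.fst h
      have e2 : quadMap r rfl Y.d = z := congrArg Prod.snd h
      rw [← e1, ← e2]
      exact congrArg _ hY

include h1 hR hr in
/-- At level one, the representations which are trivial on the corner subgroup, but not on the
off-diagonal subgroup, have the number of norm one elements as dimension. -/
theorem finrank_eq_of_offDiag_one [Finite R] [Finite k] (hu : IsUnit u)
    (hrs : Function.Surjective r) (hρ : ρ.IsIrreducible)
    (hc : ∀ x ∈ unitaryCongr (corner u hs), ρ x = 1) {x : unitary (Cen R u 0)}
    (hx : x ∈ unitaryCongr (offDiag u hs)) (hx1 : ρ x ≠ 1) :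
    Module.finrank ℂ V = Nat.card (unitary (QuadraticAlgebra k (r u) 0)) := by
  have h2A : IsUnit (2 : Cen R u 0) := isUnit_two hR.isUnit_two
  have hp : HeisPair (offDiag u hs) (corner u hs) := heisPair_offDiag rfl hs
  set K := unitaryCongr (offDiag u hs) with hK
  have heq : ∀ y ∈ K, ∀ z ∈ K, ((y : Cen R u 0).b = (z : Cen R u 0).b) → ρ y = ρ z := by
    intro y hy z hz hyz
    rw [← inv_mul_cancel_right y z, map_mul, hc _ (mul_inv_mem_corner h1 hy hz hyz), one_mul]
  have hKmul : ∀ y ∈ K, ∀ z ∈ K, ((y * z : unitary (Cen R u 0)) : Cen R u 0).b =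
      (y : Cen R u 0).b + (z : Cen R u 0).b := by
    intro y hy z hz
    rw [hK, mem_unitaryCongr_offDiag h1] at hy hz
    simp [hy.1, hz.2, add_comm]
  obtain ⟨χ, hχ, hχ1⟩ := exists_weight_apply_ne_one (ρ := ρ) (K := K) (fun y hy z hz => by
    rw [commute_iff_eq, ← map_mul, ← map_mul]
    exact heq _ (mul_mem hy hz) _ (mul_mem hz hy)
      (by rw [hKmul y hy z hz, hKmul z hz y hy, add_comm]))
    hx hx1
  have hχeq : ∀ y ∈ K, ∀ z ∈ K, ((y : Cen R u 0).b = (z : Cen R u 0).b) → χ y = χ z := by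
    intro y hy z hz hyz
    obtain ⟨w, hw, hw0⟩ := Submodule.exists_mem_ne_zero_of_ne_bot hχ
    refine smul_left_injective ℂ hw0 ?_
    simp only
    rw [← hw y hy, ← hw z hz, heq y hy z hz hyz]
  have hconj : ∀ g : unitary (Cen R u 0), ∀ y ∈ K,
      ((g * y * g⁻¹ : unitary (Cen R u 0)) : Cen R u 0).b =
        (g : Cen R u 0).a * star (g : Cen R u 0).d * (y : Cen R u 0).b := by
    intro g y hy
    have e1 := b_mul_star g
    rw [hK, mem_unitaryCongr_offDiag h1] at hy
    simp [coe_inv_unitary, hy.1, hy.2]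
    linear_combination e1
  -- the stabiliser of the weight
  have hstab : charStab K χ = unitaryIn (equalDiag R u) fun _ => star_mem_equalDiag := by
    ext g
    rw [mem_charStab, mem_unitaryIn]
    have hKn : K.Normal := inferInstance
    constructor
    · -- `g` multiplies the coordinate `b` by `z = a star d`; if `z ≠ 1`, each element of `K` agrees
      -- modulo the corner with a commutator with `g`, so that `χ` would be trivial
      intro hg
      by_contra hne
      set z := (g : Cen R u 0).a * star (g : Cen R u 0).d with hz
      have hzz : z * star z = 1 := by
        rw [hz, star_mul, star_star]
        linear_combination ((g : Cen R u 0).d * star (g : Cen R u 0).d) * a_mul_star g +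
          d_mul_star g
      have hz1 : z ≠ 1 := fun h => hne (by
        change (g : Cen R u 0).a = (g : Cen R u 0).d
        linear_combination (g : Cen R u 0).d * h - (g : Cen R u 0).a * d_mul_star g)
      obtain ⟨c, hc'⟩ := ((hR.isUnit_two.map (algebraMap R S)).mul
        (isUnit_sub_one hR hu hzz hz1)).exists_left_inv
      rw [map_ofNat] at hc'
      set β := c * (x : Cen R u 0).b with hβ
      let X : skewIn (offDiag u hs) := ⟨skewOf 0 0 (β.re, β.im, 0),
        (mem_offDiag_of_eq_one h1).2 ⟨rfl, by ext <;> simp [skewOf]⟩, star_skewOf _ _ _⟩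
      have hXb : (hp.expU X : Cen R u 0).b = 2 * β := by
        have h0 := (hp.mul_mem X.2.1 X.2.1).2.2.1
        rw [coe_expU, two_mul, two_mul, two_mul, add_b, add_b, add_b, add_b, h0]
        simp [X, skewOf]
      have hXK := hp.expU_mem X
      have e1 := hg _ hXK
      rw [hχeq _ (hKn.conj_mem _ hXK g) (x * hp.expU X) (mul_mem hx hXK) (by
        rw [hconj g _ hXK, hKmul _ hx _ hXK, hXb, ← hz, hβ]
        linear_combination ((x : Cen R u 0).b) * hc'), weight_mul hχ hx hXK] at e1
      have e2 : χ (hp.expU X) ≠ 0 := by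
        intro h0
        have := weight_mul hχ hXK (inv_mem hXK)
        rw [mul_inv_cancel, weight_one hχ, h0, zero_mul] at this
        exact one_ne_zero this
      exact hχ1 (mul_right_cancel₀ e2 (by rw [e1, one_mul]))
    · intro hg y hy
      refine hχeq _ (hKn.conj_mem _ hy g) _ hy ?_
      have : (g : Cen R u 0).a = (g : Cen R u 0).d := hg
      rw [hconj g y hy, ← this, a_mul_star, one_mul]
  -- the stabiliser acts on the weight space by scalars
  have hone : Module.finrank ℂ (weightSpace ρ K χ) = 1 := by
    have hscal : ∀ g : charStab K χ, ∃ c : ℂ, weightRep ρ K χ g = c • 1 := by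
      intro g
      have hg : (g : unitary (Cen R u 0)) ∈ unitaryIn (equalDiag R u) fun _ => star_mem_equalDiag :=
        hstab ▸ g.2
      have hgd : ((g : unitary (Cen R u 0)) : Cen R u 0).a =
        ((g : unitary (Cen R u 0)) : Cen R u 0).d := hg
      have hga := a_mul_star (g : unitary (Cen R u 0))
      let z : unitary (Cen R u 0) := ⟨scalar ((g : unitary (Cen R u 0)) : Cen R u 0).a,
        Unitary.mem_iff.2 ⟨by ext1 <;> simp [mul_comm (star _), hga], by ext1 <;> simp [hga]⟩⟩
      have hz : ∀ t, t * z = z * t := fun t => Subtype.ext (scalar_comm _ _)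
      obtain ⟨c, hcz⟩ := hρ.exists_eq_smul_one (ρ z) fun t => by
        rw [commute_iff_eq, ← map_mul, ← map_mul, hz]
      have hh : z⁻¹ * g ∈ K := by
        refine (mem_unitaryCongr_offDiag h1).2 ?_
        rw [Submonoid.coe_mul, coe_inv_unitary]
        simp [z, ← hgd, mul_comm (star _), hga]
      refine ⟨c * χ (z⁻¹ * g), ?_⟩
      ext w
      have e : (g : unitary (Cen R u 0)) = z * (z⁻¹ * g) := by group
      rw [coe_weightRep_apply, e, map_mul, hcz, Module.End.mul_apply, w.2 _ hh]
      simp [smul_smul, mul_comm]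
    refine (hρ.weightRep hχ).finrank_eq_one fun g g' => ?_
    obtain ⟨c, hc⟩ := hscal g
    obtain ⟨c', hc'⟩ := hscal g'
    rw [hc, hc']
    exact ((Commute.one_left _).smul_left _).smul_right _
  have key := hρ.card_charStab_mul_finrank hχ
  rw [hstab, card_equalDiag hR r hr hrs, hone, card_unitary hR r hr (map_zero r) hrs] at key
  have hq : 0 < q := zero_lt_one.trans hR.one_lt
  have hn : 0 < Nat.card (unitary (QuadraticAlgebra k (r u) 0)) := Nat.card_pos
  refine Nat.eq_of_mul_eq_mul_left (Nat.mul_pos (Nat.pow_pos hq (n := 3)) hn) (key.trans ?_)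
  ring

end LevelOne

end Cen

/-! ### Zeta functions and chains of normal subgroups -/

namespace Irr

variable {G : Type*} [Group G] [Finite G] {M : Type*} [AddCommMonoid M]

omit [Finite G] in
theorem smul_one_injective (x : Irr G) :
    Function.Injective fun c : ℂ => c • (1 : Module.End ℂ (Fin x.dim → ℂ)) := by
  have := x.isIrreducible_rep.nontrivial
  intro c c' h
  obtain ⟨v, hv⟩ := exists_ne (0 : Fin x.dim → ℂ)
  exact smul_left_injective ℂ hv (LinearMap.congr_fun h v)

open Classical in
/-- Let `T / K` be central in `G / K`, and let `ν` restrict to a homomorphism of `T` with kernel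
`K`. Then `T` acts by scalars in the irreducible representations which are trivial on `K`, and these
scalars are given by linear characters of `G`. Hence twisting identifies the representations which
are trivial on `K` with pairs of a character of `T / K` and a representation which is trivial
on `T`. -/
theorem sum_trivialOn_eq_smul {A : Type*} [CommGroup A] [Finite A] (ν : G →* A)
    {K T : Subgroup G} (hKT : K ≤ T) (hK : ∀ t ∈ T, ν t = 1 ↔ t ∈ K)
    (hcomm : ∀ g, ∀ t ∈ T, g * t * g⁻¹ * t⁻¹ ∈ K) {n : ℕ} (hn : Nat.card T = n * Nat.card K)
    (F : ℕ → M) :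
    ∑ x : Irr G with x.TrivialOn K, F x.dim = n • ∑ x : Irr G with x.TrivialOn T, F x.dim := by
  set f := ν.comp T.subtype with hf
  have hker : Nat.card f.ker = Nat.card K := by
    refine Nat.card_congr ⟨fun t => ⟨t.1, (hK _ t.1.2).1 t.2⟩,
      fun t => ⟨⟨t, hKT t.2⟩, (hK _ (hKT t.2)).2 t.2⟩, fun _ => rfl, fun _ => rfl⟩
  have hrange : Nat.card f.range = n := by
    have h1 := f.ker.card_eq_card_quotient_mul_card_subgroup
    rw [Nat.card_congr (QuotientGroup.quotientKerEquivRange f).toEquiv, hn, hker] at h1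
    exact (Nat.eq_of_mul_eq_mul_right Nat.card_pos h1).symm
  -- the characters of `T / K ≃ f.range` extend to `A`, and give linear characters of `G` via `ν`
  have hext : ∀ φ : f.range →* ℂˣ, ∃ φ' : A →* ℂˣ, MonoidHom.domRestrictHom f.range ℂˣ φ' = φ :=
    fun φ => MonoidHom.domRestrict_surjective ℂ f.range φ
  choose ext hext using hext
  have hext' : ∀ (φ : f.range →* ℂˣ) (t : T), ext φ (ν t) = φ ⟨f t, t, rfl⟩ := fun φ t => by
    conv_rhs => rw [← hext φ]
    rfl
  have hfin : Finite (f.range →* ℂˣ) := Nat.finite_of_card_ne_zero (by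
    rw [CommGroup.card_monoidHom_of_hasEnoughRootsOfUnity]
    exact Nat.card_pos.ne')
  have := Fintype.ofFinite (f.range →* ℂˣ)
  have hcard : n = (Finset.univ : Finset (f.range →* ℂˣ)).card := by
    rw [Finset.card_univ, ← Nat.card_eq_fintype_card,
      CommGroup.card_monoidHom_of_hasEnoughRootsOfUnity, hrange]
  rw [hcard, ← Finset.sum_const, ← Finset.sum_product']
  -- the twist of a representation which is trivial on `T` acts on `T` through the character
  have hval : ∀ (φ : f.range →* ℂˣ) (y : Irr G) (c : ℂ), y.TrivialOn T → ∀ t : T,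
      ((y.twist ((ext φ).comp ν)).rep t = c • 1 ↔ c = φ ⟨f t, t, rfl⟩) := by
    intro φ y c hy t
    rw [twist_rep_eq_smul_one_iff, hy _ t.2, MonoidHom.comp_apply, hext']
    constructor
    · intro h
      have h1 : ((φ ⟨f t, t, rfl⟩ : ℂ)⁻¹ * c) = 1 :=
        y.smul_one_injective (by simpa only [one_smul] using h.symm)
      rw [inv_mul_eq_iff_eq_mul₀ (Units.ne_zero _), mul_one] at h1
      exact h1
    · rintro rfl
      rw [inv_mul_cancel₀ (Units.ne_zero _), one_smul]
  symm
  refine Finset.sum_bij (fun p _ => p.2.twist ((ext p.1).comp ν)) ?_ ?_ ?_ ?_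
  · rintro ⟨φ, y⟩ hy
    have hy' : y.TrivialOn T := by simpa using hy
    rw [Finset.mem_filter_univ]
    intro g hg
    have h1 := (hval φ y 1 hy' ⟨g, hKT hg⟩).2 (by
      have : (⟨f ⟨g, hKT hg⟩, ⟨g, hKT hg⟩, rfl⟩ : f.range) = 1 :=
        Subtype.ext ((hK _ (hKT hg)).2 hg)
      rw [this, map_one, Units.val_one])
    rwa [one_smul] at h1
  · rintro ⟨φ, y⟩ hy ⟨φ', y'⟩ hy' h
    have hy1 : y.TrivialOn T := by simpa using hy
    have hy1' : y'.TrivialOn T := by simpa using hy'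
    have hφ : φ = φ' := by
      ext ⟨-, t, rfl⟩
      have h1 := (hval φ y _ hy1 t).2 rfl
      dsimp only at h
      rw [h, hval φ' y' _ hy1'] at h1
      exact h1
    subst hφ
    exact Prod.ext rfl ((twistEquiv ((ext φ).comp ν)).injective h)
  · intro x hx
    rw [Finset.mem_filter_univ] at hx
    have hnt := x.isIrreducible_rep.nontrivial
    -- conversely, `T` acts on `x` by scalars, which form a character of `T / K`; twisting back by
    -- its extension makes `x` trivial on `T`
    have hscal : ∀ t : T, ∃ c : ℂˣ, x.rep t = (c : ℂ) • 1 := by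
      intro t
      obtain ⟨c, hc⟩ := x.isIrreducible_rep.exists_eq_smul_one (x.rep t) fun g => by
        have h1 := hx _ (hcomm g t t.2)
        have h2 : g * t = g * t * g⁻¹ * (t : G)⁻¹ * (t * g) := by group
        rw [commute_iff_eq, ← map_mul, h2, map_mul, h1, one_mul, map_mul]
      refine ⟨Units.mk0 c ?_, hc⟩
      rintro rfl
      have h3 : x.rep ((t : G) * (t : G)⁻¹) = 0 := by
        rw [map_mul, hc, zero_smul, zero_mul]
      rw [mul_inv_cancel, map_one] at h3
      exact one_ne_zero h3
    choose χ hχ using hscal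
    have hinj : ∀ {a b : ℂˣ}, (a : ℂ) • (1 : Module.End ℂ (Fin x.dim → ℂ)) = (b : ℂ) • 1 → a = b :=
      fun h => Units.ext (x.smul_one_injective h)
    let χ' : T →* ℂˣ := MonoidHom.mk' χ fun s t => hinj (by
      rw [← hχ, Subgroup.coe_mul, map_mul, hχ, hχ, smul_mul_smul_comm, one_mul, Units.val_mul])
    have hχ' : f.ker ≤ χ'.ker := fun t ht => hinj (by
      refine (hχ t).symm.trans ?_
      rw [hx _ ((hK _ t.2).1 ht), Units.val_one, one_smul])
    let φ : f.range →* ℂˣ := (QuotientGroup.lift f.ker χ' hχ').comp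
      (QuotientGroup.quotientKerEquivRange f).symm.toMonoidHom
    have hφ : ∀ t : T, φ ⟨f t, t, rfl⟩ = χ t := fun t => by
      have : (QuotientGroup.quotientKerEquivRange f).symm ⟨f t, t, rfl⟩ = (t : T ⧸ f.ker) := by
        rw [MulEquiv.symm_apply_eq]
        rfl
      change QuotientGroup.lift f.ker χ' hχ'
        ((QuotientGroup.quotientKerEquivRange f).symm ⟨f t, t, rfl⟩) = χ t
      rw [this]
      rfl
    refine ⟨(φ, (twistEquiv ((ext φ).comp ν)).symm x), ?_,
      (twistEquiv ((ext φ).comp ν)).apply_symm_apply x⟩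
    rw [Finset.mem_product]
    refine ⟨Finset.mem_univ _, ?_⟩
    rw [Finset.mem_filter_univ]
    intro t ht
    have h1 := hχ ⟨t, ht⟩
    rw [← (twistEquiv ((ext φ).comp ν)).apply_symm_apply x] at h1
    have h2 := (twist_rep_eq_smul_one_iff ((ext φ).comp ν) _ t _).1 h1
    have h3 := hext' φ ⟨t, ht⟩
    rw [hφ] at h3
    rw [MonoidHom.comp_apply, h3, inv_mul_cancel₀ (Units.ne_zero _), one_smul] at h2
    exact h2
  · rintro ⟨φ, y⟩ -
    rw [dim_twist]

open Classical in
/-- Sorting the irreducible classes by the first member of the chain `N ≤ K` on which they are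
nontrivial. -/
theorem sum_filter_chain {N K : Subgroup G} (hNK : N ≤ K) {d e : ℕ}
    (hda : ∀ x : Irr G, ¬ x.TrivialOn N → x.dim = d)
    (hdb : ∀ x : Irr G, x.TrivialOn N → ¬ x.TrivialOn K → x.dim = e) (F : ℕ → M) :
    ∑ x : Irr G, F x.dim = ({x : Irr G | ¬ x.TrivialOn N} : Finset _).card • F d +
      ∑ x : Irr G with x.TrivialOn N, F x.dim ∧
    ∑ x : Irr G with x.TrivialOn N, F x.dim =
        ({x : Irr G | x.TrivialOn N ∧ ¬ x.TrivialOn K} : Finset _).card • F e +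
          ∑ x : Irr G with x.TrivialOn K, F x.dim := by
  constructor
  · rw [← Finset.sum_filter_not_add_sum_filter Finset.univ (fun x : Irr G => x.TrivialOn N)]
    congr 1
    rw [← Finset.sum_const]
    exact Finset.sum_congr rfl fun x hx => by rw [hda x (by simpa using hx)]
  · rw [← Finset.sum_filter_not_add_sum_filter _ (fun x : Irr G => x.TrivialOn K),
      Finset.filter_filter, Finset.filter_filter, ← Finset.sum_const]
    congr 1
    · refine Finset.sum_congr rfl fun x hx => ?_
      rw [Finset.mem_filter_univ] at hx
      rw [hdb x hx.1 hx.2]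
    · refine Finset.sum_congr (Finset.filter_congr fun x _ => ?_) fun _ _ => rfl
      exact ⟨fun h => h.2, fun h => ⟨fun g hg => h g (hNK hg), h⟩⟩

open Classical in
/-- The contributions to a sum over the irreducible classes of those which are nontrivial on `N`,
of those which are trivial on `N` but not on `K`, and of those which are trivial on `K`. The
cardinalities of the first two sets are determined by the sums of the squares of the dimensions. -/
theorem sum_eq_of_chain {N K : Subgroup G} [N.Normal] [K.Normal] (hNK : N ≤ K) {d e m n k a b : ℕ}
    (hG : Nat.card G = m * k) (hK : Nat.card K = k) (hN : Nat.card N = n) (hkn : k = n * n * n)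
    (hd : 0 < d) (he : 0 < e)
    (hda : ∀ x : Irr G, ¬ x.TrivialOn N → x.dim = d)
    (hdb : ∀ x : Irr G, x.TrivialOn N → ¬ x.TrivialOn K → x.dim = e)
    (ha : a * d ^ 2 + m * (n * n) = m * k) (hb : b * e ^ 2 + m = m * (n * n)) (F : ℕ → M) :
    ∑ x : Irr G, F x.dim = a • F d + b • F e + ∑ x : Irr G with x.TrivialOn K, F x.dim := by
  have hn : 0 < n := hN ▸ Nat.card_pos
  have hk : 0 < k := hK ▸ Nat.card_pos
  have hsN := sum_trivialOn_sq (G := G) N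
  have hsK := sum_trivialOn_sq (G := G) K
  rw [hG, hK] at hsK
  have hsK := Nat.eq_of_mul_eq_mul_right hk hsK
  rw [hG, hN, hkn, ← mul_assoc] at hsN
  have hsN := Nat.eq_of_mul_eq_mul_right hn hsN
  obtain ⟨h1, h2⟩ := sum_filter_chain hNK hda hdb (· ^ 2)
  rw [sum_dim_sq, hG, hsN, smul_eq_mul] at h1
  rw [hsK, hsN, smul_eq_mul] at h2
  have hb' : b = ({x : Irr G | x.TrivialOn N ∧ ¬ x.TrivialOn K} : Finset _).card :=
    Nat.eq_of_mul_eq_mul_right (Nat.pow_pos (n := 2) he) (by omega)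
  have ha' : a = ({x : Irr G | ¬ x.TrivialOn N} : Finset _).card :=
    Nat.eq_of_mul_eq_mul_right (Nat.pow_pos (n := 2) hd) (by omega)
  obtain ⟨h3, h4⟩ := sum_filter_chain hNK hda hdb F
  rw [ha', hb', h3, h4, add_assoc]

end Irr

/-! ### Reduction to the lower level -/

namespace Cen

variable {R : Type*} [CommRing R] {u τ : R}

local notation "S" => QuadraticAlgebra R u 0

/-- The reduction map between centraliser algebras. -/
def map {R' : Type*} [CommRing R'] (f : R →+* R') {u' τ' : R'} (hu : f u = u') (hτ : f τ = τ') :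
    Cen R u τ →+* Cen R' u' τ' where
  toFun X := ⟨quadMap f hu X.a, quadMap f hu X.c, quadMap f hu X.b, quadMap f hu X.e,
    quadMap f hu X.d⟩
  map_one' := by ext1 <;> simp
  map_mul' X Y := by ext1 <;> simp [quadMap_algebraMap, hτ]
  map_zero' := by ext1 <;> simp
  map_add' X Y := by ext1 <;> simp

section Map

variable {R' : Type*} [CommRing R'] (f : R →+* R') {u' τ' : R'} (hu : f u = u') (hτ : f τ = τ')

theorem map_star (X : Cen R u τ) : map f hu hτ (star X) = star (map f hu hτ X) := by
  ext1 <;> exact quadMap_star _ _ _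

theorem map_surjective (hf : Function.Surjective f) : Function.Surjective (map f hu hτ) := by
  intro X
  obtain ⟨a, ha⟩ := quadMap_surjective f hu hf X.a
  obtain ⟨c, hc⟩ := quadMap_surjective f hu hf X.c
  obtain ⟨b, hb⟩ := quadMap_surjective f hu hf X.b
  obtain ⟨e, he⟩ := quadMap_surjective f hu hf X.e
  obtain ⟨d, hd⟩ := quadMap_surjective f hu hf X.d
  exact ⟨⟨a, c, b, e, d⟩, by ext1 <;> assumption⟩

theorem map_eq_zero_iff {s : R} (hf : ∀ x, f x = 0 ↔ s ∣ x) (X : Cen R u τ) :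
    map f hu hτ X = 0 ↔ X ∈ multiples s := by
  rw [mem_multiples, ← quadMap_eq_zero_iff f hu hf, ← quadMap_eq_zero_iff f hu hf,
    ← quadMap_eq_zero_iff f hu hf, ← quadMap_eq_zero_iff f hu hf, ← quadMap_eq_zero_iff f hu hf]
  exact Cen.ext_iff

/-- Unitary elements lift along the reduction, as its kernel is nilpotent. -/
theorem unitaryMap_map_surjective [Finite R] (h2 : IsUnit (2 : R)) {s : R} (hs : IsNilpotent s)
    (hf : ∀ x, f x = 0 ↔ s ∣ x) (hfs : Function.Surjective f) :
    Function.Surjective (unitaryMap (map f hu hτ) (map_star f hu hτ)) := by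
  intro y
  obtain ⟨Y, hY⟩ := map_surjective f hu hτ hfs y
  obtain ⟨t, -, ht⟩ := exists_unitary_lift (isUnit_two h2) (map f hu hτ) (map_star f hu hτ)
    (fun X hX => isNilpotent_of_mem_multiples hs ((map_eq_zero_iff f hu hτ hf X).1 hX)) ⊤
    (fun _ _ => trivial) (Y := Y) trivial (hY ▸ y.2)
  exact ⟨t, Subtype.ext (ht.trans hY)⟩

theorem ker_unitaryMap_map {s : R} (hf : ∀ x, f x = 0 ↔ s ∣ x) :
    (unitaryMap (map f hu hτ) (map_star f hu hτ)).ker = unitaryCongr (multiples s) := by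
  ext g
  rw [MonoidHom.mem_ker, mem_unitaryCongr, ← map_eq_zero_iff f hu hτ hf, map_sub, map_one,
    sub_eq_zero, Subtype.ext_iff]
  rfl

end Map

/-- The determinant of the block with rows `(a + τ c, b)`, `(τ e, d)`. -/
def blockDet : Cen R u τ →* S where
  toFun X := (X.a + algebraMap R S τ * X.c) * X.d - algebraMap R S τ * X.e * X.b
  map_one' := by simp
  map_mul' X Y := by
    simp only [mul_a, mul_c, mul_b, mul_e, mul_d]
    ring

theorem blockDet_star (X : Cen R u τ) : blockDet (star X) = star (blockDet X) := by
  simp only [blockDet, MonoidHom.coe_mk, OneHom.coe_mk, star_a, star_c, star_b, star_e, star_d,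
    star_sub, star_mul, star_add, star_algebraMap']
  ring

/-- The pair of linear characters of the unitary group given by the coordinate `a` and by the
determinant of the complementary block. -/
def diagHom : unitary (Cen R u τ) →* unitary S × unitary S where
  toFun g :=
    (⟨(g : Cen R u τ).a, Unitary.mem_iff.2 ⟨congrArg Cen.a (Unitary.star_mul_self_of_mem g.2),
      congrArg Cen.a (Unitary.mul_star_self_of_mem g.2)⟩⟩,
    ⟨blockDet (g : Cen R u τ), Unitary.mem_iff.2 ⟨by
      rw [← blockDet_star, ← map_mul, Unitary.star_mul_self_of_mem g.2, map_one], by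
      rw [← blockDet_star, ← map_mul, Unitary.mul_star_self_of_mem g.2, map_one]⟩⟩)
  map_one' := Prod.ext (Subtype.ext rfl) (Subtype.ext (map_one _))
  map_mul' g h := Prod.ext (Subtype.ext rfl) (Subtype.ext (map_mul _ _ _))

theorem diagHom_eq_one_iff {g : unitary (Cen R u τ)} :
    diagHom g = 1 ↔ (g : Cen R u τ).a = 1 ∧ blockDet (g : Cen R u τ) = 1 := by
  rw [Prod.ext_iff, Subtype.ext_iff, Subtype.ext_iff]
  rfl

section

variable {s : R} (hs : s * τ = 0)

include hs in
theorem algebraMap_mul_eq_zero {x : S} (hx : algebraMap R S s ∣ x) : algebraMap R S τ * x = 0 := by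
  obtain ⟨x, rfl⟩ := hx
  rw [← mul_assoc, ← map_mul, mul_comm τ, hs, map_zero, zero_mul]

/-- If `s` annihilates `τ`, the block of an element congruent to `1` modulo `s` has determinant `d`,
so that on this congruence subgroup `diagHom` consists of the entries `a` and `d`. -/
theorem diagHom_eq_one_iff_mem {g : unitary (Cen R u τ)} (hg : g ∈ unitaryCongr (multiples s)) :
    diagHom g = 1 ↔ g ∈ unitaryCongr (offDiag u hs) := by
  obtain ⟨-, h2, h3, h4, -⟩ := mem_multiples.1 hg
  simp only [sub_c, sub_b, sub_e, one_c, one_b, one_e, sub_zero] at h2 h3 h4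
  have e1 := algebraMap_mul_eq_zero (u := u) hs h2
  have e2 := algebraMap_mul_eq_zero (u := u) hs h4
  rw [diagHom_eq_one_iff, mem_unitaryCongr, mem_offDiag]
  simp only [blockDet, MonoidHom.coe_mk, OneHom.coe_mk, e1, e2, sub_a, sub_c, sub_b, sub_e, sub_d,
    one_a, one_c, one_b, one_e, one_d, sub_zero, add_zero, zero_mul, sub_eq_zero]
  exact ⟨fun ⟨h, h'⟩ => ⟨h, by rwa [h, one_mul] at h', h2, h3, h4⟩,
    fun ⟨h, h', _⟩ => ⟨h, by rw [h, h', one_mul]⟩⟩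

/-- If `s` annihilates `τ`, the congruence subgroup modulo `s` is central modulo the off-diagonal
subgroup: the commutator of `g` with a multiple of `s` has vanishing diagonal entries. -/
theorem commutator_mem_offDiag (g : unitary (Cen R u τ)) {t : unitary (Cen R u τ)}
    (ht : t ∈ unitaryCongr (multiples s)) :
    g * t * g⁻¹ * t⁻¹ ∈ unitaryCongr (offDiag u hs) := by
  have hm : (g : Cen R u τ) * t - t * g ∈ offDiag u hs := by
    have e : (g : Cen R u τ) * t - t * g = g * (t - 1) - (t - 1) * g := by noncomm_ring
    rw [e]
    rw [mem_unitaryCongr] at ht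
    obtain ⟨-, h2, h3, h4, -⟩ := mem_multiples.1
      (sub_mem (Ideal.mul_mem_left _ (g : Cen R u τ) ht) (Ideal.mul_mem_right (g : Cen R u τ) _ ht))
    obtain ⟨X, hX⟩ := mem_multiples_iff_exists.1 ht
    have h0 : algebraMap R S s * algebraMap R S τ = 0 := by rw [← map_mul, hs, map_zero]
    rw [mem_offDiag]
    refine ⟨?_, ?_, h2, h3, h4⟩ <;> rw [hX]
    · simp [mul_comm, mul_left_comm]
    · simp only [sub_d, mul_d, mul_b, mul_e, scalar_a, scalar_b, scalar_c, scalar_d, scalar_e]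
      linear_combination ((g : Cen R u τ).e * X.b - X.e * (g : Cen R u τ).b) * h0
  have : ((g * t * g⁻¹ * t⁻¹ : unitary (Cen R u τ)) : Cen R u τ) - 1 =
      (g * t - t * g) * star ((t * g : unitary (Cen R u τ)) : Cen R u τ) := by
    have e : g * t * g⁻¹ * t⁻¹ = g * t * (t * g)⁻¹ := by group
    rw [e, Submonoid.coe_mul, coe_inv_unitary, sub_mul, ← Submonoid.coe_mul, ← Submonoid.coe_mul,
      Unitary.mul_star_self_of_mem (Subtype.prop (t * g))]
  rw [mem_unitaryCongr, this]
  exact Ideal.mul_mem_right _ _ hm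

end

section Truncated

variable {π : R} {ℓ q : ℕ} (hR : IsTruncated π ℓ q) (hs : π ^ (ℓ - 1) * τ = 0)
  {k : Type*} [CommRing k] (r : R →+* k) (hr : ∀ x, r x = 0 ↔ π ∣ x) (hτ : r τ = 0)

include hR in
theorem card_unitaryCongr_multiples_pow_pred [Finite R] (h2 : 2 ≤ ℓ) :
    Nat.card (unitaryCongr (multiples (π ^ (ℓ - 1)) : Ideal (Cen R u τ))) = q ^ 5 := by
  rw [card_unitaryCongr hR.isUnit_two _ fun X hX =>
    isNilpotent_of_mem_multiples ⟨2, by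
      rw [← pow_mul]; exact hR.pow_eq_zero_of_le (by omega)⟩ hX]
  exact card_skewIn_multiples hR (i := ℓ - 1) (i' := 1) (by omega)

open Classical in
include hR hr hτ in
/-- Sums over the irreducible classes in terms of sums for the lower level. The three summands
belong to the representations which are nontrivial on the corner subgroup, to those which are
trivial on it but not on the off-diagonal subgroup, and to the twists of representations of the
lower level. The coefficients come from the sums of the squares of the dimensions. -/
theorem sum_irr_eq [Finite R] [Finite k] (hu : IsUnit u) (hrs : Function.Surjective r)
    (h2 : 2 ≤ ℓ) {R' : Type*} [CommRing R'] [Finite R'] (f : R →+* R') {u' τ' : R'} (hfu : f u = u')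
    (hfτ : f τ = τ') (hf : ∀ x, f x = 0 ↔ π ^ (ℓ - 1) ∣ x) (hfs : Function.Surjective f)
    {M : Type*} [AddCommMonoid M] (F : ℕ → M) {N : ℕ}
    (hN : Nat.card (unitary (QuadraticAlgebra k (r u) 0)) = N) :
    ∑ x : Irr (unitary (Cen R u τ)), F x.dim =
      (q ^ (3 * ℓ - 3) * N ^ 2 * (q - 1)) • F (q ^ ℓ) +
      (q ^ (3 * ℓ - 3) * (q ^ 2 - 1)) • F (q ^ (ℓ - 1) * N) +
      q ^ 2 • ∑ x : Irr (unitary (Cen R' u' τ')), F x.dim := by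
  have hs := pow_pred_mul_eq_zero hR ((hr τ).1 hτ)
  have hl := hR.pos
  have hq := hR.one_lt
  have hq0 : 0 < q := by omega
  have hN0 : 0 < N := hN ▸ Nat.card_pos
  obtain ⟨j, rfl⟩ : ∃ j, ℓ = j + 2 := ⟨ℓ - 2, by omega⟩
  obtain ⟨p, rfl⟩ : ∃ p, q = p + 1 := ⟨q - 1, by omega⟩
  rw [Irr.sum_eq_of_chain (unitaryCongr_mono (corner_le_offDiag (hs := hs)))
    (m := (p + 1) ^ (5 * j + 5) * N ^ 2) (k := (p + 1) ^ 3) (d := (p + 1) ^ (j + 2))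
    (e := (p + 1) ^ (j + 1) * N) (a := (p + 1) ^ (3 * (j + 2) - 3) * N ^ 2 * (p + 1 - 1))
    (b := (p + 1) ^ (3 * (j + 2) - 3) * ((p + 1) ^ 2 - 1)) ?_ (card_offDiag hR hs)
    (card_corner hR hs) (by ring) (Nat.pow_pos hq0) (Nat.mul_pos (Nat.pow_pos hq0) hN0) ?_ ?_ ?_ ?_]
  · congr 1
    rw [Irr.sum_trivialOn_eq_smul diagHom (unitaryCongr_mono (offDiag_le_multiples dvd_rfl))
      (fun t ht => diagHom_eq_one_iff_mem hs ht) (fun g t ht => commutator_mem_offDiag hs g ht)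
      (n := (p + 1) ^ 2) (by
        rw [card_unitaryCongr_multiples_pow_pred hR h2, card_offDiag hR hs]; ring)]
    congr 1
    rw [← ker_unitaryMap_map f hfu hfτ hf, Irr.sum_trivialOn_ker _
      (unitaryMap_map_surjective f hfu hfτ hR.isUnit_two ⟨2, by
        rw [← pow_mul]; exact hR.pow_eq_zero_of_le (by omega)⟩ hf hfs)]
  · rw [card_unitary hR r hr hτ hrs, hN]
    have : 5 * (j + 2) - 2 = 5 * j + 8 := by omega
    rw [this]
    ring
  · intro x hx
    simp only [Irr.TrivialOn, not_forall] at hx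
    obtain ⟨g, hg, hg1⟩ := hx
    have := finrank_eq_of_corner hR hs r hr hτ hu hrs x.isIrreducible_rep h2 hg hg1
    rwa [Module.finrank_fin_fun] at this
  · intro x hx hx'
    simp only [Irr.TrivialOn, not_forall] at hx'
    obtain ⟨g, hg, hg1⟩ := hx'
    have := finrank_eq_of_offDiag hR hs r hr hτ hu hrs x.isIrreducible_rep h2 hx hg hg1
    rwa [Module.finrank_fin_fun, hN] at this
  · have : 3 * (j + 2) - 3 = 3 * j + 3 := by omega
    rw [this, Nat.add_sub_cancel]
    ring
  · have h3 : 3 * (j + 2) - 3 = 3 * j + 3 := by omega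
    have h4 : (p + 1) ^ 2 - 1 = p ^ 2 + 2 * p := by
      rw [Nat.sub_eq_iff_eq_add (Nat.pow_pos hq0)]; ring
    rw [h3, h4]
    ring

end Truncated

section LevelOne

variable {π : R} {q : ℕ} (hR : IsTruncated π 1 q)
  {k : Type*} [CommRing k] (r : R →+* k) (hr : ∀ x, r x = 0 ↔ π ∣ x)

include hR hr in
/-- Sums over the irreducible classes at level one, where the representations which are trivial on
the off-diagonal subgroup are the linear characters. -/
theorem sum_irr_eq_of_level_one [Finite R] [Finite k] (hu : IsUnit u) (hrs : Function.Surjective r)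
    (hτ : τ = 0) {M : Type*} [AddCommMonoid M] (F : ℕ → M) {N : ℕ}
    (hN : Nat.card (unitary (QuadraticAlgebra k (r u) 0)) = N) :
    ∑ x : Irr (unitary (Cen R u τ)), F x.dim =
      (N ^ 2 * (q - 1)) • F q + (q ^ 2 - 1) • F N + N ^ 2 • F 1 := by
  classical
  subst hτ
  have hs : π ^ (1 - 1) * (0 : R) = 0 := mul_zero _
  have h1 : π ^ (1 - 1) = 1 := pow_zero π
  have hq := hR.one_lt
  have hq0 : 0 < q := by omega
  have hN0 : 0 < N := hN ▸ Nat.card_pos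
  obtain ⟨p, rfl⟩ : ∃ p, q = p + 1 := ⟨q - 1, by omega⟩
  have hG : Nat.card (unitary (Cen R u 0)) = N ^ 2 * (p + 1) ^ 3 := by
    rw [card_unitary hR r hr (map_zero r) hrs, hN]
    ring
  have hdim : ∀ x : Irr (unitary (Cen R u 0)), x.TrivialOn (unitaryCongr (offDiag u hs)) →
      x.dim = 1 := by
    intro x hx
    have := finrank_eq_one_of_offDiag h1 x.isIrreducible_rep hx
    rwa [Module.finrank_fin_fun] at this
  rw [Irr.sum_eq_of_chain (unitaryCongr_mono (corner_le_offDiag (hs := hs)))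
    (m := N ^ 2) (k := (p + 1) ^ 3) (d := p + 1)
    (e := N) (a := N ^ 2 * (p + 1 - 1))
    (b := ((p + 1) ^ 2 - 1)) hG (card_offDiag hR hs)
    (card_corner hR hs) (by ring) hq0 hN0 ?_ ?_ ?_ ?_]
  · congr 1
    have e1 := Irr.sum_trivialOn_sq (unitaryCongr (offDiag u hs))
    rw [hG, card_offDiag hR hs] at e1
    have e1 := Nat.eq_of_mul_eq_mul_right (Nat.pow_pos (n := 3) hq0) e1
    rw [← e1, Finset.sum_smul]
    refine Finset.sum_congr rfl fun x hx => ?_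
    rw [hdim x (by simpa using hx), one_pow, one_smul]
  · intro x hx
    simp only [Irr.TrivialOn, not_forall] at hx
    obtain ⟨g, hg, hg1⟩ := hx
    have := finrank_eq_of_corner_one hR h1 x.isIrreducible_rep (card_offDiag hR hs)
      (card_corner hR hs) hg hg1
    rwa [Module.finrank_fin_fun] at this
  · intro x hx hx'
    simp only [Irr.TrivialOn, not_forall] at hx'
    obtain ⟨g, hg, hg1⟩ := hx'
    have := finrank_eq_of_offDiag_one hR h1 r hr hu hrs x.isIrreducible_rep hx hg hg1
    rwa [Module.finrank_fin_fun, hN] at this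
  · rw [Nat.add_sub_cancel]
    ring
  · have h4 : (p + 1) ^ 2 - 1 = p ^ 2 + 2 * p := by
      rw [Nat.sub_eq_iff_eq_add (Nat.pow_pos hq0)]; ring
    rw [h4]
    ring

end LevelOne

end Cen

/-! ### Counting norm one elements of a quadratic algebra over a finite field -/

namespace QuadraticAlgebra

/-- The unitary elements of a quadratic algebra are the elements of norm one. -/
theorem mem_unitary_iff {R : Type*} [CommRing R] {u : R} {z : QuadraticAlgebra R u 0} :
    z ∈ unitary (QuadraticAlgebra R u 0) ↔ z.re * z.re - u * (z.im * z.im) = 1 := by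
  rw [Unitary.mem_iff, mul_comm (star z), and_self_iff]
  constructor
  · intro h
    have := congrArg QuadraticAlgebra.re h
    simp [re_one] at this
    linear_combination this
  · intro h
    ext
    · simp [re_one]
      linear_combination h
    · simp [im_one]
      ring

variable {k : Type*} [Field k]

/-- The norm one elements of the split algebra correspond to the units of the field. -/
theorem card_unitary_split (h2 : (2 : k) ≠ 0) :
    Nat.card (unitary (QuadraticAlgebra k 1 0)) = Nat.card k - 1 := by
  have : Nat.card (unitary (QuadraticAlgebra k 1 0)) = Nat.card kˣ := by
    refine Nat.card_congr ⟨fun z => ⟨z.1.re + z.1.im, z.1.re - z.1.im, ?_, ?_⟩,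
      fun t => ⟨⟨((t : k) + (t⁻¹ : kˣ)) / 2, ((t : k) - (t⁻¹ : kˣ)) / 2⟩, mem_unitary_iff.2 ?_⟩,
      fun z => ?_, fun t => ?_⟩
    · linear_combination mem_unitary_iff.1 z.2
    · linear_combination mem_unitary_iff.1 z.2
    · have := t.mul_inv
      field_simp
      linear_combination 4 * this
    · apply Subtype.ext
      ext
      · simp only [Units.inv_mk]
        field_simp
        ring
      · simp only [Units.inv_mk]
        field_simp
        ring
    · apply Units.ext
      simp only
      field_simp
      ring
  rw [this, Nat.card_units]

/-- The norm one elements of a quadratic field extension are parametrised by the projective line: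
`t` corresponds to `(1 + t ξ) / (1 - t ξ)`, and the point at infinity to `-1`. -/
theorem card_unitary_of_not_isSquare [Finite k] (h2 : (2 : k) ≠ 0) {u : k} (hu : ¬ IsSquare u) :
    Nat.card (unitary (QuadraticAlgebra k u 0)) = Nat.card k + 1 := by
  have h1 : ∀ t : k, 1 - u * (t * t) ≠ 0 := by
    intro t h
    have ht : t ≠ 0 := by rintro rfl; simp at h
    refine hu ⟨t⁻¹, ?_⟩
    field_simp
    linear_combination -h
  have h3 : ∀ z : unitary (QuadraticAlgebra k u 0), z ≠ -1 → z.1.re + 1 ≠ 0 := by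
    intro z hz h
    have hre : z.1.re = -1 := eq_neg_of_add_eq_zero_left h
    have hn := mem_unitary_iff.1 z.2
    have him : z.1.im = 0 := by
      have hu0 : u ≠ 0 := fun h => hu (h ▸ IsSquare.zero)
      have : u * (z.1.im * z.1.im) = 0 := by rw [hre] at hn; linear_combination -hn
      simpa [hu0] using this
    refine hz (Subtype.ext ?_)
    ext
    · change _ = (-1 : QuadraticAlgebra k u 0).re
      simp [hre, re_one]
    · change _ = (-1 : QuadraticAlgebra k u 0).im
      simp [him, im_one]
  have : Nat.card (unitary (QuadraticAlgebra k u 0)) = Nat.card (Option k) := by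
    symm
    refine Nat.card_congr (Equiv.ofBijective (fun t => t.elim (-1) fun t =>
      ⟨⟨(1 + u * (t * t)) / (1 - u * (t * t)), 2 * t / (1 - u * (t * t))⟩,
        mem_unitary_iff.2 ?_⟩) ⟨?_, ?_⟩)
    · rw [div_mul_div_comm, div_mul_div_comm, mul_div_assoc', ← sub_div,
        div_eq_one_iff_eq (mul_ne_zero (h1 t) (h1 t))]
      ring
    · have hne : ∀ t : k, (1 + u * (t * t)) / (1 - u * (t * t)) ≠ -1 := fun t h => by
        rw [div_eq_iff (h1 t)] at h
        exact h2 (by linear_combination h)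
      rintro (_ | t) (_ | t') h
      · rfl
      · have := congrArg (fun z => z.1.re) h
        simp at this
        exact absurd this.symm (hne t')
      · have := congrArg (fun z => z.1.re) h
        simp at this
        exact absurd this (hne t)
      · have e1 := congrArg (fun z => z.1.re) h
        have e2 := congrArg (fun z => z.1.im) h
        simp only [Option.elim_some] at e1 e2
        have a1 := h1 t
        have a2 := h1 t'
        have e3 : ∀ t : k, (1 + u * (t * t)) / (1 - u * (t * t)) + 1 = 2 / (1 - u * (t * t)) := by
          intro t
          rw [div_add_one (h1 t)]
          congr 1
          ring
        have e4 : 2 / (1 - u * (t * t)) = 2 / (1 - u * (t' * t')) := by rw [← e3, ← e3, e1]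
        have e5 : t * (2 / (1 - u * (t * t))) = t' * (2 / (1 - u * (t * t))) := by
          conv_rhs => rw [e4]
          linear_combination e2
        exact congrArg some (mul_right_cancel₀ (div_ne_zero h2 a1) e5)
    · intro z
      by_cases hz : z = -1
      · exact ⟨none, hz.symm⟩
      · have h4 := h3 z hz
        have hn := mem_unitary_iff.1 z.2
        refine ⟨some (z.1.im / (z.1.re + 1)), Subtype.ext ?_⟩
        have h5 : 1 - u * (z.1.im / (z.1.re + 1) * (z.1.im / (z.1.re + 1))) =
            2 / (z.1.re + 1) := by
          field_simp
          linear_combination hn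
        simp only [Option.elim_some]
        ext
        · simp only [h5]
          field_simp
          linear_combination -hn
        · simp only [h5]
          field_simp
  rw [this, Finite.card_option]

end QuadraticAlgebra

/-! ### Quotients of discrete valuation rings -/

section Level

variable {o : Type*} [CommRing o] [IsDomain o] [IsDiscreteValuationRing o]

theorem card_oLevel (ℓ : ℕ) : Nat.card (oLevel o ℓ) = Nat.card (ResidueField o) ^ ℓ :=
  cardQuot_pow_of_prime (P := maximalIdeal o) (IsDiscreteValuationRing.not_a_field o)

instance [Finite (ResidueField o)] (ℓ : ℕ) : Finite (oLevel o ℓ) :=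
  Nat.finite_of_card_ne_zero (by rw [card_oLevel]; exact (Nat.pow_pos Nat.card_pos).ne')

theorem isUnit_two_of_ringChar_ne_two (hp : ringChar (ResidueField o) ≠ 2) : IsUnit (2 : o) := by
  rw [← residue_ne_zero_iff_isUnit, map_ofNat]
  exact Ring.two_ne_zero hp

variable {ϖ : o} (hϖ : Irreducible ϖ)

include hϖ

theorem mem_maximalIdeal_pow_iff {n : ℕ} {x : o} : x ∈ maximalIdeal o ^ n ↔ ϖ ^ n ∣ x := by
  rw [hϖ.maximalIdeal_eq, Ideal.span_singleton_pow, Ideal.mem_span_singleton]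

/-- Divisibility by powers of the uniformiser up to the exponent `ℓ` can be tested modulo `𝔭^ℓ`. -/
theorem mk_pow_dvd_iff {ℓ i : ℕ} (h : i ≤ ℓ) (x : o) :
    (Ideal.Quotient.mk (maximalIdeal o ^ ℓ) ϖ) ^ i ∣ Ideal.Quotient.mk (maximalIdeal o ^ ℓ) x ↔
      ϖ ^ i ∣ x := by
  constructor
  · rintro ⟨y, hy⟩
    obtain ⟨y, rfl⟩ := Ideal.Quotient.mk_surjective y
    rw [← map_pow, ← map_mul, Ideal.Quotient.mk_eq_mk_iff_sub_mem,
      mem_maximalIdeal_pow_iff hϖ] at hy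
    exact (dvd_sub_left (dvd_mul_right _ _)).1 ((pow_dvd_pow ϖ h).trans hy)
  · rintro ⟨y, rfl⟩
    rw [map_mul, map_pow]
    exact dvd_mul_right _ _

theorem isTruncated_oLevel [Finite (ResidueField o)] (hp : ringChar (ResidueField o) ≠ 2)
    {ℓ : ℕ} (hℓ : 0 < ℓ) :
    IsTruncated (Ideal.Quotient.mk (maximalIdeal o ^ ℓ) ϖ) ℓ (Nat.card (ResidueField o)) where
  pos := hℓ
  one_lt := Finite.one_lt_card
  pow_eq_zero := by
    rw [← map_pow, Ideal.Quotient.eq_zero_iff_mem, mem_maximalIdeal_pow_iff hϖ]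
  isUnit_or_dvd x := by
    obtain ⟨x, rfl⟩ := Ideal.Quotient.mk_surjective x
    by_cases hx : IsUnit x
    · exact Or.inl (hx.map _)
    · right
      have := (mem_maximalIdeal x).2 hx
      rw [hϖ.maximalIdeal_eq, Ideal.mem_span_singleton] at this
      exact map_dvd _ this
  dvd_of_mul_eq_zero i j hij x hx := by
    obtain ⟨x, rfl⟩ := Ideal.Quotient.mk_surjective x
    rw [← map_pow, ← map_mul, Ideal.Quotient.eq_zero_iff_mem, mem_maximalIdeal_pow_iff hϖ, ← hij,
      pow_add] at hx
    exact (mk_pow_dvd_iff hϖ (by omega) x).2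
      ((mul_dvd_mul_iff_left (pow_ne_zero i hϖ.ne_zero)).1 hx)
  card_dvd i j hij := by
    let φ : o →ₗ[o] oLevel o ℓ := (Submodule.mkQ (maximalIdeal o ^ ℓ)).comp
      (LinearMap.mulLeft o (ϖ ^ i))
    have hker : LinearMap.ker φ = maximalIdeal o ^ j := by
      ext x
      rw [LinearMap.mem_ker, mem_maximalIdeal_pow_iff hϖ]
      change Ideal.Quotient.mk _ (ϖ ^ i * x) = 0 ↔ _
      rw [Ideal.Quotient.eq_zero_iff_mem, mem_maximalIdeal_pow_iff hϖ, ← hij, pow_add,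
        mul_dvd_mul_iff_left (pow_ne_zero i hϖ.ne_zero)]
    have h1 : Nat.card (oLevel o j) = Nat.card (LinearMap.range φ) := by
      rw [← Nat.card_congr φ.quotKerEquivRange.toEquiv, hker]
    rw [← card_oLevel, h1]
    refine Nat.card_congr (Equiv.subtypeEquivRight fun x => ?_)
    obtain ⟨x, rfl⟩ := Ideal.Quotient.mk_surjective x
    constructor
    · rintro ⟨y, hy⟩
      obtain ⟨y, rfl⟩ := Ideal.Quotient.mk_surjective y
      refine ⟨y, ?_⟩
      rw [hy, ← map_pow, ← map_mul]
      rfl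
    · rintro ⟨y, hy⟩
      refine ⟨Ideal.Quotient.mk _ y, ?_⟩
      rw [← hy, ← map_pow, ← map_mul]
      rfl
  isUnit_two := by
    have := (isUnit_two_of_ringChar_ne_two hp).map (Ideal.Quotient.mk (maximalIdeal o ^ ℓ))
    rwa [map_ofNat] at this

theorem factor_eq_zero_iff {m n : ℕ} (h : m ≤ n) (x : oLevel o n) :
    Ideal.Quotient.factor (Ideal.pow_le_pow_right h) x = (0 : oLevel o m) ↔
      (Ideal.Quotient.mk (maximalIdeal o ^ n) ϖ) ^ m ∣ x := by
  obtain ⟨x, rfl⟩ := Ideal.Quotient.mk_surjective x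
  rw [Ideal.Quotient.factor_mk, Ideal.Quotient.eq_zero_iff_mem, mk_pow_dvd_iff hϖ h,
    mem_maximalIdeal_pow_iff hϖ]

omit hϖ in
/-- The reduction map from `o_ℓ` to the residue field. -/
def levelResidue {n : ℕ} (hn : n ≠ 0) : oLevel o n →+* ResidueField o :=
  Ideal.Quotient.factor (Ideal.pow_le_self hn)

omit hϖ in
theorem levelResidue_surjective {n : ℕ} (hn : n ≠ 0) :
    Function.Surjective (levelResidue (o := o) hn) :=
  Ideal.Quotient.factor_surjective _

theorem levelResidue_eq_zero_iff {n : ℕ} (hn : n ≠ 0) (x : oLevel o n) :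
    levelResidue hn x = 0 ↔ Ideal.Quotient.mk (maximalIdeal o ^ n) ϖ ∣ x := by
  obtain ⟨x, rfl⟩ := Ideal.Quotient.mk_surjective x
  have := mk_pow_dvd_iff hϖ (Nat.one_le_iff_ne_zero.2 hn) x
  rw [pow_one, pow_one] at this
  change residue o x = 0 ↔ _
  rw [residue_eq_zero_iff, this, hϖ.maximalIdeal_eq, Ideal.mem_span_singleton]

end Level

/-! ### The zeta functions of the unitary groups -/

theorem natCast_pow_cpow (q n : ℕ) (s : ℂ) :
    (((q ^ n : ℕ) : ℂ)) ^ (-s) = (q : ℂ) ^ (-((n : ℂ) * s)) := by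
  rw [← mul_neg, Complex.cpow_nat_mul]
  induction n with
  | zero => simp
  | succ n ih => rw [pow_succ, Nat.cast_mul, Complex.natCast_mul_natCast_cpow, ih, pow_succ]

/-- The formula obeys the recursion given by `Cen.sum_irr_eq`, with `q - ε` norm one elements. -/
theorem zetaFormula_succ (q : ℕ) (ε : ℤ) {ℓ : ℕ} (hℓ : 1 ≤ ℓ) (s : ℂ) :
    zetaFormula q ε (ℓ + 1) s = (q : ℂ) ^ (3 * ℓ) * ((q : ℂ) - ε) ^ 2 * ((q : ℂ) - 1) *
        (q : ℂ) ^ (-(((ℓ + 1 : ℕ) : ℂ) * s)) +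
      (q : ℂ) ^ (3 * ℓ) * ((q : ℂ) ^ 2 - 1) * ((q : ℂ) ^ ℓ * ((q : ℂ) - ε)) ^ (-s) +
      (q : ℂ) ^ 2 * zetaFormula q ε ℓ s := by
  have h1 : ∑ i ∈ Finset.Icc 1 ℓ, (q : ℂ) ^ (i + 2 * (ℓ + 1) - 3) * (q : ℂ) ^ (-((i : ℂ) * s)) =
      (q : ℂ) ^ 2 *
        ∑ i ∈ Finset.Icc 1 ℓ, (q : ℂ) ^ (i + 2 * ℓ - 3) * (q : ℂ) ^ (-((i : ℂ) * s)) := by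
    rw [Finset.mul_sum]
    refine Finset.sum_congr rfl fun i hi => ?_
    have := (Finset.mem_Icc.1 hi).1
    rw [← mul_assoc, ← pow_add]
    congr 2
    omega
  have h2 : ∑ i ∈ Finset.range ℓ, (q : ℂ) ^ (i + 2 * (ℓ + 1) - 2) *
        ((q : ℂ) ^ i * ((q : ℂ) - ε)) ^ (-s) =
      (q : ℂ) ^ 2 * ∑ i ∈ Finset.range ℓ, (q : ℂ) ^ (i + 2 * ℓ - 2) *
        ((q : ℂ) ^ i * ((q : ℂ) - ε)) ^ (-s) := by
    rw [Finset.mul_sum]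
    refine Finset.sum_congr rfl fun i hi => ?_
    rw [← mul_assoc, ← pow_add]
    congr 2
    omega
  rw [zetaFormula, zetaFormula, Finset.sum_Icc_succ_top (by omega), Finset.sum_range_succ, h1, h2]
  have e1 : ℓ + 1 + 2 * (ℓ + 1) - 3 = 3 * ℓ := by omega
  have e2 : ℓ + 2 * (ℓ + 1) - 2 = 3 * ℓ := by omega
  have e3 : 2 * (ℓ + 1) - 2 = (2 * ℓ - 2) + 2 := by omega
  rw [e1, e2, e3, pow_add]
  ring

theorem zetaFormula_one (q : ℕ) (ε : ℤ) (s : ℂ) :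
    zetaFormula q ε 1 s = ((q : ℂ) - ε) ^ 2 * ((q : ℂ) - 1) * (q : ℂ) ^ (-s) +
      ((q : ℂ) ^ 2 - 1) * ((q : ℂ) - ε) ^ (-s) + ((q : ℂ) - ε) ^ 2 := by
  simp [zetaFormula]
  ring

theorem zetaFormulaOne_eq (q : ℕ) (ε : ℤ) (s : ℂ) :
    zetaFormulaOne q ε s = zetaFormula q ε 1 s := by
  rw [zetaFormula_one, zetaFormulaOne]
  ring

section Level

variable {o : Type*} [CommRing o] [IsDomain o] [IsDiscreteValuationRing o]
  [Finite (ResidueField o)]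

/-- The zeta function of the unitary group of the centraliser algebra over `o_ℓ`. -/
theorem repZeta_unitary_cen (hp : ringChar (ResidueField o) ≠ 2) {u τ : o} (hu : IsUnit u)
    (hτ : τ ∈ maximalIdeal o) {q N : ℕ} (hq : q = Nat.card (ResidueField o))
    (hN : Nat.card (unitary (QuadraticAlgebra (ResidueField o) (residue o u) 0)) = N) {ε : ℤ}
    (hNε : (N : ℂ) = q - ε) {ℓ : ℕ} (hℓ : 1 ≤ ℓ) (s : ℂ) :
    repZeta (unitary (Cen (oLevel o ℓ) (Ideal.Quotient.mk _ u) (Ideal.Quotient.mk _ τ))) s =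
      zetaFormula q ε ℓ s := by
  classical
  obtain ⟨ϖ, hϖ⟩ := IsDiscreteValuationRing.exists_irreducible o
  have hq1 : 1 ≤ q := hq ▸ Nat.card_pos
  have hq2 : 1 ≤ q ^ 2 := Nat.one_le_pow _ _ hq1
  induction ℓ, hℓ using Nat.le_induction with
  | base =>
    rw [Irr.repZeta_eq_sum, Cen.sum_irr_eq_of_level_one (isTruncated_oLevel hϖ hp zero_lt_one)
      (levelResidue one_ne_zero) (levelResidue_eq_zero_iff hϖ one_ne_zero) (hu.map _)
      (levelResidue_surjective one_ne_zero)
      ((Ideal.Quotient.eq_zero_iff_mem).2 (by rwa [pow_one])) (fun n => (n : ℂ) ^ (-s)) hN, ← hq,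
      zetaFormula_one, nsmul_eq_mul, nsmul_eq_mul, nsmul_eq_mul]
    push_cast [hq1, hq2]
    rw [hNε, Complex.one_cpow, mul_one]
  | succ ℓ hℓ ih =>
    have hR := isTruncated_oLevel (ℓ := ℓ + 1) hϖ hp (by omega)
    rw [Irr.repZeta_eq_sum, Cen.sum_irr_eq hR
      (levelResidue (Nat.succ_ne_zero ℓ)) (levelResidue_eq_zero_iff hϖ (Nat.succ_ne_zero ℓ))
      ((Ideal.Quotient.eq_zero_iff_mem).2 hτ) (hu.map _)
      (levelResidue_surjective (Nat.succ_ne_zero ℓ)) (by omega)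
      (Ideal.Quotient.factor (Ideal.pow_le_pow_right (Nat.le_succ ℓ)) :
        oLevel o (ℓ + 1) →+* oLevel o ℓ) (u' := Ideal.Quotient.mk _ u)
      (τ' := Ideal.Quotient.mk _ τ) rfl rfl
      (factor_eq_zero_iff hϖ (Nat.le_succ ℓ)) (Ideal.Quotient.factor_surjective _)
      (fun n => (n : ℂ) ^ (-s)) hN, ← hq, ← Irr.repZeta_eq_sum, ih, zetaFormula_succ q ε hℓ,
      natCast_pow_cpow, nsmul_eq_mul, nsmul_eq_mul, nsmul_eq_mul]
    have e1 : 3 * (ℓ + 1) - 3 = 3 * ℓ := by omega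
    rw [e1, Nat.add_sub_cancel]
    push_cast [hq1, hq2]
    rw [hNε]

end Level

/-! ### The matrices which commute with `𝐜` -/

namespace Cen

variable {R : Type*} [CommRing R] {u τ : R}

local notation "S" => QuadraticAlgebra R u 0

section

variable {A : Type*} [CommRing A] (φ : QuadraticAlgebra R u 0 →+* A) {δ : R} (hτ : τ = 2 * δ)

/-- The matrix of an element of the centraliser algebra, with the coefficients mapped to `A`. -/
def toMatrix : Cen R u τ →+* Matrix (Fin 3) (Fin 3) A where
  toFun X :=
    !![φ X.a + φ (algebraMap R S δ) * φ X.c, φ X.b, φ X.c;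
      φ (algebraMap R S δ) * φ X.e, φ X.d, φ X.e;
      φ (algebraMap R S δ) ^ 2 * φ X.c, φ (algebraMap R S δ) * φ X.b,
        φ X.a + φ (algebraMap R S δ) * φ X.c]
  map_one' := by
    ext i j
    fin_cases i <;> fin_cases j <;> simp
  map_mul' X Y := by
    have h2 : φ (algebraMap R (QuadraticAlgebra R u 0) τ) = 2 * φ (algebraMap R _ δ) := by
      rw [hτ, map_mul, map_mul, map_ofNat, map_ofNat]
    ext i j
    fin_cases i <;> fin_cases j <;> simp [Matrix.mul_apply, Fin.sum_univ_three, h2] <;> ring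
  map_zero' := by
    ext i j
    fin_cases i <;> fin_cases j <;> simp
  map_add' X Y := by
    ext i j
    fin_cases i <;> fin_cases j <;> simp <;> ring

theorem toMatrix_apply (X : Cen R u τ) : toMatrix φ hτ X =
    !![φ X.a + φ (algebraMap R S δ) * φ X.c, φ X.b, φ X.c;
      φ (algebraMap R S δ) * φ X.e, φ X.d, φ X.e;
      φ (algebraMap R S δ) ^ 2 * φ X.c, φ (algebraMap R S δ) * φ X.b,
        φ X.a + φ (algebraMap R S δ) * φ X.c] := rfl

theorem commute_toMatrix (X : Cen R u τ) :
    Commute (toMatrix φ hτ X) (cMatrix (φ (algebraMap R S δ))) := by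
  rw [commute_iff_eq]
  ext i j
  fin_cases i <;> fin_cases j <;>
    simp [toMatrix_apply, cMatrix, Matrix.mul_apply, Fin.sum_univ_three] <;> ring

/-- A matrix which commutes with `𝐜` is determined by its entries in the positions of the
coordinates. -/
theorem toMatrix_eq_iff {X : Cen R u τ} {M : Matrix (Fin 3) (Fin 3) A}
    (hM : Commute M (cMatrix (φ (algebraMap R S δ)))) :
    toMatrix φ hτ X = M ↔ φ X.a = M 0 0 - φ (algebraMap R S δ) * M 0 2 ∧ φ X.c = M 0 2 ∧
      φ X.b = M 0 1 ∧ φ X.e = M 1 2 ∧ φ X.d = M 1 1 := by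
  constructor
  · rintro rfl
    simp [toMatrix_apply]
  · rintro ⟨h1, h2, h3, h4, h5⟩
    have h : ∀ i j, (M * cMatrix (φ (algebraMap R S δ))) i j =
      (cMatrix (φ (algebraMap R S δ)) * M) i j := fun i j => by rw [hM.eq]
    have a1 := h 0 1
    have a2 := h 0 2
    have a3 := h 1 2
    have a4 := h 2 2
    simp [cMatrix, Matrix.mul_apply, Fin.sum_univ_three] at a1 a2 a3 a4
    ext i j
    fin_cases i <;> fin_cases j <;> simp [toMatrix_apply, h1, h2, h3, h4, h5]
    · exact a3.symm
    · exact a4.symm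
    · linear_combination a1
    · exact a2

theorem toMatrix_injective (hφ : Function.Injective φ) :
    Function.Injective (toMatrix φ hτ : Cen R u τ →+* _) := by
  intro X Y h
  have h1 := (toMatrix_eq_iff φ hτ (commute_toMatrix φ hτ Y)).1 h
  have h2 := (toMatrix_eq_iff φ hτ (commute_toMatrix φ hτ Y)).1 rfl
  exact Cen.ext (hφ (h1.1.trans h2.1.symm)) (hφ (h1.2.1.trans h2.2.1.symm))
    (hφ (h1.2.2.1.trans h2.2.2.1.symm)) (hφ (h1.2.2.2.1.trans h2.2.2.2.1.symm))
    (hφ (h1.2.2.2.2.trans h2.2.2.2.2.symm))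

/-- The invertible matrix of a unitary element. -/
def toGL : unitary (Cen R u τ) →* GL (Fin 3) A :=
  (Units.map (toMatrix φ hτ : Cen R u τ →* Matrix (Fin 3) (Fin 3) A)).comp Unitary.toUnits

@[simp] theorem coe_toGL (g : unitary (Cen R u τ)) :
    (toGL φ hτ g : Matrix (Fin 3) (Fin 3) A) = toMatrix φ hτ (g : Cen R u τ) := rfl

theorem coe_inv_toGL (g : unitary (Cen R u τ)) :
    ((toGL φ hτ g)⁻¹ : GL (Fin 3) A) = toMatrix φ hτ (star (g : Cen R u τ)) := by
  rw [← map_inv, coe_toGL, coe_inv_unitary]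

theorem toGL_mem_centGL (g : unitary (Cen R u τ)) :
    toGL φ hτ g ∈ centGL (cMatrix (φ (algebraMap R S δ))) := commute_toMatrix φ hτ g

end

/-! ### The general linear case -/

section Split

variable {R : Type*} [CommRing R] {τ : R}

/-- The projection of the split quadratic algebra onto one of its two factors. -/
def splitEval : QuadraticAlgebra R 1 0 →+* R where
  toFun z := z.re + z.im
  map_one' := by simp [QuadraticAlgebra.re_one, QuadraticAlgebra.im_one]
  map_mul' z w := by
    simp
    ring
  map_zero' := by simp
  map_add' z w := by
    simp
    ring

theorem splitEval_algebraMap (x : R) :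
    splitEval (algebraMap R (QuadraticAlgebra R 1 0) x) = x := by
  simp [splitEval]

/-- The two projections of the split algebra, which are exchanged by the involution, are jointly
injective. -/
theorem ext_splitEval (h2 : IsUnit (2 : R)) {z w : QuadraticAlgebra R 1 0}
    (h : splitEval z = splitEval w) (h' : splitEval (star z) = splitEval (star w)) : z = w := by
  simp [splitEval] at h h'
  ext
  · apply h2.mul_left_cancel
    linear_combination h + h'
  · apply h2.mul_left_cancel
    linear_combination h - h'

/-- The two projections of the split algebra are jointly surjective. -/
theorem exists_splitEval (h2 : IsUnit (2 : R)) (x y : R) :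
    ∃ z : QuadraticAlgebra R 1 0, splitEval z = x ∧ splitEval (star z) = y := by
  obtain ⟨c, hc⟩ := h2.exists_left_inv
  refine ⟨⟨c * (x + y), c * (x - y)⟩, ?_, ?_⟩
  · simp [splitEval]
    linear_combination x * hc
  · simp [splitEval]
    linear_combination y * hc

theorem ext_toMatrix_splitEval (h2 : IsUnit (2 : R)) {δ : R} (hτ : τ = 2 * δ) {X Y : Cen R 1 τ}
    (h : toMatrix splitEval hτ X = toMatrix splitEval hτ Y)
    (h' : toMatrix splitEval hτ (star X) = toMatrix splitEval hτ (star Y)) : X = Y := by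
  have hY := (toMatrix_eq_iff splitEval hτ (commute_toMatrix splitEval hτ Y)).1 rfl
  have hX := (toMatrix_eq_iff splitEval hτ (commute_toMatrix splitEval hτ Y)).1 h
  have hY' := (toMatrix_eq_iff splitEval hτ (commute_toMatrix splitEval hτ (star Y))).1 rfl
  have hX' := (toMatrix_eq_iff splitEval hτ (commute_toMatrix splitEval hτ (star Y))).1 h'
  refine Cen.ext (ext_splitEval h2 (hX.1.trans hY.1.symm) (hX'.1.trans hY'.1.symm))
    (ext_splitEval h2 (hX.2.1.trans hY.2.1.symm) (hX'.2.1.trans hY'.2.1.symm))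
    (ext_splitEval h2 (hX.2.2.1.trans hY.2.2.1.symm) (hX'.2.2.2.1.trans hY'.2.2.2.1.symm))
    (ext_splitEval h2 (hX.2.2.2.1.trans hY.2.2.2.1.symm) (hX'.2.2.1.trans hY'.2.2.1.symm))
    (ext_splitEval h2 (hX.2.2.2.2.trans hY.2.2.2.2.symm) (hX'.2.2.2.2.trans hY'.2.2.2.2.symm))

/-- The centraliser of `𝐜` in the general linear group, as a unitary group for the split
quadratic algebra: a unitary element corresponds to its first component, as its second component
is the image of the inverse of the first one under the anti-automorphism which exchanges `b`
and `e`. -/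
def unitaryEquivGL (h2 : IsUnit (2 : R)) {δ : R} (hτ : τ = 2 * δ) :
    unitary (Cen R 1 τ) ≃* centGL (cMatrix δ) :=
  MulEquiv.ofBijective ((toGL splitEval hτ).codRestrict (centGL (cMatrix δ)) fun g => by
    have := toGL_mem_centGL splitEval hτ g
    rwa [splitEval_algebraMap] at this) (by
    constructor
    · intro g g' h
      have h1 : toGL splitEval hτ g = toGL splitEval hτ g' := congrArg Subtype.val h
      refine Subtype.ext (ext_toMatrix_splitEval h2 hτ (congrArg Units.val h1) ?_)
      rw [← coe_inv_toGL, ← coe_inv_toGL, h1]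
    · rintro ⟨M, hM⟩
      have hM' := (centGL (cMatrix δ)).inv_mem hM
      have e : splitEval (algebraMap R (QuadraticAlgebra R 1 0) δ) = δ := splitEval_algebraMap δ
      change Commute (M : Matrix (Fin 3) (Fin 3) R) _ at hM
      change Commute ((M⁻¹ : GL (Fin 3) R) : Matrix (Fin 3) (Fin 3) R) _ at hM'
      rw [← e] at hM hM'
      obtain ⟨a, ha, ha'⟩ := exists_splitEval h2 (M.1 0 0 - δ * M.1 0 2)
        ((M⁻¹).1 0 0 - δ * (M⁻¹).1 0 2)
      obtain ⟨c, hc, hc'⟩ := exists_splitEval h2 (M.1 0 2) ((M⁻¹).1 0 2)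
      obtain ⟨b, hb, hb'⟩ := exists_splitEval h2 (M.1 0 1) ((M⁻¹).1 1 2)
      obtain ⟨d, hd, hd'⟩ := exists_splitEval h2 (M.1 1 1) ((M⁻¹).1 1 1)
      obtain ⟨f, hf, hf'⟩ := exists_splitEval h2 (M.1 1 2) ((M⁻¹).1 0 1)
      let X : Cen R 1 τ := ⟨a, c, b, f, d⟩
      have h1 : toMatrix splitEval hτ X = M :=
        (toMatrix_eq_iff splitEval hτ hM).2 ⟨by rw [e]; exact ha, hc, hb, hf, hd⟩
      have h3 : toMatrix splitEval hτ (star X) = (M⁻¹ : GL (Fin 3) R) :=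
        (toMatrix_eq_iff splitEval hτ hM').2 ⟨by rw [e]; exact ha', hc', hf', hb', hd'⟩
      have hX : X ∈ unitary (Cen R 1 τ) := by
        rw [Unitary.mem_iff]
        constructor
        · refine ext_toMatrix_splitEval h2 hτ ?_ ?_
          · rw [map_mul, h1, h3, map_one, Units.inv_mul]
          · rw [star_mul, star_star, star_one, map_mul, h1, h3, map_one, Units.inv_mul]
        · refine ext_toMatrix_splitEval h2 hτ ?_ ?_
          · rw [map_mul, h1, h3, map_one, Units.mul_inv]
          · rw [star_mul, star_star, star_one, map_mul, h1, h3, map_one, Units.mul_inv]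
      exact ⟨⟨X, hX⟩, Subtype.ext (Units.ext h1)⟩)

end Split

/-! ### The unitary case -/

section Hermitian

variable {A : Type*} [CommRing A] (conj : A →+* A) (φ : QuadraticAlgebra R u 0 ≃+* A)
  (hφ : ∀ z, φ (star z) = conj (φ z)) {δ : R} (hτ : τ = 2 * δ)

include hφ in
/-- The operation `⋆` on matrices is the involution of the centraliser algebra: the reflection in
the antidiagonal exchanges the entries `b` and `e`. -/
theorem hermStar_toMatrix (X : Cen R u τ) :
    hermStar conj (toMatrix (φ : S →+* A) hτ X) = toMatrix (φ : S →+* A) hτ (star X) := by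
  have hδ : conj (φ (algebraMap R S δ)) = φ (algebraMap R S δ) := by rw [← hφ, star_algebraMap']
  ext i j
  fin_cases i <;> fin_cases j <;> simp [hermStar, toMatrix_apply, hφ, hδ, Fin.rev]

/-- The centraliser of `𝐜` in the unitary group, as the unitary group of the centraliser
algebra. -/
def unitaryEquivGU : unitary (Cen R u τ) ≃*
    (GU conj 3 ⊓ centGL (cMatrix (φ (algebraMap R S δ))) : Subgroup (GL (Fin 3) A)) :=
  MulEquiv.ofBijective ((toGL (φ : S →+* A) hτ).codRestrict _ fun g => by
    refine ⟨?_, toGL_mem_centGL (φ : S →+* A) hτ g⟩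
    change hermStar conj (toMatrix (φ : S →+* A) hτ g) * toMatrix (φ : S →+* A) hτ g = 1
    rw [hermStar_toMatrix conj φ hφ, ← map_mul, Unitary.star_mul_self_of_mem g.2, map_one]) (by
    have hinj := toMatrix_injective (φ : S →+* A) hτ φ.injective
    constructor
    · intro g g' h
      exact Subtype.ext (hinj (congrArg (fun M => M.1.1) h))
    · rintro ⟨M, hM, hMc⟩
      let X : Cen R u τ := ⟨φ.symm (M.1 0 0 - φ (algebraMap R S δ) * M.1 0 2), φ.symm (M.1 0 2),
        φ.symm (M.1 0 1), φ.symm (M.1 1 2), φ.symm (M.1 1 1)⟩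
      have hX : toMatrix (φ : S →+* A) hτ X = M :=
        (toMatrix_eq_iff (φ : S →+* A) hτ hMc).2 (by simp [X])
      have h1 : star X * X = 1 := hinj (by
        rw [map_mul, ← hermStar_toMatrix conj φ hφ, hX, map_one]
        exact hM)
      have h2 : X * star X = 1 := hinj (by
        rw [map_mul, ← hermStar_toMatrix conj φ hφ, hX, map_one]
        exact mul_eq_one_comm.1 hM)
      exact ⟨⟨X, Unitary.mem_iff.2 ⟨h1, h2⟩⟩, Subtype.ext (Units.ext hX)⟩)

end Hermitian

end Cen

/-! ### Unramified quadratic extensions -/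

section Quadratic

open Module

variable {o : Type*} [CommRing o] [IsDomain o] [IsDiscreteValuationRing o]
  {O : Type*} [CommRing O] [IsDomain O] [Algebra o O] [Module.Finite o O]

omit [IsDomain O] in
theorem faithfulSMul_of_finrank_eq_two (hquad : finrank o O = 2) : FaithfulSMul o O := by
  rw [faithfulSMul_iff_algebraMap_injective, injective_iff_map_eq_zero]
  intro r hr
  by_contra h0
  have : IsTorsion o O := fun {x} => ⟨⟨r, mem_nonZeroDivisors_of_ne_zero h0⟩, by
    change r • x = 0
    rw [Algebra.smul_def, hr, zero_mul]⟩
  rw [← finrank_eq_zero_iff_isTorsion] at this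
  omega

/-- An automorphism of a quadratic extension is an involution, as each element is a root of a
quadratic polynomial over the base. -/
theorem conj_conj_of_finrank_eq_two (hquad : finrank o O = 2) (conj : O ≃ₐ[o] O) (x : O) :
    conj (conj x) = x := by
  have := faithfulSMul_of_finrank_eq_two hquad
  obtain ⟨b, c, hx⟩ : ∃ b c : o, x * x + algebraMap o O b * x + algebraMap o O c = 0 := by
    have h := LinearMap.aeval_self_charpoly (LinearMap.mulLeft o x)
    have hdeg := LinearMap.charpoly_natDegree (LinearMap.mulLeft o x)
    have hlead := (LinearMap.charpoly_monic (LinearMap.mulLeft o x)).coeff_natDegree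
    rw [hquad] at hdeg
    rw [hdeg] at hlead
    rw [Polynomial.aeval_eq_sum_range, hdeg, Finset.sum_range_succ, Finset.sum_range_succ,
      Finset.sum_range_one, hlead] at h
    have h1 := LinearMap.congr_fun h 1
    refine ⟨(LinearMap.mulLeft o x).charpoly.coeff 1, (LinearMap.mulLeft o x).charpoly.coeff 0,
      Eq.trans ?_ h1⟩
    simp [pow_two, Algebra.smul_def]
    ring
  have hroot : ∀ y, y * y + algebraMap o O b * y + algebraMap o O c = 0 → conj y ≠ y →
      conj y = -algebraMap o O b - y := by
    intro y hy hne
    have hy' := congrArg conj hy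
    simp only [map_add, map_mul, AlgEquiv.commutes, map_zero] at hy'
    have h1 : (conj y - y) * (conj y - (-algebraMap o O b - y)) = 0 := by
      linear_combination hy' - hy
    exact sub_eq_zero.1 ((mul_eq_zero.1 h1).resolve_left (sub_ne_zero.2 hne))
  by_cases hne : conj x = x
  · rw [hne, hne]
  · have hx' := congrArg conj hx
    simp only [map_add, map_mul, AlgEquiv.commutes, map_zero] at hx'
    rw [hroot (conj x) hx' fun h => hne (conj.injective h), hroot x hx hne]
    ring

/-- A quadratic extension is generated by an element which is mapped to its negative by the
automorphism. -/
theorem exists_generator (h2 : IsUnit (2 : o)) (hquad : finrank o O = 2) (conj : O ≃ₐ[o] O)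
    (hconj : conj ≠ AlgEquiv.refl) : ∃ (ξ : O) (u : o), conj ξ = -ξ ∧
      ξ * ξ = algebraMap o O u ∧ (∀ z, ∃ x y, z = algebraMap o O x + algebraMap o O y * ξ) ∧
      ∀ x y, algebraMap o O x + algebraMap o O y * ξ = 0 → x = 0 ∧ y = 0 := by
  have hf := faithfulSMul_of_finrank_eq_two hquad
  have hinj := FaithfulSMul.algebraMap_injective o O
  have hcc := conj_conj_of_finrank_eq_two hquad conj
  have h2O : IsUnit (2 : O) := by
    have := h2.map (algebraMap o O)
    rwa [map_ofNat] at this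
  obtain ⟨t, ht⟩ := h2.exists_left_inv
  have ht' : algebraMap o O t * 2 = 1 := by
    rw [← map_one (algebraMap o O), ← ht, map_mul, map_ofNat]
  -- `O` is the sum of the eigenspaces `P` and `M` of the involution for `1` and `-1`, which are
  -- free of rank one; `P` is generated by `1`, as a generator of `P` divides `1`
  let P : Submodule o O := LinearMap.ker (conj.toLinearMap - LinearMap.id)
  let M : Submodule o O := LinearMap.ker (conj.toLinearMap + LinearMap.id)
  have hP : ∀ z, z ∈ P ↔ conj z = z := fun z => by
    simp [P, sub_eq_zero]
  have hM : ∀ z, z ∈ M ↔ conj z = -z := fun z => by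
    simp [M, add_eq_zero_iff_eq_neg]
  have hcompl : IsCompl P M := by
    constructor
    · rw [Submodule.disjoint_def]
      intro z h h'
      rw [hP] at h
      rw [hM] at h'
      apply h2O.mul_left_cancel
      linear_combination h' - h
    · rw [codisjoint_iff, eq_top_iff]
      intro z _
      refine Submodule.mem_sup.2 ⟨algebraMap o O t * (z + conj z), ?_,
        algebraMap o O t * (z - conj z), ?_, ?_⟩
      · rw [hP, map_mul, map_add, hcc, AlgEquiv.commutes, add_comm]
      · rw [hM, map_mul, map_sub, hcc, AlgEquiv.commutes]
        ring
      · linear_combination z * ht'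
  have hsum : finrank o P + finrank o M = 2 := by
    rw [← hquad, ← (Submodule.prodEquivOfIsCompl P M hcompl).finrank_eq, finrank_prod]
  have h1P : (1 : O) ∈ P := (hP 1).2 (map_one conj)
  have hPpos : finrank o P ≠ 0 := by
    have : Nontrivial P := ⟨⟨⟨1, h1P⟩, 0, fun h => one_ne_zero (congrArg Subtype.val h)⟩⟩
    exact finrank_pos.ne'
  have hMpos : finrank o M ≠ 0 := by
    obtain ⟨z, hz⟩ : ∃ z, conj z ≠ z := by
      by_contra! h
      exact hconj (AlgEquiv.ext h)
    have : Nontrivial M := ⟨⟨⟨z - conj z, (hM _).2 (by rw [map_sub, hcc, neg_sub])⟩, 0, fun h =>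
      hz (sub_eq_zero.1 (congrArg Subtype.val h)).symm⟩⟩
    exact finrank_pos.ne'
  obtain ⟨⟨η, hη⟩, -, hη'⟩ := finrank_eq_one_iff'.1 (show finrank o P = 1 by omega)
  obtain ⟨⟨ξ, hξ⟩, hξ0, hξ'⟩ := finrank_eq_one_iff'.1 (show finrank o M = 1 by omega)
  have hP' : ∀ z, conj z = z → ∃ x, z = algebraMap o O x := by
    intro z hz
    obtain ⟨s, hs⟩ := hη' ⟨1, h1P⟩
    obtain ⟨w, hw⟩ := hη' ⟨z, (hP z).2 hz⟩
    have hs := congrArg Subtype.val hs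
    have hw := congrArg Subtype.val hw
    simp only [SetLike.mk_smul_mk, Algebra.smul_def] at hs hw
    have hsu : IsUnit (algebraMap o O s) := .of_mul_eq_one _ hs
    obtain ⟨s', hs'⟩ := ((isUnit_map_iff (algebraMap o O) s).1 hsu).exists_left_inv
    have hs'' : algebraMap o O s' * algebraMap o O s = 1 := by
      rw [← map_mul, hs', map_one]
    refine ⟨w * s', ?_⟩
    rw [map_mul]
    linear_combination -hw + (algebraMap o O w * algebraMap o O s') * hs -
      algebraMap o O w * η * hs''
  have hcξ := (hM ξ).1 hξ
  have hξ0' : ξ ≠ 0 := fun h => hξ0 (Subtype.ext h)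
  obtain ⟨u, hu⟩ := hP' (ξ * ξ) (by rw [map_mul, hcξ, neg_mul_neg])
  refine ⟨ξ, u, hcξ, hu, fun z => ?_, fun x y h => ?_⟩
  · obtain ⟨x, hx⟩ := hP' (algebraMap o O t * (z + conj z)) (by
      rw [map_mul, map_add, hcc, AlgEquiv.commutes, add_comm])
    obtain ⟨y, hy⟩ := hξ' ⟨algebraMap o O t * (z - conj z), (hM _).2 (by
      rw [map_mul, map_sub, hcc, AlgEquiv.commutes]
      ring)⟩
    have hy := congrArg Subtype.val hy
    simp only [SetLike.mk_smul_mk, Algebra.smul_def] at hy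
    refine ⟨x, y, ?_⟩
    rw [hy, ← hx]
    linear_combination -z * ht'
  · have h' := congrArg conj h
    simp only [map_add, map_mul, AlgEquiv.commutes, map_zero, hcξ] at h'
    have hx : algebraMap o O x = 0 := by
      apply h2O.mul_left_cancel
      linear_combination h + h'
    rw [hx, zero_add] at h
    rw [map_eq_zero_iff _ hinj] at hx
    exact ⟨hx, (map_eq_zero_iff _ hinj).1 ((mul_eq_zero.1 h).resolve_right hξ0')⟩

variable [IsDiscreteValuationRing O] [Algebra.FormallyUnramified o O]

section

variable {conj : O ≃ₐ[o] O} {ξ : O} {u : o} (hξ : conj ξ = -ξ) (hu : ξ * ξ = algebraMap o O u)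
  (hspan : ∀ z, ∃ x y, z = algebraMap o O x + algebraMap o O y * ξ)
  (hind : ∀ x y, algebraMap o O x + algebraMap o O y * ξ = 0 → x = 0 ∧ y = 0)

include hu hspan hind in
/-- For an unramified extension the square of the generator is a unit: otherwise `ξ` would lie in
`𝔭 O`, against its being part of a basis. -/
theorem isUnit_of_generator [FaithfulSMul o O] : IsUnit u := by
  by_contra h
  have hm : ξ * ξ ∈ maximalIdeal O := by
    rw [hu, ← Algebra.FormallyUnramified.map_maximalIdeal (R := o)]
    exact Ideal.mem_map_of_mem _ ((mem_maximalIdeal u).2 h)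
  have hξm : ξ ∈ maximalIdeal O :=
    ((maximalIdeal.isMaximal O).isPrime.mem_or_mem hm).elim id id
  obtain ⟨ϖ, hϖ⟩ := IsDiscreteValuationRing.exists_irreducible o
  rw [← Algebra.FormallyUnramified.map_maximalIdeal (R := o), hϖ.maximalIdeal_eq,
    Ideal.map_span, Set.image_singleton, Ideal.mem_span_singleton] at hξm
  obtain ⟨z, hz⟩ := hξm
  obtain ⟨x, y, rfl⟩ := hspan z
  have := (hind (ϖ * x) (ϖ * y - 1) (by
    simp only [map_mul, map_sub, map_one]
    linear_combination -hz)).2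
  exact hϖ.not_isUnit (.of_mul_eq_one y (sub_eq_zero.1 this))

include hξ hu hspan hind in
/-- As `O` is local, the square of the generator is not a square in the residue field: otherwise
one of `ξ - v` and `ξ + v` would lie in the maximal ideal, and with its conjugate also `ξ`. -/
theorem not_isSquare_residue_of_generator [FaithfulSMul o O] (h2 : IsUnit (2 : o)) :
    ¬ IsSquare (residue o u) := by
  have hunit := isUnit_of_generator hu hspan hind
  rintro ⟨v, hv⟩
  obtain ⟨v, rfl⟩ := residue_surjective v
  rw [← map_mul, ← sub_eq_zero, ← map_sub, residue_eq_zero_iff] at hv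
  have hm : (ξ - algebraMap o O v) * (ξ + algebraMap o O v) ∈ maximalIdeal O := by
    rw [← Algebra.FormallyUnramified.map_maximalIdeal (R := o)]
    convert Ideal.mem_map_of_mem (algebraMap o O) hv using 1
    rw [map_sub, ← hu, map_mul]
    ring
  have hconj : ∀ z ∈ maximalIdeal O, conj z ∈ maximalIdeal O := by
    intro z hz
    rw [mem_maximalIdeal, mem_nonunits_iff] at *
    rwa [MulEquiv.isUnit_map]
  have h2O : IsUnit (2 : O) := by
    have := h2.map (algebraMap o O)
    rwa [map_ofNat] at this
  have hξm : ξ ∈ maximalIdeal O := by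
    rcases (maximalIdeal.isMaximal O).isPrime.mem_or_mem hm with h | h
    all_goals
      have h' := hconj _ h
      simp only [map_sub, map_add, hξ, AlgEquiv.commutes] at h'
      have h3 := sub_mem h h'
      refine ((maximalIdeal.isMaximal O).isPrime.mem_or_mem
        (x := 2) (y := ξ) (by convert h3 using 1; ring)).resolve_left ?_
      exact fun h => (mem_maximalIdeal _).1 h h2O
  have hum := Ideal.mul_mem_left _ ξ hξm
  rw [hu] at hum
  exact (mem_maximalIdeal _).1 hum (hunit.map _)

end

section

variable {conj : O ≃ₐ[o] O} {ξ : O} {u : o} (hξ : conj ξ = -ξ) (hu : ξ * ξ = algebraMap o O u)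
  (hspan : ∀ z, ∃ x y, z = algebraMap o O x + algebraMap o O y * ξ)
  (hind : ∀ x y, algebraMap o O x + algebraMap o O y * ξ = 0 → x = 0 ∧ y = 0)

omit [IsDiscreteValuationRing O] [Algebra.FormallyUnramified o O] [IsDomain O]
  [Module.Finite o O] in
include hξ hu hspan hind in
/-- The finite levels of a quadratic extension are quadratic algebras over the finite levels of
the base. -/
theorem exists_levelEquiv (ℓ : ℕ) :
    ∃ φ : QuadraticAlgebra (oLevel o ℓ) (Ideal.Quotient.mk _ u) 0 ≃+* OLevel o O ℓ,
      (∀ x, φ (algebraMap _ _ x) = levelMap ℓ x) ∧ ∀ z, φ (star z) = conjLevel conj ℓ (φ z) := by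
  have hmk : ∀ x : o, levelMap (O := O) ℓ (Ideal.Quotient.mk _ x) =
      Ideal.Quotient.mk _ (algebraMap o O x) := fun x => rfl
  have hcm : ∀ x : O, conjLevel conj ℓ (Ideal.Quotient.mk _ x) = Ideal.Quotient.mk _ (conj x) :=
    fun x => rfl
  let ξ' : OLevel o O ℓ := Ideal.Quotient.mk _ ξ
  have hξ' : ξ' * ξ' = levelMap ℓ (Ideal.Quotient.mk _ u) := by
    rw [hmk, ← hu, map_mul]
  let f : QuadraticAlgebra (oLevel o ℓ) (Ideal.Quotient.mk _ u) 0 →+* OLevel o O ℓ :=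
    { toFun := fun z => levelMap ℓ z.re + levelMap ℓ z.im * ξ'
      map_one' := by simp [QuadraticAlgebra.re_one, QuadraticAlgebra.im_one]
      map_mul' := fun z w => by
        simp
        linear_combination -(levelMap ℓ z.im * levelMap ℓ w.im) * hξ'
      map_zero' := by simp
      map_add' := fun z w => by
        simp
        ring }
  have hf : ∀ x y : o, f ⟨Ideal.Quotient.mk _ x, Ideal.Quotient.mk _ y⟩ =
      Ideal.Quotient.mk _ (algebraMap o O x + algebraMap o O y * ξ) := fun x y => by
    rw [map_add, map_mul]
    rfl
  have hbij : Function.Bijective f := by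
    constructor
    · rw [injective_iff_map_eq_zero]
      rintro ⟨x, y⟩ hz
      obtain ⟨x, rfl⟩ := Ideal.Quotient.mk_surjective x
      obtain ⟨y, rfl⟩ := Ideal.Quotient.mk_surjective y
      obtain ⟨ϖ, hϖ⟩ := IsDiscreteValuationRing.exists_irreducible o
      rw [hf, Ideal.Quotient.eq_zero_iff_mem, hϖ.maximalIdeal_eq, Ideal.span_singleton_pow,
        Ideal.map_span, Set.image_singleton, Ideal.mem_span_singleton] at hz
      obtain ⟨z, hz⟩ := hz
      obtain ⟨x', y', rfl⟩ := hspan z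
      obtain ⟨h1, h2⟩ := hind (x - ϖ ^ ℓ * x') (y - ϖ ^ ℓ * y') (by
        simp only [map_sub, map_mul]
        linear_combination hz)
      ext
      · exact Ideal.Quotient.eq_zero_iff_mem.2 ((mem_maximalIdeal_pow_iff hϖ).2
          ⟨x', sub_eq_zero.1 h1⟩)
      · exact Ideal.Quotient.eq_zero_iff_mem.2 ((mem_maximalIdeal_pow_iff hϖ).2
          ⟨y', sub_eq_zero.1 h2⟩)
    · intro z
      obtain ⟨z, rfl⟩ := Ideal.Quotient.mk_surjective z
      obtain ⟨x, y, rfl⟩ := hspan z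
      exact ⟨_, hf x y⟩
  refine ⟨RingEquiv.ofBijective f hbij, fun x => ?_, fun z => ?_⟩
  · change levelMap ℓ _ + levelMap ℓ _ * ξ' = _
    simp
  · obtain ⟨x, y⟩ := z
    obtain ⟨x, rfl⟩ := Ideal.Quotient.mk_surjective x
    obtain ⟨y, rfl⟩ := Ideal.Quotient.mk_surjective y
    rw [RingEquiv.ofBijective_apply, RingEquiv.ofBijective_apply]
    have e : star (⟨Ideal.Quotient.mk _ x, Ideal.Quotient.mk _ y⟩ :
        QuadraticAlgebra (oLevel o ℓ) (Ideal.Quotient.mk _ u) 0) =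
        ⟨Ideal.Quotient.mk _ x, Ideal.Quotient.mk _ (-y)⟩ := by
      ext <;> simp
    rw [e, hf, hf, hcm]
    congr 1
    simp [hξ]

end

end Quadratic

/-! ### The zeta functions of the centralisers -/

/-- The parameter `2 δ` is lifted to `o`, so that one parameter serves for all levels. -/
theorem exists_two_mul_eq_mk {o : Type*} [CommRing o] [IsLocalRing o] {ℓ : ℕ} {δ : oLevel o ℓ}
    (hδ : δ ∈ (maximalIdeal o).map (Ideal.Quotient.mk (maximalIdeal o ^ ℓ))) :
    ∃ τ ∈ maximalIdeal o, Ideal.Quotient.mk (maximalIdeal o ^ ℓ) τ = 2 * δ := by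
  obtain ⟨x, hx, rfl⟩ := (Ideal.mem_map_iff_of_surjective _ Ideal.Quotient.mk_surjective).1 hδ
  exact ⟨2 * x, Ideal.mul_mem_left _ _ hx, by rw [map_mul, map_ofNat]⟩

section

variable {o : Type*} [CommRing o] [IsDomain o] [IsDiscreteValuationRing o]
  [Finite (ResidueField o)] (hp : ringChar (ResidueField o) ≠ 2) {ℓ : ℕ} (hℓ : 1 ≤ ℓ)
  {δ : oLevel o ℓ} (hδ : δ ∈ (maximalIdeal o).map (Ideal.Quotient.mk (maximalIdeal o ^ ℓ)))
  {q : ℕ} (hq : q = Nat.card (ResidueField o))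

include hp hℓ hδ hq in
/-- The general linear case is the unitary group for the split algebra, with `q - 1` norm one
elements. -/
theorem repZeta_JL (s : ℂ) : repZeta (JL δ) s = zetaFormula q 1 ℓ s := by
  obtain ⟨τ, hτ, hτδ⟩ := exists_two_mul_eq_mk hδ
  have h2 := (isUnit_two_of_ringChar_ne_two hp).map (Ideal.Quotient.mk (maximalIdeal o ^ ℓ))
  rw [map_ofNat] at h2
  have hq1 : 1 ≤ q := hq ▸ Nat.card_pos
  have h := repZeta_unitary_cen hp isUnit_one hτ hq (N := q - 1) (ε := 1) (by
    rw [map_one, QuadraticAlgebra.card_unitary_split (Ring.two_ne_zero hp), hq])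
    (by push_cast [hq1]; rfl) hℓ s
  rw [← h]
  exact (Irr.repZeta_congr (Cen.unitaryEquivGL h2 hτδ) s).symm

variable {O : Type*} [CommRing O] [IsDomain O] [IsDiscreteValuationRing O]
    [Algebra o O] [Module.Finite o O] (hquad : Module.finrank o O = 2)
    [Algebra.FormallyUnramified o O]
    (conj : O ≃ₐ[o] O) (hconj : conj ≠ AlgEquiv.refl)

include hp hℓ hδ hq hquad hconj in
/-- The unitary case is the unitary group for a nonsplit algebra, with `q + 1` norm one elements. -/
theorem repZeta_JU (s : ℂ) :
    Finite (JU conj δ) ∧ repZeta (JU conj δ) s = zetaFormula q (-1) ℓ s := by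
  have h2 := isUnit_two_of_ringChar_ne_two hp
  have := faithfulSMul_of_finrank_eq_two hquad
  obtain ⟨ξ, u, hξ, hu, hspan, hind⟩ := exists_generator h2 hquad conj hconj
  obtain ⟨φ, hφ, hφs⟩ := exists_levelEquiv hξ hu hspan hind ℓ
  obtain ⟨τ, hτ, hτδ⟩ := exists_two_mul_eq_mk hδ
  have h := repZeta_unitary_cen hp (isUnit_of_generator hu hspan hind) hτ hq (N := q + 1)
    (ε := -1) (by
      rw [QuadraticAlgebra.card_unitary_of_not_isSquare (Ring.two_ne_zero hp)
        (not_isSquare_residue_of_generator hξ hu hspan hind h2), hq])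
    (by push_cast; ring) hℓ s
  have e := Cen.unitaryEquivGU (conjLevel conj ℓ) φ hφs hτδ
  rw [hφ] at e
  change _ ≃* JU conj δ at e
  have hfin : Finite (JU conj δ) := Finite.of_equiv _ e.toEquiv
  exact ⟨hfin, (Irr.repZeta_congr e s).symm.trans h⟩

end

end

theorem mainTheorem8
    {o : Type*} [CommRing o] [IsDomain o] [IsDiscreteValuationRing o]
    [IsAdicComplete (IsLocalRing.maximalIdeal o) o]
    [Finite (IsLocalRing.ResidueField o)]
    (hp : ringChar (IsLocalRing.ResidueField o) ≠ 2)
    {O : Type*} [CommRing O] [IsDomain O] [IsDiscreteValuationRing O]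
    [Algebra o O] [Module.Finite o O] (hquad : Module.finrank o O = 2)
    [Algebra.FormallyUnramified o O]
    (conj : O ≃ₐ[o] O) (hconj : conj ≠ AlgEquiv.refl)
    (ℓ : ℕ) (hℓ : 1 ≤ ℓ) (δ : oLevel o ℓ)
    (hδ : δ ∈ (IsLocalRing.maximalIdeal o).map
      (Ideal.Quotient.mk (IsLocalRing.maximalIdeal o ^ ℓ)))
    (q : ℕ) (hq : q = Nat.card (IsLocalRing.ResidueField o)) :
    (Finite (Irr (JL δ)) ∧ Finite (Irr (JU conj δ))) ∧
    (ℓ = 1 → ∀ s : ℂ,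
      repZeta (JL δ) s = zetaFormulaOne q 1 s ∧
      repZeta (JU conj δ) s = zetaFormulaOne q (-1) s) ∧
    (2 ≤ ℓ → ∀ s : ℂ,
      repZeta (JL δ) s = zetaFormula q 1 ℓ s ∧
      repZeta (JU conj δ) s = zetaFormula q (-1) ℓ s) := by
  have hL := repZeta_JL hp hℓ hδ hq
  have hU := fun s => (repZeta_JU hp hℓ hδ hq hquad conj hconj s).2
  have hfin := (repZeta_JU hp hℓ hδ hq hquad conj hconj 0).1
  refine ⟨⟨inferInstance, inferInstance⟩, ?_, fun _ s => ⟨hL s, hU s⟩⟩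
  rintro rfl s
  rw [zetaFormulaOne_eq, zetaFormulaOne_eq]
  exact ⟨hL s, hU s⟩
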